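/- For a finite group $G$, call a sequence $(g_1,\dots,g_n)$ of elements of $G$ an irredundant generating sequence if $g_1,\dots,g_n$ generate $G$ but, for every $j$, the terms $g_i$ with $i\ne j$ do not generate $G$; let $m(G)$ denote the maximal length of an irredundant generating sequence of $G$ (equivalently, the maximal size of an irredundant generating set). Let $p>3$ be a prime with $p\not\equiv\pm 1 \pmod{10}$, and let $G=\mathrm{PSL}(2,p)$ be the projective special linear group of degree $2$ over the field with $p$ elements. Then $m(G)=3$ if $p\neq 7$, and $m(G)=4$ if $p=7$. -/

import Mathlib

/-- A finite sequence `g` of elements of a group `G` is an irredundant generating sequence if it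
generates `G`, but after removing any one term the remaining terms no longer generate `G`. -/
def IsIrredundantGenerating {G : Type*} [Group G] {n : ℕ} (g : Fin n → G) : Prop :=
  Subgroup.closure (Set.range g) = ⊤ ∧
    ∀ j : Fin n, Subgroup.closure (g '' {i | i ≠ j}) ≠ ⊤

/-- `m(G)`: the largest length of an irredundant generating sequence of `G`, as an extended natural
number. The terms of such a sequence are pairwise distinct, so this is also the largest size of an
irredundant finite generating set. -/
noncomputable def maxIrredundantLength (G : Type*) [Group G] : ℕ∞ :=
  ⨆ n ∈ {n : ℕ | ∃ g : Fin n → G, IsIrredundantGenerating g}, (n : ℕ∞)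

/-! ### Klein's orbit count for finite groups of Möbius transformations -/

section OrbitCounting

/-! `PSL(2, p)` acts on the projective line over an algebraic closure of the prime field. A
nontrivial element has at most two fixed points, and exactly two when its order is prime to `p`;
passing to the closure is what supplies the fixed points of elements of nonsplit tori. A proper
subgroup of order divisible by `p` fixes a point, because two transvections with different axes
generate everything (`fixesPoint_of_char_dvd_card`). For order prime to `p`, Burnside counting in
the style of Klein leaves groups fixing a point, groups stabilizing a pair, and orders 12, 24 and
60. An element of order five prime to `p` makes 5 a square mod `p`, which the congruence condition
forbids, and what remains embeds in the symmetric group of degree four. This is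
`MoebiusAction.trichotomy`.

Upper bound. Let an irredundant generating sequence have at least four terms, and look at the
subgroups obtained by dropping one term. None fixes a point and at most two stabilize a pair, since
otherwise one term would be redundant or there would be a nontrivial central element. If one of them
embeds in `S₄`, then any three of its generators already generate it
(`IndependentTriple.octahedral`). Hence the length is four (`MoebiusAction.length_eq_four`), and a
case analysis shows that all four terms are involutions (`MoebiusAction.orderOf_eq_two`) with
pairwise products of order 2, 3 or 4.

Involutions lift to traceless matrices, which form a three-dimensional quadratic space under the
trace form, so the Gram determinant of four of them vanishes (`gramPoly_traceForm`). The orders of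
the products determine the squares of the Gram entries. Running through the labelings of the
complete graph on four vertices, the determinant is nonzero away from the characteristics 2, 3, 5
and 7 (`gramPoly_ne_zero`), except for two labelings in which one involution is, up to sign, a word
in the others. Characteristic 5 is excluded because a length-four sequence requires a square root of
2 (`MoebiusAction.exists_sq_eq_two`).

Lower bounds come from explicit sequences: three involutions for every `p > 3`, where two
involutions can never generate a nonabelian simple group, and four involutions for `p = 7`, any
three of which normalize a Klein four-group. -/

theorem orbit_size_equation {N n₁ n₂ n₃ e₁ e₂ e₃ : ℕ} (h₁ : e₁ * n₁ = N) (h₂ : e₂ * n₂ = N)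
    (h₃ : e₃ * n₃ = N) (two₁ : 2 ≤ e₁) (two₂ : 2 ≤ e₂) (two₃ : 2 ≤ e₃) (three₁ : 3 ≤ n₁)
    (three₂ : 3 ≤ n₂) (three₃ : 3 ≤ n₃) (h : n₁ + n₂ + n₃ = N + 2) :
    (N = 12 ∨ N = 24 ∨ N = 60) ∧ e₁ ≤ 5 ∧ e₂ ≤ 5 ∧ e₃ ≤ 5 := by
  -- Divided by `N` the equation reads `1/e₁ + 1/e₂ + 1/e₃ = 1 + 2/N`. Its solutions are (2,3,3),
  -- (2,3,4), (2,3,5) and the dihedral family (2,2,k). The latter has an orbit of size two and is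
  -- ruled out by the bounds `3 ≤ nᵢ`.
  have key : ∀ {a b c m₁ m₂ m₃ : ℕ}, a * m₁ = N → b * m₂ = N → c * m₃ = N → 2 ≤ c →
      3 ≤ m₁ → 3 ≤ m₂ → 3 ≤ m₃ → m₁ + m₂ + m₃ = N + 2 → a = 2 → b = 3 →
      (N = 12 ∨ N = 24 ∨ N = 60) ∧ a ≤ 5 ∧ b ≤ 5 ∧ c ≤ 5 := by
    rintro a b c m₁ m₂ m₃ k₁ k₂ k₃ c2 t₁ t₂ t₃ k rfl rfl
    have hc : c < 6 := by
      by_contra! hc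
      have := Nat.mul_le_mul_right m₃ hc
      omega
    interval_cases c <;> omega
  have key' : ∀ {a b c m₁ m₂ m₃ : ℕ}, a * m₁ = N → b * m₂ = N → c * m₃ = N → 2 ≤ b → 2 ≤ c →
      3 ≤ m₁ → 3 ≤ m₂ → 3 ≤ m₃ → m₁ + m₂ + m₃ = N + 2 → a = 2 →
      (N = 12 ∨ N = 24 ∨ N = 60) ∧ a ≤ 5 ∧ b ≤ 5 ∧ c ≤ 5 := by
    rintro a b c m₁ m₂ m₃ k₁ k₂ k₃ b2 c2 t₁ t₂ t₃ k rfl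
    obtain hb | hb | hb : b = 2 ∨ b = 3 ∨ 4 ≤ b := by omega
    · subst hb; omega
    · exact key k₁ k₂ k₃ c2 t₁ t₂ t₃ k rfl hb
    obtain hc | hc | hc : c = 2 ∨ c = 3 ∨ 4 ≤ c := by omega
    · subst hc; omega
    · have := key k₁ k₃ k₂ b2 t₁ t₃ t₂ (by omega) rfl hc
      tauto
    · have := Nat.mul_le_mul_right m₂ hb
      have := Nat.mul_le_mul_right m₃ hc
      omega
  obtain h1 | h1 : e₁ = 2 ∨ 3 ≤ e₁ := by omega
  · exact key' h₁ h₂ h₃ two₂ two₃ three₁ three₂ three₃ h h1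
  obtain h2 | h2 : e₂ = 2 ∨ 3 ≤ e₂ := by omega
  · have := key' h₂ h₁ h₃ two₁ two₃ three₂ three₁ three₃ (by omega) h2
    tauto
  obtain h3 | h3 : e₃ = 2 ∨ 3 ≤ e₃ := by omega
  · have := key' h₃ h₁ h₂ two₁ two₂ three₃ three₁ three₂ (by omega) h3
    tauto
  have := Nat.mul_le_mul_right n₁ h1
  have := Nat.mul_le_mul_right n₂ h2
  have := Nat.mul_le_mul_right n₃ h3
  omega

open MulAction in
/-- A finite group acting on a finite set such that every non-identity element has exactly two
fixed points, every point is fixed by some non-identity element, and every orbit has at least three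
points. -/
theorem card_of_two_fixed_points {Γ Y : Type*} [Group Γ] [MulAction Γ Y] [Finite Γ] [Finite Y]
    [Nonempty Y]
    (hfix : ∀ g : Γ, g ≠ 1 → Nat.card (fixedBy Y g) = 2)
    (hstab : ∀ y : Y, 2 ≤ Nat.card (stabilizer Γ y))
    (horb : ∀ y : Y, 3 ≤ Nat.card (orbit Γ y)) :
    (Nat.card Γ = 12 ∨ Nat.card Γ = 24 ∨ Nat.card Γ = 60) ∧
      ∀ y : Y, Nat.card (stabilizer Γ y) ≤ 5 := by
  classical
  have := Fintype.ofFinite Γ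
  have := Fintype.ofFinite Y
  let Ω := orbitRel.Quotient Γ Y
  let n : Ω → ℕ := fun ω => Nat.card ω.orbit
  have hn : ∀ y : Y, n (Quotient.mk'' y) = Nat.card (orbit Γ y) := fun y => rfl
  have hmul : ∀ y : Y, Nat.card (stabilizer Γ y) * n (Quotient.mk'' y) = Nat.card Γ := by
    intro y
    rw [hn, mul_comm]
    simpa only [Nat.card_eq_fintype_card] using card_orbit_mul_card_stabilizer_eq_card_group Γ y
  have hY : Nat.card Y = ∑ ω : Ω, n ω := by
    rw [Nat.card_congr (selfEquivSigmaOrbits' Γ Y), Nat.card_sigma]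
  -- Burnside's lemma: the identity contributes all of `Y`, every other element contributes two.
  have hburn : Nat.card Y + 2 * (Nat.card Γ - 1) = Nat.card Ω * Nat.card Γ := by
    have h := sum_card_fixedBy_eq_card_orbits_mul_card_group Γ Y
    rw [← Finset.add_sum_erase _ _ (Finset.mem_univ (1 : Γ))] at h
    have h2 : ∑ g ∈ Finset.univ.erase (1 : Γ), Fintype.card (fixedBy Y g)
        = 2 * (Nat.card Γ - 1) := by
      rw [Finset.sum_congr rfl (g := fun _ => 2)]
      · simp [Finset.card_erase_of_mem, mul_comm]
      · intro g hg
        rw [← Nat.card_eq_fintype_card]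
        exact hfix g (Finset.ne_of_mem_erase hg)
    have h1 : Fintype.card (fixedBy Y (1 : Γ)) = Nat.card Y := by
      rw [← Nat.card_eq_fintype_card, fixedBy_one_eq_univ, Nat.card_univ]
    rw [h1, h2] at h
    rw [h, ← Nat.card_eq_fintype_card, ← Nat.card_eq_fintype_card]
  have hpos : 0 < Nat.card Γ := Nat.card_pos
  have h3 : ∀ ω, 3 ≤ n ω := fun ω => by
    induction ω using Quotient.inductionOn' with | h y => exact horb y
  have h2 : ∀ ω, 2 * n ω ≤ Nat.card Γ := fun ω => by
    induction ω using Quotient.inductionOn' with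
    | h y => rw [← hmul y]; exact Nat.mul_le_mul_right _ (hstab y)
  have hsum : 2 * Nat.card Y ≤ Nat.card Ω * Nat.card Γ := by
    rw [hY, Finset.mul_sum, Nat.card_eq_fintype_card (α := Ω), ← smul_eq_mul]
    exact Finset.sum_le_card_nsmul _ _ _ fun ω _ => h2 ω
  -- Nontrivial stabilizers give orbits of size at most `|Γ|/2`, so `|Ω||Γ|/2 ≤ 2(|Γ| - 1)` and
  -- there are fewer than four orbits.
  have hle : Nat.card Ω ≤ 3 := by
    by_contra! h
    nlinarith [Nat.sub_add_cancel hpos]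
  obtain ⟨y₀⟩ := ‹Nonempty Y›
  -- With one orbit, or with two, the count leaves at most two points in all, while each orbit has
  -- at least three.
  have hΩ : Nat.card Ω = 3 := by
    have h0 : 0 < Nat.card Ω := by
      have : Nonempty Ω := ⟨Quotient.mk'' y₀⟩
      exact Nat.card_pos
    obtain h | h | h : Nat.card Ω = 1 ∨ Nat.card Ω = 2 ∨ Nat.card Ω = 3 := by omega
    · rw [h] at hburn
      have := h3 (Quotient.mk'' y₀)
      have := h2 (Quotient.mk'' y₀)
      omega
    · obtain ⟨e⟩ : Nonempty (Ω ≃ Fin 2) := ⟨(Finite.equivFin Ω).trans (finCongr h)⟩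
      rw [← e.symm.sum_comp, Fin.sum_univ_two] at hY
      rw [h] at hburn
      have := h3 (e.symm 0)
      have := h3 (e.symm 1)
      omega
    · exact h
  obtain ⟨e⟩ : Nonempty (Ω ≃ Fin 3) := ⟨(Finite.equivFin Ω).trans (finCongr hΩ)⟩
  rw [← e.symm.sum_comp, Fin.sum_univ_three] at hY
  rw [hΩ] at hburn
  have hex : ∀ ω : Ω, ∃ k, k * n ω = Nat.card Γ ∧ 2 ≤ k := fun ω => by
    induction ω using Quotient.inductionOn' with
    | h y => exact ⟨_, hmul y, hstab y⟩
  choose k hk hk2 using hex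
  have hky : ∀ y : Y, Nat.card (stabilizer Γ y) = k (Quotient.mk'' y) := fun y => by
    have := (hmul y).trans (hk (Quotient.mk'' y)).symm
    have h3y := h3 (Quotient.mk'' y)
    exact Nat.eq_of_mul_eq_mul_right (by omega) this
  obtain ⟨hN, k0, k1, k2⟩ := orbit_size_equation (hk (e.symm 0)) (hk (e.symm 1)) (hk (e.symm 2))
    (hk2 _) (hk2 _) (hk2 _) (h3 _) (h3 _) (h3 _) (by omega)
  refine ⟨hN, fun y => ?_⟩
  rw [hky y]
  obtain ⟨i, hi⟩ := e.symm.surjective (Quotient.mk'' y)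
  rw [← hi]
  fin_cases i
  exacts [k0, k1, k2]

end OrbitCounting


/-! ### Finite groups whose nontrivial elements fix exactly two points -/

section SmallSubgroups

open MulAction

/-- `H` fixes some point of `X`. -/
def FixesPoint {G : Type*} [Group G] (H : Subgroup G) (X : Type*) [MulAction G X] : Prop :=
  ∃ a : X, ∀ h ∈ H, h • a = a

/-- `H` stabilizes a set of two points of `X`. -/
def FixesPair {G : Type*} [Group G] (H : Subgroup G) (X : Type*) [MulAction G X] : Prop :=
  ∃ a b : X, a ≠ b ∧ ∀ h ∈ H, (h • a = a ∧ h • b = b) ∨ (h • a = b ∧ h • b = a)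

variable {Γ X : Type*} [Group Γ] [MulAction Γ X]

/-- Elements with three fixed points are trivial. -/
def ThreeFixedPointsTrivial (Γ X : Type*) [Group Γ] [MulAction Γ X] : Prop :=
  ∀ (g : Γ) {a b c : X}, a ≠ b → a ≠ c → b ≠ c → g • a = a → g • b = b → g • c = c → g = 1

theorem ThreeFixedPointsTrivial.eq_or_eq (h3 : ThreeFixedPointsTrivial Γ X) {g : Γ} (hg : g ≠ 1)
    {a b c : X} (hab : a ≠ b) (ha : g • a = a) (hb : g • b = b) (hc : g • c = c) :
    c = a ∨ c = b := by
  by_contra! h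
  exact hg (h3 g hab h.1.symm h.2.symm ha hb hc)

/-- An element normalizing `⟨k⟩` permutes the two fixed points of `k`. -/
theorem ThreeFixedPointsTrivial.permutes (h3 : ThreeFixedPointsTrivial Γ X) {k h : Γ} (hk : k ≠ 1)
    {a b : X} (hab : a ≠ b) (ha : k • a = a) (hb : k • b = b)
    (hn : h⁻¹ * k * h ∈ Subgroup.zpowers k) :
    (h • a = a ∧ h • b = b) ∨ (h • a = b ∧ h • b = a) := by
  have hz : ∀ x : X, k • x = x → h⁻¹ * k * h ∈ stabilizer Γ x := fun x hx =>
    (Subgroup.zpowers_le.mpr (mem_stabilizer_iff.mpr hx)) hn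
  have hfix : ∀ x : X, k • x = x → h • x = a ∨ h • x = b := fun x hx => by
    refine h3.eq_or_eq hk hab ha hb ?_
    have := mem_stabilizer_iff.mp (hz x hx)
    rw [mul_smul, mul_smul, inv_smul_eq_iff] at this
    exact this
  have hne : h • a ≠ h • b := fun h' => hab (smul_left_cancel _ h')
  rcases hfix a ha with h1 | h1 <;> rcases hfix b hb with h2 | h2
  · exact absurd (h1.trans h2.symm) hne
  · exact Or.inl ⟨h1, h2⟩
  · exact Or.inr ⟨h1, h2⟩
  · exact absurd (h1.trans h2.symm) hne

/-- The points fixed by some non-identity element. -/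
def ramifiedPoints (Γ X : Type*) [Group Γ] [MulAction Γ X] : SubMulAction Γ X where
  carrier := {x | ∃ g : Γ, g ≠ 1 ∧ g • x = x}
  smul_mem' := by
    rintro c x ⟨g, hg, hx⟩
    refine ⟨c * g * c⁻¹, by simpa using hg, ?_⟩
    rw [mul_smul, mul_smul, inv_smul_smul, hx]

/-- Here `X` may be infinite, so the count is applied to the points with nontrivial stabilizer, a
finite invariant set. An orbit of size one or two there is an invariant point or pair, which `hpt`
and `hpair` exclude. -/
theorem card_of_two_fixed_points' [Finite Γ] [Nontrivial Γ]
    (h3 : ThreeFixedPointsTrivial Γ X)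
    (h2 : ∀ g : Γ, g ≠ 1 → ∃ a b : X, a ≠ b ∧ g • a = a ∧ g • b = b)
    (hpt : ¬ ∃ a : X, ∀ g : Γ, g • a = a)
    (hpair : ¬ ∃ a b : X, a ≠ b ∧ ∀ g : Γ, (g • a = a ∧ g • b = b) ∨ (g • a = b ∧ g • b = a)) :
    (Nat.card Γ = 12 ∨ Nat.card Γ = 24 ∨ Nat.card Γ = 60) ∧
      ∀ x : X, (∃ g : Γ, g ≠ 1 ∧ g • x = x) → Nat.card (stabilizer Γ x) ≤ 5 := by
  let Y := ramifiedPoints Γ X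
  have hfin : Finite Y := by
    refine Set.Finite.to_subtype (s := {x | ∃ g : Γ, g ≠ 1 ∧ g • x = x}) ?_
    refine Set.Finite.subset (Set.finite_iUnion (ι := {g : Γ // g ≠ 1})
      (f := fun g => fixedBy X g.1) fun g => ?_) ?_
    · obtain ⟨a, b, hab, ha, hb⟩ := h2 g.1 g.2
      exact (Set.toFinite {a, b}).subset fun c hc => h3.eq_or_eq g.2 hab ha hb hc
    · rintro x ⟨g, hg, hx⟩
      exact Set.mem_iUnion.mpr ⟨⟨g, hg⟩, hx⟩
  obtain ⟨g₀, hg₀⟩ := exists_ne (1 : Γ)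
  obtain ⟨a₀, b₀, -, ha₀, -⟩ := h2 g₀ hg₀
  have : Nonempty Y := ⟨⟨a₀, g₀, hg₀, ha₀⟩⟩
  have hst : ∀ y : Y, stabilizer Γ y = stabilizer Γ (y : X) := fun y => by
    ext g
    simp [mem_stabilizer_iff, Subtype.ext_iff]
  have key := card_of_two_fixed_points (Γ := Γ) (Y := Y) ?_ ?_ ?_
  · refine ⟨key.1, fun x hx => ?_⟩
    have := key.2 ⟨x, hx⟩
    rwa [hst] at this
  · intro g hg
    obtain ⟨a, b, hab, ha, hb⟩ := h2 g hg
    have : fixedBy Y g = {⟨a, g, hg, ha⟩, ⟨b, g, hg, hb⟩} := by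
      ext y
      simp only [mem_fixedBy, Set.mem_insert_iff, Set.mem_singleton_iff, Subtype.ext_iff,
        SubMulAction.val_smul]
      constructor
      · exact fun h => h3.eq_or_eq hg hab ha hb h
      · rintro (h | h) <;> rw [h] <;> assumption
    rw [this, Nat.card_coe_set_eq]
    exact Set.ncard_pair fun h => hab (congrArg Subtype.val h)
  · rintro ⟨y, g, hg, hy⟩
    rw [hst]
    have : Nontrivial (stabilizer Γ y) := ⟨⟨g, hy⟩, 1, fun h => hg (congrArg Subtype.val h)⟩
    exact Finite.one_lt_card
  · intro y
    by_contra! h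
    have : Nonempty (orbit Γ y) := (nonempty_orbit y).to_subtype
    have hpos : 0 < Nat.card (orbit Γ y) := Nat.card_pos
    rw [Nat.card_coe_set_eq] at h hpos
    obtain h1 | h1 : (orbit Γ y).ncard = 1 ∨ (orbit Γ y).ncard = 2 := by omega
    · obtain ⟨a, ha⟩ := Set.ncard_eq_one.mp h1
      refine hpt ⟨y, fun g => ?_⟩
      have e1 : g • y ∈ orbit Γ y := mem_orbit y g
      have e2 : y ∈ orbit Γ y := mem_orbit_self y
      rw [ha, Set.mem_singleton_iff] at e1 e2
      rw [← SubMulAction.val_smul, e1, e2]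
    · obtain ⟨a, b, hab, hs⟩ := Set.ncard_eq_two.mp h1
      refine hpair ⟨a, b, fun h => hab (Subtype.ext h), fun g => ?_⟩
      have ea : g • a ∈ orbit Γ y := (mem_orbit_of_mem_orbit g (by rw [hs]; simp))
      have eb : g • b ∈ orbit Γ y := (mem_orbit_of_mem_orbit g (by rw [hs]; simp))
      have hne : g • a ≠ g • b := fun h' => hab (smul_left_cancel _ h')
      rw [hs] at ea eb
      simp only [Set.mem_insert_iff, Set.mem_singleton_iff] at ea eb
      simp only [← SubMulAction.val_smul, ← Subtype.ext_iff]
      rcases ea with h1 | h1 <;> rcases eb with h2 | h2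
      · exact absurd (h1.trans h2.symm) hne
      · exact Or.inl ⟨h1, h2⟩
      · exact Or.inr ⟨h1, h2⟩
      · exact absurd (h1.trans h2.symm) hne

/-- A finite group whose non-identity elements have exactly two fixed points embeds into `S₄`,
unless it fixes a point, stabilizes a pair of points, or has an element of order five. -/
theorem exists_embedding_perm_four [Finite Γ]
    (h3 : ThreeFixedPointsTrivial Γ X)
    (h2 : ∀ g : Γ, g ≠ 1 → ∃ a b : X, a ≠ b ∧ g • a = a ∧ g • b = b)
    (h5 : ∀ g : Γ, orderOf g ≠ 5) [Nonempty X]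
    (hpt : ¬ ∃ a : X, ∀ g : Γ, g • a = a)
    (hpair : ¬ ∃ a b : X, a ≠ b ∧ ∀ g : Γ, (g • a = a ∧ g • b = b) ∨ (g • a = b ∧ g • b = a)) :
    ∃ ψ : Γ →* Equiv.Perm (Fin 4), Function.Injective ψ := by
  have hnt : Nontrivial Γ := by
    by_contra h
    rw [not_nontrivial_iff_subsingleton] at h
    obtain ⟨a⟩ := ‹Nonempty X›
    exact hpt ⟨a, fun g => by rw [Subsingleton.elim g 1, one_smul]⟩
  obtain ⟨hN, hst⟩ := card_of_two_fixed_points' h3 h2 hpt hpair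
  have hN' : Nat.card Γ = 12 ∨ Nat.card Γ = 24 := by
    rcases hN with h | h | h
    · exact Or.inl h
    · exact Or.inr h
    · have : Fact (Nat.Prime 5) := ⟨by norm_num⟩
      obtain ⟨g, hg⟩ := exists_prime_orderOf_dvd_card' (G := Γ) 5 (by rw [h]; norm_num)
      exact absurd hg (h5 g)
  have : Fact (Nat.Prime 3) := ⟨by norm_num⟩
  have hcard : ∀ P : Sylow 3 Γ, Nat.card P = 3 := fun P => by
    rw [P.card_eq_multiplicity]
    have h12 : Nat.factorization 12 3 = 1 := by
      rw [show 12 = 3 ^ 1 * 4 by norm_num, Nat.factorization_mul (by norm_num) (by norm_num)]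
      simp [Nat.prime_three.factorization_self, Nat.factorization_eq_zero_of_not_dvd (n := 4) (p :=
          3) (by norm_num)]
    have h24 : Nat.factorization 24 3 = 1 := by
      rw [show 24 = 3 ^ 1 * 8 by norm_num, Nat.factorization_mul (by norm_num) (by norm_num)]
      simp [Nat.prime_three.factorization_self, Nat.factorization_eq_zero_of_not_dvd (n := 8) (p :=
          3) (by norm_num)]
    rcases hN' with h | h <;> rw [h] <;> simp [h12, h24]
  have hgen : ∀ P : Sylow 3 Γ, ∃ t : Γ, t ≠ 1 ∧ t ∈ P ∧ (P : Subgroup Γ) = Subgroup.zpowers t := by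
    intro P
    obtain ⟨t, ht⟩ := exists_prime_orderOf_dvd_card' (G := P) 3 (by rw [hcard P])
    have ht' : orderOf (t : Γ) = 3 := by rw [Subgroup.orderOf_coe, ht]
    refine ⟨t, fun h => by simp [h] at ht', t.2, ?_⟩
    symm
    refine Subgroup.eq_of_le_of_card_ge (Subgroup.zpowers_le.mpr t.2) ?_
    rw [Nat.card_zpowers, ht']
    exact (hcard P).le
  choose t ht1 htP htz using hgen
  choose a b hab hta htb using fun P => h2 (t P) (ht1 P)
  -- The stabilizer has order divisible by 3 and at most 5, hence 3.
  have hstab : ∀ P : Sylow 3 Γ, ∀ x : X, t P • x = x → stabilizer Γ x = (P : Subgroup Γ) := by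
    intro P x hx
    have hle : (P : Subgroup Γ) ≤ stabilizer Γ x := by
      rw [htz P]; exact Subgroup.zpowers_le.mpr hx
    have hd := Subgroup.card_dvd_of_le hle
    have h5 := hst x ⟨t P, ht1 P, hx⟩
    have hpos : 0 < Nat.card (stabilizer Γ x) := Nat.card_pos
    change Nat.card P ∣ _ at hd
    rw [hcard P] at hd
    symm
    refine Subgroup.eq_of_le_of_card_ge hle ?_
    rw [hcard P]
    omega
  have hnorm : ∀ P : Sylow 3 Γ, ∀ k : Γ, k • P = P →
      (k • a P = a P ∧ k • b P = b P) ∨ (k • a P = b P ∧ k • b P = a P) := by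
    intro P k hk
    refine h3.permutes (ht1 P) (hab P) (hta P) (htb P) ?_
    rw [← htz P]
    have := (Sylow.smul_eq_iff_mem_normalizer.mp hk)
    have := Subgroup.mem_normalizer_iff.mp (inv_mem this) (t P)
    simpa using this.mp (htP P)
  have hcs : Nat.card (Sylow 3 Γ) = 1 ∨ Nat.card (Sylow 3 Γ) = 4 := by
    have h1 := card_sylow_modEq_one 3 Γ
    obtain ⟨P⟩ : Nonempty (Sylow 3 Γ) := inferInstance
    have hd := P.card_dvd_index
    have hi := (P : Subgroup Γ).card_mul_index
    change Nat.card P * _ = _ at hi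
    rw [hcard P] at hi
    have hle := Nat.le_of_dvd (by omega) hd
    unfold Nat.ModEq at h1
    generalize Nat.card (Sylow 3 Γ) = n at *
    have hi' : (P : Subgroup Γ).index = 4 ∨ (P : Subgroup Γ).index = 8 := by omega
    rcases hi' with h | h <;> rw [h] at hd hle <;> interval_cases n <;> simp_all
  obtain hc1 | hc4 := hcs
  -- A normal Sylow subgroup would make its pair of fixed points invariant.
  · exfalso
    obtain ⟨P⟩ : Nonempty (Sylow 3 Γ) := inferInstance
    have hs : Subsingleton (Sylow 3 Γ) := (Nat.card_eq_one_iff_unique.mp hc1).1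
    exact hpair ⟨a P, b P, hab P, fun g => hnorm P g (Subsingleton.elim _ _)⟩
  let φ := MulAction.toPermHom Γ (Sylow 3 Γ)
  -- A kernel element fixing `a P` lies in `P` and has trivial cube, so it cannot swap the fixed
  -- pair of another Sylow subgroup `Q`; it then has three fixed points and is trivial. Hence all
  -- nontrivial kernel elements swap `a P` and `b P`. Any two of them agree, so there is only one;
  -- it is central, and its own pair of fixed points is invariant.
  have hinj : Function.Injective φ := by
    rw [injective_iff_map_eq_one]
    by_contra! hker
    obtain ⟨k, hk, hk1⟩ := hker
    have hmem : ∀ l : Γ, φ l = 1 → ∀ P : Sylow 3 Γ, l • P = P := fun l hl P =>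
      congrArg (fun e : Equiv.Perm (Sylow 3 Γ) => e P) hl
    have hfixed : ∀ l : Γ, φ l = 1 → ∀ P, l • a P = a P → l = 1 := by
      intro l hl P hlP
      have hlP' : l ∈ (P : Subgroup Γ) := by rw [← hstab P _ (hta P)]; exact hlP
      have : Nontrivial (Sylow 3 Γ) := Finite.one_lt_card_iff_nontrivial.mp (by omega)
      obtain ⟨Q, hQ⟩ := exists_ne P
      have hl3 : l ^ 3 = 1 := by
        have := pow_card_eq_one' (G := P) (x := ⟨l, hlP'⟩)
        rw [hcard P] at this
        exact congrArg Subtype.val this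
      have hlQ : l • a Q = a Q := by
        rcases hnorm Q l (hmem l hl Q) with h | h
        · exact h.1
        · have : l ^ 3 • a Q = b Q := by
            rw [pow_succ, pow_two, mul_smul, mul_smul, h.1, h.2, h.1]
          rw [hl3, one_smul] at this
          exact absurd this (hab Q)
      have hne : ∀ x : X, t P • x = x → x ≠ a Q := by
        rintro x hx rfl
        exact hQ (Sylow.ext ((hstab Q _ (hta Q)).symm.trans (hstab P _ hx)))
      have hlb : l • b P = b P := by
        have : l ∈ stabilizer Γ (b P) := by rw [hstab P _ (htb P)]; exact hlP'
        exact this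
      exact h3 l (hab P) (hne _ (hta P)) (hne _ (htb P)) hlP hlb hlQ
    obtain ⟨P⟩ : Nonempty (Sylow 3 Γ) := inferInstance
    have hswap : ∀ l : Γ, φ l = 1 → l ≠ 1 → l • a P = b P := fun l hl hl1 => by
      rcases hnorm P l (hmem l hl P) with h | h
      · exact absurd (hfixed l hl P h.1) hl1
      · exact h.1
    have huniq : ∀ l : Γ, φ l = 1 → l ≠ 1 → l = k := fun l hl hl1 => by
      have : k⁻¹ * l = 1 := hfixed _ (by simp [hk, hl]) P (by
        rw [mul_smul, hswap l hl hl1, inv_smul_eq_iff, hswap k hk hk1])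
      exact (inv_mul_eq_one.mp this).symm
    obtain ⟨c, d, hcd, hc, hd⟩ := h2 k hk1
    refine hpair ⟨c, d, hcd, fun g => h3.permutes hk1 hcd hc hd ?_⟩
    have : g⁻¹ * k * g = k := huniq _ (by simp [hk]) (by
      intro h
      apply hk1
      have h' : g⁻¹ * k * (g⁻¹)⁻¹ = 1 := by simpa using h
      exact conj_eq_one_iff.mp h')
    rw [this]
    exact Subgroup.mem_zpowers k
  obtain ⟨e⟩ : Nonempty (Sylow 3 Γ ≃ Fin 4) := ⟨(Finite.equivFin _).trans (finCongr hc4)⟩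
  exact ⟨(e.permCongrHom : Equiv.Perm (Sylow 3 Γ) →* Equiv.Perm (Fin 4)).comp φ,
    (e.permCongrHom.injective).comp hinj⟩

end SmallSubgroups


/-! ### Irredundant triples in the symmetric group of degree four, by computation -/

section SymmetricGroupFour

open Equiv

/-- A permutation of `Fin 4`, written in base four. -/
def permCode (σ : Perm (Fin 4)) : ℕ :=
  (σ 0).val + 4 * (σ 1).val + 16 * (σ 2).val + 64 * (σ 3).val

/-- The `i`-th digit of `a` in base four. -/
def codeDigit (a i : ℕ) : ℕ := (a >>> (2 * i)) % 4

/-- Composition of permutations on codes. -/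
def codeMul (a b : ℕ) : ℕ :=
  codeDigit a (codeDigit b 0) + 4 * codeDigit a (codeDigit b 1) +
    16 * codeDigit a (codeDigit b 2) + 64 * codeDigit a (codeDigit b 3)

/-- The codes of all permutations. -/
def allCodes : List ℕ := (List.range 256).filter fun a =>
  [0, 1, 2, 3].all fun i => [0, 1, 2, 3].any fun j => codeDigit a j == i

/-- Breadth first search: the bit mask of the elements reached from the list `todo` by right
multiplication with `gens`. -/
def codeSpan (gens : List ℕ) : ℕ → List ℕ → ℕ → ℕ
  | 0, _, mask => mask
  | _ + 1, [], mask => mask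
  | n + 1, f :: todo, mask =>
    let new := gens.foldr (fun g (acc : List ℕ × ℕ) =>
      bif acc.2.testBit (codeMul f g) then acc
      else (codeMul f g :: acc.1, acc.2 ||| 2 ^ codeMul f g)) (todo, mask)
    codeSpan gens n new.1 new.2

/-- The bit mask of the subgroup generated by `gens`. -/
def codeClosure (gens : List ℕ) : ℕ := codeSpan gens 24 [228] (2 ^ 228)

/-- The admissible orders of the products `xy`, `xz`, `yz` and `xyz` for an irredundant generating
triple of involutions of the symmetric group of degree four. -/
def InvolutionShape (a b c d : ℕ) : Prop :=
  (((a, b, c) = (2, 3, 3) ∨ (a, b, c) = (3, 2, 3) ∨ (a, b, c) = (3, 3, 2) ∨ (a, b, c) = (3, 3, 3)) ∧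
    d = 4) ∨
  ((a, b, c) = (2, 3, 4) ∨ (a, b, c) = (2, 4, 3) ∨ (a, b, c) = (3, 2, 4) ∨ (a, b, c) = (3, 4, 2) ∨
    (a, b, c) = (4, 2, 3) ∨ (a, b, c) = (4, 3, 2)) ∨
  (((a, b, c) = (3, 4, 4) ∨ (a, b, c) = (4, 3, 4) ∨ (a, b, c) = (4, 4, 3)) ∧ d = 3)

instance (a b c d : ℕ) : Decidable (InvolutionShape a b c d) := by
  unfold InvolutionShape; infer_instance

/-- The possible shapes of an irredundant generating triple `(x, y, z)` of the symmetric group of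
degree four, in terms of a multiplication and an order function. -/
def TripleShape {α : Type*} (mul : α → α → α) (o : α → ℕ) (x y z : α) : Prop :=
  (o x = 2 ∨ o x = 3) ∧
  (o x = 3 →
    (o y = 2 ∧ o z = 3 ∧ o (mul x y) = 2 ∧ o (mul z y) = 2) ∨
    (o z = 2 ∧ o y = 3 ∧ o (mul x z) = 2 ∧ o (mul y z) = 2) ∨
    (o y = 2 ∧ o z = 2 ∧
      (o (mul x y) = 2 ∧ o (mul x z) = 3 ∨ o (mul x y) = 3 ∧ o (mul x z) = 2) ∧
      (o (mul y z) = 2 ∨ o (mul y z) = 4))) ∧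
  (o x = 2 → o y = 2 → o z = 2 →
    InvolutionShape (o (mul x y)) (o (mul x z)) (o (mul y z)) (o (mul (mul x y) z)))

instance {α : Type*} (mul : α → α → α) (o : α → ℕ) (x y z : α) :
    Decidable (TripleShape mul o x y z) := by
  unfold TripleShape; infer_instance

/-- The order of the permutation with code `a`. -/
def codeOrder (a : ℕ) : ℕ :=
  bif a == 228 then 1
  else bif codeMul a a == 228 then 2
  else bif codeMul (codeMul a a) a == 228 then 3
  else 4

/-- Either one of the three codes lies in the span of the others, or they have one of the shapes
of an irredundant generating triple and generate everything. -/
def tripleCheck (x y z : ℕ) : Bool :=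
  (codeClosure [x, y]).testBit z || (codeClosure [x, z]).testBit y ||
    (codeClosure [y, z]).testBit x ||
    (decide (TripleShape codeMul codeOrder x y z) &&
      allCodes.all fun w => (codeClosure [x, y, z]).testBit w)

/-- The five codes are the identity, a transposition, a double transposition, a three-cycle and a
four-cycle. Conjugation lets the first entry range over these class representatives only. -/
theorem tripleCheck_eq_true : ([228, 225, 177, 210, 57].all fun x => allCodes.all fun y =>
    allCodes.all fun z => tripleCheck x y z) = true := by
  decide +kernel

theorem permCode_mul : ∀ σ τ : Perm (Fin 4),
    permCode (σ * τ) = codeMul (permCode σ) (permCode τ) := by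
  decide +kernel

theorem permCode_injective : Function.Injective permCode := by
  have : ∀ σ τ : Perm (Fin 4), permCode σ = permCode τ → σ = τ := by decide +kernel
  exact fun σ τ => this σ τ

theorem permCode_mem : ∀ σ : Perm (Fin 4), permCode σ ∈ allCodes := by decide +kernel

theorem permCode_one : permCode 1 = 228 := rfl

theorem exists_conj_permCode : ∀ σ : Perm (Fin 4), ∃ τ : Perm (Fin 4),
    permCode (τ * σ * τ⁻¹) ∈ [228, 225, 177, 210, 57] := by
  decide +kernel

theorem pow_four_of_code : ∀ σ : Perm (Fin 4), codeOrder (permCode σ) = 4 →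
    σ ^ 2 ≠ 1 ∧ σ ^ 4 = 1 := by
  decide +kernel

theorem codeOrder_permCode (σ : Perm (Fin 4)) : codeOrder (permCode σ) = orderOf σ := by
  have hone : ∀ τ : Perm (Fin 4), permCode τ = 228 ↔ τ = 1 := fun τ => by
    rw [← permCode_one, permCode_injective.eq_iff]
  by_cases h4 : codeOrder (permCode σ) = 4
  · obtain ⟨h2, h4'⟩ := pow_four_of_code σ h4
    have := orderOf_eq_prime_pow (x := σ) (p := 2) (n := 1) (by simpa using h2) (by simpa using h4')
    rw [h4, this]
    norm_num
  have : Fact (Nat.Prime 2) := ⟨Nat.prime_two⟩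
  have : Fact (Nat.Prime 3) := ⟨Nat.prime_three⟩
  revert h4
  unfold codeOrder
  simp only [Bool.cond_eq_ite, beq_iff_eq, ← permCode_mul, hone]
  split_ifs with h1 h2 h3
  · simp [h1]
  · intro _
    exact (orderOf_eq_prime (by rw [pow_two, h2]) h1).symm
  · intro _
    exact (orderOf_eq_prime (by rw [pow_succ, pow_two, h3]) h1).symm
  · simp

/-- Every element of the list is the code of some member of `S`. -/
def CodesIn (S : Subgroup (Perm (Fin 4))) (p : ℕ → Prop) : Prop :=
  ∀ c, p c → ∃ σ ∈ S, permCode σ = c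

/-- Soundness of the search is all that is needed: whatever is reached lies in `S`. That the search
is exhaustive plays no role, since the check only draws conclusions from bits that are set. -/
theorem codesIn_codeSpan {S : Subgroup (Perm (Fin 4))} {gens : List ℕ}
    (hg : CodesIn S (· ∈ gens)) (n : ℕ) : ∀ (todo : List ℕ) (mask : ℕ),
    CodesIn S (· ∈ todo) → CodesIn S (fun c => mask.testBit c) →
    CodesIn S (fun c => (codeSpan gens n todo mask).testBit c) := by
  induction n with
  | zero => intro todo mask _ hm; cases todo <;> exact hm
  | succ n ih =>
    intro todo mask ht hm
    cases todo with
    | nil => exact hm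
    | cons f todo =>
      obtain ⟨φ, hφ, rfl⟩ := ht f (by simp)
      have ht' : CodesIn S (· ∈ todo) := fun c hc => ht c (by simp [hc])
      have key : ∀ l : List ℕ, CodesIn S (· ∈ l) →
          CodesIn S (· ∈ (l.foldr (fun g (acc : List ℕ × ℕ) =>
            bif acc.2.testBit (codeMul (permCode φ) g) then acc
            else (codeMul (permCode φ) g :: acc.1, acc.2 ||| 2 ^ codeMul (permCode φ) g))
            (todo, mask)).1) ∧
          CodesIn S (fun c => (l.foldr (fun g (acc : List ℕ × ℕ) =>
            bif acc.2.testBit (codeMul (permCode φ) g) then acc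
            else (codeMul (permCode φ) g :: acc.1, acc.2 ||| 2 ^ codeMul (permCode φ) g))
            (todo, mask)).2.testBit c) := by
        intro l
        induction l with
        | nil => exact fun _ => ⟨ht', hm⟩
        | cons g l ihl =>
          intro hl
          obtain ⟨h1, h2⟩ := ihl fun c hc => hl c (by simp [hc])
          obtain ⟨γ, hγ, rfl⟩ := hl g (by simp)
          rw [List.foldr_cons, ← permCode_mul]
          generalize List.foldr _ _ l = acc at h1 h2 ⊢
          cases acc.2.testBit (permCode (φ * γ)) with
          | true => exact ⟨h1, h2⟩
          | false =>
            have hmem : φ * γ ∈ S := mul_mem hφ hγ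
            refine ⟨fun c hc => ?_, fun c hc => ?_⟩
            · rcases List.mem_cons.mp hc with rfl | hc
              · exact ⟨_, hmem, rfl⟩
              · exact h1 c hc
            · simp only [cond_false, Nat.testBit_lor, Nat.testBit_two_pow, Bool.or_eq_true,
                decide_eq_true_eq] at hc
              rcases hc with hc | rfl
              · exact h2 c hc
              · exact ⟨_, hmem, rfl⟩
      exact ih _ _ (key gens hg).1 (key gens hg).2

theorem mem_of_testBit_codeClosure {S : Subgroup (Perm (Fin 4))} {gens : List ℕ}
    (hg : ∀ c ∈ gens, ∃ σ ∈ S, permCode σ = c) {w : Perm (Fin 4)}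
    (hw : (codeClosure gens).testBit (permCode w) = true) : w ∈ S := by
  have := codesIn_codeSpan (S := S) (gens := gens) hg 24 [228] (2 ^ 228) ?_ ?_ _ hw
  · obtain ⟨σ, hσ, h⟩ := this
    rwa [← permCode_injective h]
  · intro c hc
    rw [List.mem_singleton.mp hc]
    exact ⟨1, one_mem S, rfl⟩
  · intro c hc
    rw [Nat.testBit_two_pow, decide_eq_true_eq] at hc
    exact ⟨1, one_mem S, hc⟩

/-- No member of the triple lies in the subgroup generated by the other two. -/
def IndependentTriple {G : Type*} [Group G] (x y z : G) : Prop :=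
  x ∉ Subgroup.closure {y, z} ∧ y ∉ Subgroup.closure {x, z} ∧ z ∉ Subgroup.closure {x, y}

/-- The shape of an irredundant generating triple of the symmetric group of degree four. -/
def OctahedralTriple {G : Type*} [Group G] (x y z : G) : Prop :=
  TripleShape (· * ·) orderOf x y z

theorem tripleShape_permCode (x y z : Perm (Fin 4)) :
    TripleShape codeMul codeOrder (permCode x) (permCode y) (permCode z) ↔
      OctahedralTriple x y z := by
  simp only [OctahedralTriple, TripleShape, ← permCode_mul, codeOrder_permCode]

theorem octahedralTriple_of_code {x y z : Perm (Fin 4)}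
    (hx : permCode x ∈ [228, 225, 177, 210, 57]) (h : IndependentTriple x y z) :
    OctahedralTriple x y z ∧ Subgroup.closure {x, y, z} = ⊤ := by
  have hc := tripleCheck_eq_true
  rw [List.all_eq_true] at hc
  have hc := hc _ hx
  rw [List.all_eq_true] at hc
  have hc := hc _ (permCode_mem y)
  rw [List.all_eq_true] at hc
  have hc := hc _ (permCode_mem z)
  simp only [tripleCheck, Bool.or_eq_true, Bool.and_eq_true, decide_eq_true_eq,
    tripleShape_permCode, List.all_eq_true] at hc
  obtain ⟨h1, h2, h3⟩ := h
  have sub2 : ∀ a b : Perm (Fin 4), ∀ c ∈ [permCode a, permCode b],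
      ∃ σ ∈ Subgroup.closure {a, b}, permCode σ = c := by
    intro a b c hc
    simp only [List.mem_cons, List.not_mem_nil, or_false] at hc
    rcases hc with rfl | rfl
    · exact ⟨a, Subgroup.subset_closure (by simp), rfl⟩
    · exact ⟨b, Subgroup.subset_closure (by simp), rfl⟩
  rcases hc with ((hc | hc) | hc) | hc
  · exact absurd (mem_of_testBit_codeClosure (sub2 x y) hc) h3
  · exact absurd (mem_of_testBit_codeClosure (sub2 x z) hc) h2
  · exact absurd (mem_of_testBit_codeClosure (sub2 y z) hc) h1
  · refine ⟨hc.1, eq_top_iff.mpr fun w _ => mem_of_testBit_codeClosure ?_ (hc.2 _ (permCode_mem w))⟩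
    intro c hc
    simp only [List.mem_cons, List.not_mem_nil, or_false] at hc
    rcases hc with rfl | rfl | rfl
    · exact ⟨x, Subgroup.subset_closure (by simp), rfl⟩
    · exact ⟨y, Subgroup.subset_closure (by simp), rfl⟩
    · exact ⟨z, Subgroup.subset_closure (by simp), rfl⟩

theorem IndependentTriple.of_map {G H : Type*} [Group G] [Group H] (f : G →* H)
    (hf : Function.Injective f) {x y z : G} (h : IndependentTriple x y z) :
    IndependentTriple (f x) (f y) (f z) := by
  have : ∀ a b c : G, f a ∈ Subgroup.closure {f b, f c} ↔ a ∈ Subgroup.closure {b, c} := by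
    intro a b c
    rw [show ({f b, f c} : Set H) = f '' {b, c} by rw [Set.image_pair], ← MonoidHom.map_closure]
    exact Subgroup.mem_map_iff_mem hf
  unfold IndependentTriple
  rw [this, this, this]
  exact h

theorem octahedralTriple_map {G H : Type*} [Group G] [Group H] (f : G →* H)
    (hf : Function.Injective f) (x y z : G) :
    OctahedralTriple (f x) (f y) (f z) ↔ OctahedralTriple x y z := by
  simp only [OctahedralTriple, TripleShape, ← map_mul, orderOf_injective f hf]

/-- An independent triple in a group embedding into the symmetric group of degree four has one of
the listed shapes and generates the group. -/
theorem IndependentTriple.octahedral {G : Type*} [Group G] (ψ : G →* Perm (Fin 4))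
    (hψ : Function.Injective ψ) {x y z : G} (h : IndependentTriple x y z) :
    OctahedralTriple x y z ∧ Subgroup.closure {x, y, z} = ⊤ := by
  obtain ⟨τ, hτ⟩ := exists_conj_permCode (ψ x)
  let f : G →* Perm (Fin 4) := (MulAut.conj τ).toMonoidHom.comp ψ
  have hf : Function.Injective f := (MulAut.conj τ).injective.comp hψ
  obtain ⟨h1, h2⟩ := octahedralTriple_of_code (x := f x) hτ (h.of_map f hf)
  refine ⟨(octahedralTriple_map f hf x y z).mp h1, eq_top_iff.mpr fun w _ => ?_⟩
  rw [show ({f x, f y, f z} : Set (Perm (Fin 4))) = f '' {x, y, z} by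
    rw [Set.image_insert_eq, Set.image_pair], ← MonoidHom.map_closure] at h2
  rw [← Subgroup.mem_map_iff_mem hf, h2]
  trivial

/-- In a cyclic group embedding into the symmetric group of degree four, the subgroups form a
chain. -/
theorem mem_zpowers_or_mem_zpowers {G : Type*} [Group G] (ψ : G →* Perm (Fin 4))
    (hψ : Function.Injective ψ) (S : Subgroup G) [IsCyclic S] {x y : G} (hx : x ∈ S) (hy : y ∈ S) :
    x ∈ Subgroup.zpowers y ∨ y ∈ Subgroup.zpowers x := by
  obtain ⟨⟨g, hg⟩, hgen⟩ := IsCyclic.exists_generator (α := S)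
  have hpow : ∀ z ∈ S, ∃ i < orderOf g, g ^ i = z := by
    intro z hz
    have hfin : IsOfFinOrder g := by
      have : Finite G := Finite.of_injective ψ hψ
      exact isOfFinOrder_of_finite g
    have : z ∈ Subgroup.zpowers g := by
      obtain ⟨k, hk⟩ := hgen ⟨z, hz⟩
      exact ⟨k, congrArg Subtype.val hk⟩
    obtain ⟨i, hi⟩ := (hfin.mem_powers_iff_mem_zpowers.mpr this)
    exact ⟨i % orderOf g, Nat.mod_lt _ hfin.orderOf_pos, by rw [pow_mod_orderOf]; exact hi⟩
  obtain ⟨i, hi, rfl⟩ := hpow x hx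
  obtain ⟨j, hj, rfl⟩ := hpow y hy
  -- Orders up to four are prime powers (or one), so the subgroups of `⟨g⟩` form a chain; `key`
  -- verifies this on exponents.
  have hn : orderOf g ≤ 4 := by
    rw [← orderOf_injective ψ hψ, ← codeOrder_permCode]
    unfold codeOrder
    simp only [Bool.cond_eq_ite]
    split_ifs <;> norm_num
  have key : ∀ n ≤ 4, ∀ i < n, ∀ j < n, (∃ k < 4, j * k % n = i) ∨ ∃ k < 4, i * k % n = j := by
    decide
  rcases key _ hn i hi j hj with ⟨k, -, hk⟩ | ⟨k, -, hk⟩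
  · left
    refine ⟨k, ?_⟩
    dsimp only
    rw [zpow_natCast, ← pow_mul, ← pow_mod_orderOf, hk]
  · right
    refine ⟨k, ?_⟩
    dsimp only
    rw [zpow_natCast, ← pow_mul, ← pow_mod_orderOf, hk]

end SymmetricGroupFour


/-! ### Abstract Möbius actions and the trichotomy for proper subgroups -/

section MoebiusActions

open MulAction

/-- The properties of the action of `PSL(2, p)` on the projective line over an algebraically closed
field of characteristic `p` that determine the subgroups of `PSL(2, p)` without elements of order
five prime to `p`. -/
structure MoebiusAction (p : ℕ) (G X : Type*) [Group G] [MulAction G X] : Prop where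
  coprime_two : Nat.Coprime 2 p
  coprime_three : Nat.Coprime 3 p
  prime : p.Prime
  finite : Finite G
  nonempty : Nonempty X
  three : ThreeFixedPointsTrivial G X
  exists_fixed : ∀ g : G, g ≠ 1 → (orderOf g).Coprime p → ∃ a b : X, a ≠ b ∧ g • a = a ∧ g • b = b
  isCyclic_pair : ∀ {a b : X}, a ≠ b → IsCyclic (stabilizer G a ⊓ stabilizer G b : Subgroup G)
  isCyclic_point : ∀ (S : Subgroup G) (a : X), (Nat.card S).Coprime p → S ≤ stabilizer G a →
    IsCyclic S
  fixesPoint_of_dvd : ∀ S : Subgroup G, p ∣ Nat.card S → S ≠ ⊤ → FixesPoint S X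
  orderOf_ne_five : ∀ g : G, (orderOf g).Coprime p → orderOf g ≠ 5
  not_fixesPoint : ¬ FixesPoint (⊤ : Subgroup G) X
  not_fixesPair : ¬ FixesPair (⊤ : Subgroup G) X

/-- `H` has order prime to `p` and embeds into the symmetric group of degree four. -/
def EmbedsInPermFour (p : ℕ) {G : Type*} [Group G] (H : Subgroup G) : Prop :=
  (Nat.card H).Coprime p ∧ ∃ ψ : H →* Equiv.Perm (Fin 4), Function.Injective ψ

/-- With `d = orderOf y`, the equation `a ^ d = 1` has at most `d` solutions in a cyclic group, and
the powers of `y` already account for all of them. -/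
theorem IsCyclic.mem_zpowers_of_orderOf_dvd {C : Type*} [Group C] [Finite C] [IsCyclic C] {x y : C}
    (h : orderOf x ∣ orderOf y) : x ∈ Subgroup.zpowers y := by
  classical
  have := Fintype.ofFinite C
  have hsub : (Finset.univ.filter fun a : C => a ∈ Subgroup.zpowers y) ⊆
      Finset.univ.filter fun a : C => a ^ orderOf y = 1 := by
    intro a ha
    simp only [Finset.mem_filter, Finset.mem_univ, true_and] at ha ⊢
    exact orderOf_dvd_iff_pow_eq_one.mp (orderOf_dvd_of_mem_zpowers ha)
  have hcard : (Finset.univ.filter fun a : C => a ∈ Subgroup.zpowers y).card = orderOf y := by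
    rw [← Nat.card_zpowers, ← Fintype.card_subtype, ← Nat.card_eq_fintype_card]
  have heq := Finset.eq_of_subset_of_card_le hsub
    (by rw [hcard]; exact IsCyclic.card_pow_eq_one_le (orderOf_pos y))
  have hx : x ∈ Finset.univ.filter fun a : C => a ^ orderOf y = 1 := by
    simpa using orderOf_dvd_iff_pow_eq_one.mp h
  rw [← heq] at hx
  simpa using hx

theorem zpowers_le_closure_pair {G : Type*} [Group G] (x y : G) :
    Subgroup.zpowers x ≤ Subgroup.closure {x, y} :=
  Subgroup.zpowers_le.mpr (Subgroup.subset_closure (by simp))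

theorem mem_closure_pair_left {G : Type*} [Group G] (x y : G) : x ∈ Subgroup.closure {x, y} :=
  Subgroup.subset_closure (by simp)

theorem mem_closure_pair_right {G : Type*} [Group G] (x y : G) : y ∈ Subgroup.closure {x, y} :=
  Subgroup.subset_closure (by simp)


namespace MoebiusAction

variable {G X : Type*} [Group G] [MulAction G X] {p : ℕ}

theorem mem_zpowers (hM : MoebiusAction p G X) {x y : G} {a b : X} (hab : a ≠ b) (hxa : x • a = a)
    (hxb : x • b = b) (hya : y • a = a) (hyb : y • b = b) (h : orderOf x ∣ orderOf y) :
    x ∈ Subgroup.zpowers y := by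
  have := hM.finite
  have := hM.isCyclic_pair hab
  let C := (stabilizer G a ⊓ stabilizer G b : Subgroup G)
  let x' : C := ⟨x, hxa, hxb⟩
  let y' : C := ⟨y, hya, hyb⟩
  have hxy : orderOf x' ∣ orderOf y' := by
    rwa [← Subgroup.orderOf_coe, ← Subgroup.orderOf_coe]
  obtain ⟨k, hk⟩ := IsCyclic.mem_zpowers_of_orderOf_dvd hxy
  exact ⟨k, congrArg Subtype.val hk⟩

theorem commute (hM : MoebiusAction p G X) {x y : G} {a b : X} (hab : a ≠ b) (hxa : x • a = a)
    (hxb : x • b = b) (hya : y • a = a) (hyb : y • b = b) : x * y = y * x := by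
  have := hM.isCyclic_pair hab
  let C := (stabilizer G a ⊓ stabilizer G b : Subgroup G)
  let x' : C := ⟨x, hxa, hxb⟩
  let y' : C := ⟨y, hya, hyb⟩
  obtain ⟨z, hz⟩ := IsCyclic.exists_generator (α := C)
  obtain ⟨i, hi⟩ := hz x'
  obtain ⟨j, hj⟩ := hz y'
  have : x' * y' = y' * x' := by
    rw [← hi, ← hj]
    exact (Commute.zpow_zpow_self z i j).eq
  exact congrArg Subtype.val this

/-- A proper subgroup fixes a point, stabilizes a pair, or embeds into `S₄`. -/
theorem trichotomy (hM : MoebiusAction p G X) (H : Subgroup G) (hH : H ≠ ⊤) :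
    FixesPoint H X ∨ FixesPair H X ∨ EmbedsInPermFour p H := by
  -- Order divisible by `p` forces a fixed point. Otherwise every nontrivial element of `H` has
  -- exactly two fixed points and the orbit count applies.
  by_cases hp : p ∣ Nat.card H
  · exact Or.inl (hM.fixesPoint_of_dvd H hp hH)
  have hcop : (Nat.card H).Coprime p := ((Nat.Prime.coprime_iff_not_dvd hM.prime).mpr hp).symm
  by_contra! h
  obtain ⟨h1, h2, h3⟩ := h
  have := hM.finite
  have := hM.nonempty
  have hord : ∀ g : H, (orderOf (g : G)).Coprime p := fun g => by
    rw [Subgroup.orderOf_coe]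
    exact Nat.Coprime.coprime_dvd_left (orderOf_dvd_natCard g) hcop
  refine h3 ⟨hcop, exists_embedding_perm_four (Γ := H) (X := X) ?_ ?_ ?_ ?_ ?_⟩
  · intro g a b c hab hac hbc ha hb hc
    exact Subtype.ext (hM.three (g : G) hab hac hbc ha hb hc)
  · intro g hg
    exact hM.exists_fixed g (fun h => hg (Subtype.ext h)) (hord g)
  · intro g
    rw [← Subgroup.orderOf_coe]
    exact hM.orderOf_ne_five g (hord g)
  · rintro ⟨a, ha⟩
    exact h1 ⟨a, fun h hh => ha ⟨h, hh⟩⟩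
  · rintro ⟨a, b, hab, ha⟩
    exact h2 ⟨a, b, hab, fun h hh => ha ⟨h, hh⟩⟩

/-- Two elements of `H ↪ S₄` with a common fixed point generate a group with a chain of
subgroups. -/
theorem mem_zpowers_or (hM : MoebiusAction p G X) {H : Subgroup G} (hH : EmbedsInPermFour p H)
    {x y : G} (hx : x ∈ H) (hy : y ∈ H) {a : X} (hxa : x • a = a) (hya : y • a = a) :
    x ∈ Subgroup.zpowers y ∨ y ∈ Subgroup.zpowers x := by
  obtain ⟨hcop, ψ, hψ⟩ := hH
  let K := H ⊓ stabilizer G a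
  have hK : (Nat.card K).Coprime p :=
    Nat.Coprime.coprime_dvd_left (Subgroup.card_dvd_of_le inf_le_left) hcop
  have : IsCyclic K := hM.isCyclic_point K a hK inf_le_right
  let f : K →* Equiv.Perm (Fin 4) := ψ.comp (Subgroup.inclusion inf_le_left)
  have hf : Function.Injective f := hψ.comp (Subgroup.inclusion_injective _)
  have key := mem_zpowers_or_mem_zpowers f hf (⊤ : Subgroup K) (x := ⟨x, hx, hxa⟩)
    (y := ⟨y, hy, hya⟩) trivial trivial
  rcases key with ⟨k, hk⟩ | ⟨k, hk⟩
  · exact Or.inl ⟨k, congrArg Subtype.val hk⟩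
  · exact Or.inr ⟨k, congrArg Subtype.val hk⟩

/-- Commuting with a set of generators an element of order prime to `p` is trivial. -/
theorem eq_one_of_central (hM : MoebiusAction p G X) {z : G} (hz : (orderOf z).Coprime p)
    (hc : ∀ h : G, h * z = z * h) : z = 1 := by
  by_contra hz1
  obtain ⟨a, b, hab, ha, hb⟩ := hM.exists_fixed z hz1 hz
  refine hM.not_fixesPair ⟨a, b, hab, fun h _ => hM.three.permutes hz1 hab ha hb ?_⟩
  rw [mul_assoc, ← hc, inv_mul_cancel_left]
  exact Subgroup.mem_zpowers z

end MoebiusAction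

/-! ### Transfer of the computation to subgroups embedding in `S₄` -/

section EmbedsInPermFour

variable {G : Type*} [Group G] {p : ℕ}

theorem coe_mem_closure_pair {H : Subgroup G} {a b c : H} (h : a ∈ Subgroup.closure {b, c}) :
    (a : G) ∈ Subgroup.closure {(b : G), (c : G)} := by
  have := Subgroup.mem_map_of_mem H.subtype h
  rw [MonoidHom.map_closure, Set.image_pair] at this
  exact this

theorem coe_mem_closure_triple {H : Subgroup G} {a b c d : H}
    (h : a ∈ Subgroup.closure {b, c, d}) :
    (a : G) ∈ Subgroup.closure {(b : G), (c : G), (d : G)} := by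
  have := Subgroup.mem_map_of_mem H.subtype h
  rw [MonoidHom.map_closure, Set.image_insert_eq, Set.image_pair] at this
  exact this

theorem IndependentTriple.of_coe {H : Subgroup G} {x y z : H}
    (h : IndependentTriple (x : G) (y : G) (z : G)) : IndependentTriple x y z :=
  ⟨fun h' => h.1 (coe_mem_closure_pair h'), fun h' => h.2.1 (coe_mem_closure_pair h'),
    fun h' => h.2.2 (coe_mem_closure_pair h')⟩

theorem OctahedralTriple.coe {H : Subgroup G} {x y z : H} (h : OctahedralTriple x y z) :
    OctahedralTriple (x : G) (y : G) (z : G) :=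
  (octahedralTriple_map H.subtype H.subtype_injective x y z).mpr h

theorem EmbedsInPermFour.octahedral {H : Subgroup G} (hH : EmbedsInPermFour p H) {x y z : G}
    (hx : x ∈ H) (hy : y ∈ H) (hz : z ∈ H) (h : IndependentTriple x y z) :
    OctahedralTriple x y z ∧ H ≤ Subgroup.closure {x, y, z} := by
  obtain ⟨-, ψ, hψ⟩ := hH
  lift x to H using hx
  lift y to H using hy
  lift z to H using hz
  obtain ⟨h1, h2⟩ := (IndependentTriple.of_coe h).octahedral ψ hψ
  refine ⟨h1.coe, fun w hw => ?_⟩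
  lift w to H using hw
  exact coe_mem_closure_triple (h2 ▸ Subgroup.mem_top w)

end EmbedsInPermFour

/-! ### Irredundant sequences and the subgroups obtained by dropping a term -/

section Irredundant

variable {G : Type*} [Group G] {n : ℕ} {g : Fin n → G}

/-- The subgroup generated by the terms of `g` other than `g j`. -/
def dropSubgroup (g : Fin n → G) (j : Fin n) : Subgroup G := Subgroup.closure (g '' {i | i ≠ j})

theorem mem_dropSubgroup (g : Fin n → G) {i j : Fin n} (h : i ≠ j) : g i ∈ dropSubgroup g j :=
  Subgroup.subset_closure ⟨i, h, rfl⟩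

theorem dropSubgroup_le {j : Fin n} {S : Subgroup G} :
    dropSubgroup g j ≤ S ↔ ∀ i, i ≠ j → g i ∈ S := by
  rw [dropSubgroup, Subgroup.closure_le]
  exact ⟨fun h i hi => h ⟨i, hi, rfl⟩, fun h _ ⟨i, hi, e⟩ => e ▸ h i hi⟩

theorem IsIrredundantGenerating.eq_top (hg : IsIrredundantGenerating g) {S : Subgroup G}
    (h : ∀ i, g i ∈ S) : S = ⊤ := by
  rw [eq_top_iff, ← hg.1, Subgroup.closure_le]
  rintro _ ⟨i, rfl⟩
  exact h i

theorem IsIrredundantGenerating.notMem_dropSubgroup (hg : IsIrredundantGenerating g) (j : Fin n) :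
    g j ∉ dropSubgroup g j := by
  intro h
  refine hg.2 j (hg.eq_top fun i => ?_)
  by_cases hij : i = j
  · rw [hij]; exact h
  · exact mem_dropSubgroup g hij

theorem IsIrredundantGenerating.notMem_closure (hg : IsIrredundantGenerating g) (j : Fin n)
    {s : Set G} (hs : ∀ x ∈ s, ∃ i, i ≠ j ∧ g i = x) : g j ∉ Subgroup.closure s := by
  refine fun h => hg.notMem_dropSubgroup j (Subgroup.closure_mono ?_ h)
  exact fun x hx => hs x hx

theorem IsIrredundantGenerating.notMem_pair (hg : IsIrredundantGenerating g) {i j k : Fin n}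
    (hi : j ≠ i) (hk : k ≠ i) : g i ∉ Subgroup.closure {g j, g k} := by
  refine hg.notMem_closure i ?_
  rintro x (rfl | rfl)
  exacts [⟨j, hi, rfl⟩, ⟨k, hk, rfl⟩]

theorem IsIrredundantGenerating.notMem_zpowers (hg : IsIrredundantGenerating g) {i j : Fin n}
    (h : j ≠ i) : g i ∉ Subgroup.zpowers (g j) :=
  fun h' => hg.notMem_pair h h (zpowers_le_closure_pair _ _ h')

theorem IsIrredundantGenerating.ne_one (hg : IsIrredundantGenerating g) (i : Fin n) : g i ≠ 1 :=
  fun h => hg.notMem_dropSubgroup i (h ▸ one_mem _)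

theorem IsIrredundantGenerating.independentTriple (hg : IsIrredundantGenerating g) {i j k : Fin n}
    (hij : i ≠ j) (hik : i ≠ k) (hjk : j ≠ k) : IndependentTriple (g i) (g j) (g k) :=
  ⟨hg.notMem_pair hij.symm hik.symm, hg.notMem_pair hij hjk.symm, hg.notMem_pair hik hjk⟩

end Irredundant

end MoebiusActions

set_option linter.unusedSimpArgs false

/-! ### Types of the dropped subgroups; the length is at most four -/

section MaximalSubgroupTypes

open MulAction

/-- `x` permutes the points `a` and `b`. -/
def Permutes {G X : Type*} [Group G] [MulAction G X] (x : G) (a b : X) : Prop :=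
  (x • a = a ∧ x • b = b) ∨ (x • a = b ∧ x • b = a)

theorem Permutes.symm {G X : Type*} [Group G] [MulAction G X] {x : G} {a b : X}
    (h : Permutes x a b) : Permutes x b a :=
  h.imp And.symm And.symm

open scoped Pointwise in
theorem permutes_stabilizer {G X : Type*} [Group G] [MulAction G X] (a b : X) :
    ∃ S : Subgroup G, ∀ x, x ∈ S ↔ Permutes x a b := by
  refine ⟨MulAction.stabilizer G ({a, b} : Set X), fun x => ?_⟩
  rw [MulAction.mem_stabilizer_iff, ← Set.image_smul, Set.image_pair]
  rw [Set.pair_eq_pair_iff]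
  rfl

theorem exists_notMem_of_card_lt {n : ℕ} (s : Finset (Fin n)) (h : s.card < n) : ∃ k, k ∉ s := by
  by_contra! hs
  rw [Finset.eq_univ_iff_forall.mpr hs, Finset.card_univ, Fintype.card_fin] at h
  exact lt_irrefl _ h

theorem exists_two_ne {n : ℕ} (hn : 4 ≤ n) (i j : Fin n) :
    ∃ k l : Fin n, k ≠ i ∧ k ≠ j ∧ l ≠ i ∧ l ≠ j ∧ k ≠ l := by
  obtain ⟨k, hk⟩ := exists_notMem_of_card_lt {i, j} (by
    have := Finset.card_le_two (a := i) (b := j); omega)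
  obtain ⟨l, hl⟩ := exists_notMem_of_card_lt {i, j, k} (by
    have := Finset.card_le_three (a := i) (b := j) (c := k); omega)
  simp only [Finset.mem_insert, Finset.mem_singleton, not_or] at hk hl
  exact ⟨k, l, hk.1, hk.2, hl.1, hl.2.1, fun h => hl.2.2 h.symm⟩

variable {G X : Type*} [Group G] [MulAction G X] {p : ℕ}

/-- If `x` fixes `R` and `S`, the two fixed pairs coincide. If it swaps them, `x ^ 2` fixes `P`, `Q`
and also `R`, which is neither of these. -/
theorem ThreeFixedPointsTrivial.sq_eq_one (h3 : ThreeFixedPointsTrivial G X) {x : G} (hx : x ≠ 1)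
    {P Q R S : X} (hPQ : P ≠ Q) (hRS : R ≠ S) (hP : x • P = P) (hQ : x • Q = Q)
    (hx2 : Permutes x R S) : (R = P ∧ S = Q ∨ R = Q ∧ S = P) ∨ x ^ 2 = 1 := by
  rcases hx2 with ⟨hR, hS⟩ | ⟨hR, hS⟩
  · left
    rcases h3.eq_or_eq hx hPQ hP hQ hR with rfl | rfl <;>
      rcases h3.eq_or_eq hx hPQ hP hQ hS with rfl | rfl
    · exact absurd rfl hRS
    · exact Or.inl ⟨rfl, rfl⟩
    · exact Or.inr ⟨rfl, rfl⟩
    · exact absurd rfl hRS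
  · right
    have hne : ∀ T, x • T = T → T ≠ R := by
      rintro T hT rfl
      exact hRS (hT.symm.trans hR)
    refine h3 (x ^ 2) hPQ (hne P hP) (hne Q hQ) ?_ ?_ ?_
    · rw [pow_two, mul_smul, hP, hP]
    · rw [pow_two, mul_smul, hQ, hQ]
    · rw [pow_two, mul_smul, hR, hS]

variable {n : ℕ} {g : Fin n → G}

namespace MoebiusAction

/-- Inside a subgroup of `S₄` type a point stabilizer has a chain of subgroups, so one of two terms
with a common fixed point is a power of the other. -/
theorem false_of_embeds (hM : MoebiusAction p G X) (hg : IsIrredundantGenerating g) {i j k : Fin n}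
    (hj : EmbedsInPermFour p (dropSubgroup g j)) (hij : i ≠ j) (hkj : k ≠ j) (hik : i ≠ k) {a : X}
    (hia : g i • a = a) (hka : g k • a = a) : False := by
  rcases hM.mem_zpowers_or hj (mem_dropSubgroup g hij) (mem_dropSubgroup g hkj) hia hka with h | h
  · exact hg.notMem_zpowers hik.symm h
  · exact hg.notMem_zpowers hik h

/-- Both `g k` and `g l` lie in the cyclic group fixing `P` and `Q`. The subgroup dropping `l`
contains `g j` and `g k`, which share `P`, so it is not of `S₄` type; a pair it stabilizes is not
`{P, Q}`, because `g j` fixes `P` but moves `Q`. Hence `g k` is an involution, and by symmetry so is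
`g l`; a cyclic group has at most one. -/
theorem false_of_torus (hM : MoebiusAction p G X) (hg : IsIrredundantGenerating g) {j k l : Fin n}
    {P Q : X} (hPQ : P ≠ Q) (hjk : j ≠ k) (hjl : j ≠ l) (hkl : k ≠ l)
    (hkP : g k • P = P) (hkQ : g k • Q = Q) (hlP : g l • P = P) (hlQ : g l • Q = Q)
    (hjP : g j • P = P) (hjQ : g j • Q ≠ Q)
    (hk : FixesPair (dropSubgroup g k) X ∨ EmbedsInPermFour p (dropSubgroup g k))
    (hl : FixesPair (dropSubgroup g l) X ∨ EmbedsInPermFour p (dropSubgroup g l)) : False := by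
  have key : ∀ m q : Fin n, j ≠ m → q ≠ m → j ≠ q → g q • P = P → g q • Q = Q →
      (FixesPair (dropSubgroup g m) X ∨ EmbedsInPermFour p (dropSubgroup g m)) →
      orderOf (g q) = 2 := by
    intro m q hjm hqm hjq hqP hqQ hm
    rcases hm with ⟨R, S, hRS, hfix⟩ | hm
    · rcases hM.three.sq_eq_one (hg.ne_one q) hPQ hRS hqP hqQ (hfix _ (mem_dropSubgroup g hqm))
        with (⟨rfl, rfl⟩ | ⟨rfl, rfl⟩) | h
      · rcases hfix _ (mem_dropSubgroup g hjm) with h | h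
        · exact absurd h.2 hjQ
        · exact absurd (hjP.symm.trans h.1) hPQ
      · rcases hfix _ (mem_dropSubgroup g hjm) with h | h
        · exact absurd h.1 hjQ
        · exact absurd (hjP.symm.trans h.2) hPQ
      · exact orderOf_eq_prime h (hg.ne_one q)
    · exact (hM.false_of_embeds hg hm hjm hqm hjq hjP hqP).elim
  have ok := key l k hjl hkl hjk hkP hkQ hl
  have ol := key k l hjk hkl.symm hjl hlP hlQ hk
  exact hg.notMem_zpowers hkl.symm (hM.mem_zpowers hPQ hkP hkQ hlP hlQ (by rw [ok, ol]))

/-- The fixed points `P`, `Q` differ, and all terms other than `g i`, `g j` fix both. A third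
dropped subgroup with a fixed point would give some term three fixed points, so the hypotheses of
`false_of_torus` hold. -/
theorem not_two_fixesPoint (hM : MoebiusAction p G X) (hg : IsIrredundantGenerating g) (hn : 4 ≤ n)
    {i j : Fin n} (hij : i ≠ j) (hi : FixesPoint (dropSubgroup g i) X)
    (hj : FixesPoint (dropSubgroup g j) X) : False := by
  have hcommon : ∀ (i j : Fin n) (P : X), i ≠ j → (∀ h ∈ dropSubgroup g i, h • P = P) →
      ¬ ∀ h ∈ dropSubgroup g j, h • P = P := by
    intro i j P hij hP hP'
    refine hM.not_fixesPoint ⟨P, fun h _ => ?_⟩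
    have : stabilizer G P = ⊤ := hg.eq_top fun m => by
      by_cases hm : m = i
      · exact hP' _ (mem_dropSubgroup g (by rw [hm]; exact hij))
      · exact hP _ (mem_dropSubgroup g hm)
    exact mem_stabilizer_iff.mp (this ▸ Subgroup.mem_top h)
  obtain ⟨P, hP⟩ := hi
  obtain ⟨Q, hQ⟩ := hj
  obtain ⟨k, l, hki, hkj, hli, hlj, hkl⟩ := exists_two_ne hn i j
  have hPQ : P ≠ Q := by
    rintro rfl
    exact hcommon i j P hij hP hQ
  have hjQ : g j • Q ≠ Q := by
    intro h
    refine hcommon j i Q hij.symm hQ (dropSubgroup_le (S := stabilizer G Q) |>.mpr fun m hm => ?_)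
    by_cases hmj : m = j
    · rw [hmj]; exact h
    · exact hQ _ (mem_dropSubgroup g hmj)
  have hne : ∀ m, m ≠ i → m ≠ j → FixesPair (dropSubgroup g m) X ∨
      EmbedsInPermFour p (dropSubgroup g m) := by
    intro m hmi hmj
    rcases hM.trichotomy _ (hg.2 m) with ⟨R, hR⟩ | h
    · exfalso
      obtain ⟨q, q', hqi, hqj, hqi', hqj', hqq⟩ := exists_two_ne hn i j
      obtain ⟨q, hqi, hqj, hqm⟩ : ∃ q, q ≠ i ∧ q ≠ j ∧ q ≠ m := by
        by_cases h : q = m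
        · exact ⟨q', hqi', hqj', fun h' => hqq (h.trans h'.symm)⟩
        · exact ⟨q, hqi, hqj, h⟩
      refine hg.ne_one q (hM.three (g q) (c := R) hPQ ?_ ?_ (hP _ (mem_dropSubgroup g hqi))
        (hQ _ (mem_dropSubgroup g hqj)) (hR _ (mem_dropSubgroup g hqm)))
      · rintro rfl
        exact hcommon i m P hmi.symm hP hR
      · rintro rfl
        exact hcommon j m Q hmj.symm hQ hR
    · exact h
  exact hM.false_of_torus hg hPQ hkj.symm hlj.symm hkl
    (hP _ (mem_dropSubgroup g hki)) (hQ _ (mem_dropSubgroup g hkj))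
    (hP _ (mem_dropSubgroup g hli)) (hQ _ (mem_dropSubgroup g hlj))
    (hP _ (mem_dropSubgroup g hij.symm)) hjQ (hne k hki hkj) (hne l hli hlj)

/-- For an irredundant sequence, a pair of points cannot be stabilized by all terms. -/
theorem not_permutes (hM : MoebiusAction p G X) (hg : IsIrredundantGenerating g) {a b : X}
    (hab : a ≠ b) : ¬ ∀ i, Permutes (g i) a b := by
  intro h
  obtain ⟨S, hS⟩ := permutes_stabilizer (G := G) a b
  have : S = ⊤ := hg.eq_top fun i => (hS _).mpr (h i)
  exact hM.not_fixesPair ⟨a, b, hab, fun x _ => (hS x).mp (this ▸ Subgroup.mem_top x)⟩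

/-- Compare the fixed point `P` with the type of another dropped subgroup. A stabilized pair
containing `P` leads to `false_of_torus`. If the pair avoids `P`, then `g k` and `g l` both fix `P`
and swap the pair, so their product has three fixed points and they are mutually inverse. The `S₄`
type is `false_of_embeds`. -/
theorem not_fixesPoint_dropSubgroup (hM : MoebiusAction p G X) (hg : IsIrredundantGenerating g)
    (hn : 4 ≤ n) (i : Fin n) : ¬ FixesPoint (dropSubgroup g i) X := by
  intro hi
  have hnot : ∀ m, m ≠ i → FixesPair (dropSubgroup g m) X ∨
      EmbedsInPermFour p (dropSubgroup g m) := by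
    intro m hm
    rcases hM.trichotomy _ (hg.2 m) with h | h
    · exact (hM.not_two_fixesPoint hg hn hm h hi).elim
    · exact h
  obtain ⟨P, hP⟩ := hi
  have hP : ∀ m, m ≠ i → g m • P = P := fun m hm => hP _ (mem_dropSubgroup g hm)
  obtain ⟨j, -, hji, -, -, -, -⟩ := exists_two_ne hn i i
  obtain ⟨k, l, hki, hkj, hli, hlj, hkl⟩ := exists_two_ne hn i j
  rcases hnot j hji with ⟨Q, R, hQR, hfix⟩ | h
  · have hfix : ∀ m, m ≠ j → Permutes (g m) Q R := fun m hm => hfix _ (mem_dropSubgroup g hm)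
    have key : ∀ S, P ≠ S → (∀ m, m ≠ j → Permutes (g m) P S) → False := by
      intro S hPS hfix
      have hS : ∀ m, m ≠ i → m ≠ j → g m • S = S := by
        intro m hmi hmj
        rcases hfix m hmj with h | h
        · exact h.2
        · exact absurd ((hP m hmi).symm.trans h.1) hPS
      refine hM.false_of_torus hg hPS hkj.symm hlj.symm hkl (hP k hki) (hS k hki hkj) (hP l hli)
        (hS l hli hlj) (hP j hji) (fun hjS => ?_) (hnot k hki) (hnot l hli)
      refine hM.not_permutes hg hPS fun m => ?_
      by_cases hmj : m = j
      · rw [hmj]; exact Or.inl ⟨hP j hji, hjS⟩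
      · exact hfix m hmj
    by_cases hPQ : P = Q
    · subst hPQ
      exact key R hQR hfix
    by_cases hPR : P = R
    · subst hPR
      exact key Q (Ne.symm hQR) fun m hm => (hfix m hm).symm
    have hswap : ∀ m, m ≠ i → m ≠ j → g m • Q = R ∧ g m • R = Q := by
      intro m hmi hmj
      rcases hfix m hmj with h | h
      · exact absurd (hM.three (g m) hPQ hPR hQR (hP m hmi) h.1 h.2) (hg.ne_one m)
      · exact h
    have h1 : g k * g l = 1 := by
      refine hM.three _ hPQ hPR hQR ?_ ?_ ?_
      · rw [mul_smul, hP l hli, hP k hki]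
      · rw [mul_smul, (hswap l hli hlj).1, (hswap k hki hkj).2]
      · rw [mul_smul, (hswap l hli hlj).2, (hswap k hki hkj).1]
    apply hg.notMem_zpowers hkl.symm (i := k)
    rw [eq_inv_of_mul_eq_one_left h1]
    exact inv_mem (Subgroup.mem_zpowers _)
  · exact hM.false_of_embeds hg h hkj hlj hkl (hP k hki) (hP l hli)

theorem fixesPair_or_embeds (hM : MoebiusAction p G X) (hg : IsIrredundantGenerating g)
    (hn : 4 ≤ n) (i : Fin n) :
    FixesPair (dropSubgroup g i) X ∨ EmbedsInPermFour p (dropSubgroup g i) :=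
  (hM.trichotomy _ (hg.2 i)).resolve_left (hM.not_fixesPoint_dropSubgroup hg hn i)

/-- Two stabilized pairs sharing a point are equal. -/
theorem pairs_disjoint (hM : MoebiusAction p G X) {x : G} (hx : x ≠ 1) {P Q S : X} (hPQ : P ≠ Q)
    (hPS : P ≠ S) (h1 : Permutes x P Q) (h2 : Permutes x P S) : Q = S := by
  by_contra hQS
  rcases h1 with h1 | h1
  · rcases h2 with h2 | h2
    · exact hx (hM.three x hPQ hPS hQS h1.1 h1.2 h2.2)
    · exact hPS (h1.1.symm.trans h2.1)
  · rcases h2 with h2 | h2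
    · exact hPQ (h2.1.symm.trans h1.1)
    · exact hQS (h1.1.symm.trans h2.1)

/-- `x` permutes `P, Q` and `R, S` in one of the three nontrivial ways. -/
def KleinType (x : G) (P Q R S : X) : Prop :=
  (x • P = P ∧ x • Q = Q ∧ x • R = S ∧ x • S = R) ∨
  (x • P = Q ∧ x • Q = P ∧ x • R = R ∧ x • S = S) ∨
  (x • P = Q ∧ x • Q = P ∧ x • R = S ∧ x • S = R)

/-- The three types behave as the involutions of a Klein four-group: equal types multiply to 1,
which is excluded, and three different types have product 1. -/
theorem KleinType.mul_mul_eq_one {P Q R S : X}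
    (hone : ∀ x : G, x • P = P → x • Q = Q → x • R = R → x • S = S → x = 1) {x y z : G}
    (hx : KleinType x P Q R S) (hy : KleinType y P Q R S) (hz : KleinType z P Q R S)
    (hxy : x * y ≠ 1) (hxz : x * z ≠ 1) (hyz : y * z ≠ 1) : x * y * z = 1 := by
  rcases hx with ⟨a, b, c, d⟩ | ⟨a, b, c, d⟩ | ⟨a, b, c, d⟩ <;>
  rcases hy with ⟨a', b', c', d'⟩ | ⟨a', b', c', d'⟩ | ⟨a', b', c', d'⟩ <;>
  first
  | (refine absurd (hone _ ?_ ?_ ?_ ?_) hxy <;>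
      (simp only [mul_smul, a, b, c, d, a', b', c', d']; done))
  | (rcases hz with ⟨a₃, b₃, c₃, d₃⟩ | ⟨a₃, b₃, c₃, d₃⟩ | ⟨a₃, b₃, c₃, d₃⟩ <;>
    first
    | (refine absurd (hone _ ?_ ?_ ?_ ?_) hxz <;>
        (simp only [mul_smul, a, b, c, d, a₃, b₃, c₃, d₃]; done))
    | (refine absurd (hone _ ?_ ?_ ?_ ?_) hyz <;>
        (simp only [mul_smul, a', b', c', d', a₃, b₃, c₃, d₃]; done))
    | (refine hone _ ?_ ?_ ?_ ?_ <;>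
        (simp only [mul_smul, a, b, c, d, a', b', c', d', a₃, b₃, c₃, d₃])))

/-- If two of the subgroups stabilize pairs, there are exactly four terms, and the two others
generate a Klein four-group. -/
theorem two_fixesPair (hM : MoebiusAction p G X) (hg : IsIrredundantGenerating g) (hn : 4 ≤ n)
    {i j : Fin n} (hij : i ≠ j) (hi : FixesPair (dropSubgroup g i) X)
    (hj : FixesPair (dropSubgroup g j) X) {k l : Fin n} (hki : k ≠ i) (hkj : k ≠ j) (hli : l ≠ i)
    (hlj : l ≠ j) (hkl : k ≠ l) :
    n = 4 ∧ orderOf (g k) = 2 ∧ orderOf (g k * g l) = 2 := by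
  obtain ⟨P, Q, hPQ, hi⟩ := hi
  obtain ⟨R, S, hRS, hj⟩ := hj
  have hi : ∀ m, m ≠ i → Permutes (g m) P Q := fun m hm => hi _ (mem_dropSubgroup g hm)
  have hj : ∀ m, m ≠ j → Permutes (g m) R S := fun m hm => hj _ (mem_dropSubgroup g hm)
  -- If the two pairs met, the nontrivial term `g k` permuting both would make them equal, and then
  -- every term would stabilize that pair.
  have hshare : ∀ {P Q R S : X}, P ≠ Q → R ≠ S → (∀ m, m ≠ i → Permutes (g m) P Q) →
      (∀ m, m ≠ j → Permutes (g m) R S) → P ≠ R := by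
    rintro P Q P S hPQ hPS hi hj rfl
    have : Q = S := hM.pairs_disjoint (hg.ne_one k) hPQ hPS (hi k hki) (hj k hkj)
    subst this
    refine hM.not_permutes hg hPQ fun m => ?_
    by_cases hm : m = i
    · exact hj m (by rw [hm]; exact hij)
    · exact hi m hm
  have hi' : ∀ m, m ≠ i → Permutes (g m) Q P := fun m hm => (hi m hm).symm
  have hj' : ∀ m, m ≠ j → Permutes (g m) S R := fun m hm => (hj m hm).symm
  have hPR := hshare hPQ hRS hi hj
  have hPS := hshare hPQ hRS.symm hi hj'
  have hQR := hshare hPQ.symm hRS hi' hj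
  have hQS := hshare hPQ.symm hRS.symm hi' hj'
  have hone : ∀ x : G, (x • P = P ∧ x • Q = Q ∧ x • R = R ∧ x • S = S) → x = 1 :=
    fun x h => hM.three x hPQ hPR hQR h.1 h.2.1 h.2.2.1
  have hcase : ∀ m, m ≠ i → m ≠ j → KleinType (g m) P Q R S := by
    intro m hmi hmj
    rcases hi m hmi with h1 | h1 <;> rcases hj m hmj with h2 | h2
    · exact absurd (hone _ ⟨h1.1, h1.2, h2.1, h2.2⟩) (hg.ne_one m)
    · exact Or.inl ⟨h1.1, h1.2, h2.1, h2.2⟩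
    · exact Or.inr (Or.inl ⟨h1.1, h1.2, h2.1, h2.2⟩)
    · exact Or.inr (Or.inr ⟨h1.1, h1.2, h2.1, h2.2⟩)
  have hsq : ∀ m, m ≠ i → m ≠ j → g m * g m = 1 := by
    intro m hmi hmj
    apply hone
    simp only [mul_smul]
    rcases hcase m hmi hmj with ⟨a, b, c, d⟩ | ⟨a, b, c, d⟩ | ⟨a, b, c, d⟩ <;> simp [a, b, c, d]
  have hprod : ∀ m q, m ≠ q → g m * g q ≠ 1 := by
    intro m q hmq h
    apply hg.notMem_zpowers hmq.symm
    rw [eq_inv_of_mul_eq_one_left h]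
    exact inv_mem (Subgroup.mem_zpowers _)
  have ho : ∀ x : G, x * x = 1 → x ≠ 1 → orderOf x = 2 := fun x h1 h2 =>
    orderOf_eq_prime (by rw [pow_two, h1]) h2
  refine ⟨?_, ho _ (hsq k hki hkj) (hg.ne_one k), ho _ (hone _ ?_) (hprod k l hkl)⟩
  -- A fifth term would be the third involution of the Klein four-group of `g k` and `g l`, hence
  -- redundant.
  · by_contra hn4
    obtain ⟨m, hm⟩ := exists_notMem_of_card_lt {i, j, k, l} (by
      have := Finset.card_le_four (a := i) (b := j) (c := k) (d := l); omega)
    simp only [Finset.mem_insert, Finset.mem_singleton, not_or] at hm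
    obtain ⟨hmi, hmj, hmk, hml⟩ := hm
    have key : g k * g l * g m = 1 :=
      KleinType.mul_mul_eq_one (fun x a b c d => hone x ⟨a, b, c, d⟩) (hcase k hki hkj)
        (hcase l hli hlj) (hcase m hmi hmj) (hprod k l hkl) (hprod k m (Ne.symm hmk))
        (hprod l m (Ne.symm hml))
    refine hg.notMem_pair (i := m) (j := k) (k := l) (Ne.symm hmk) (Ne.symm hml) ?_
    rw [eq_inv_of_mul_eq_one_right key]
    exact inv_mem (mul_mem (mem_closure_pair_left _ _) (mem_closure_pair_right _ _))
  · simp only [mul_smul]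
    rcases hcase k hki hkj with ⟨a, b, c, d⟩ | ⟨a, b, c, d⟩ | ⟨a, b, c, d⟩ <;>
      rcases hcase l hli hlj with ⟨a', b', c', d'⟩ | ⟨a', b', c', d'⟩ | ⟨a', b', c', d'⟩ <;>
      simp [a, b, c, d, a', b', c', d']

theorem central_eq_one (hM : MoebiusAction p G X) (hg : IsIrredundantGenerating g) {z : G}
    (hz : orderOf z = 2) : ¬ ∀ i, g i * z = z * g i := by
  intro h
  have hc : Subgroup.centralizer {z} = (⊤ : Subgroup G) := hg.eq_top fun i =>
    Subgroup.mem_centralizer_singleton_iff.mpr (h i)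
  have := hM.eq_one_of_central (z := z) (by rw [hz]; exact hM.coprime_two) fun x =>
    Subgroup.mem_centralizer_singleton_iff.mp (hc ▸ Subgroup.mem_top x)
  rw [this, orderOf_one] at hz
  norm_num at hz

theorem mul_comm_of_orderOf_two {x y : G} (hx : orderOf x = 2) (hy : orderOf y = 2)
    (hxy : orderOf (x * y) = 2) : x * y = y * x := by
  have hx' := pow_orderOf_eq_one x
  have hy' := pow_orderOf_eq_one y
  have hxy' := pow_orderOf_eq_one (x * y)
  rw [hx, pow_two] at hx'
  rw [hy, pow_two] at hy'
  rw [hxy, pow_two] at hxy'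
  have hi := eq_inv_of_mul_eq_one_left hxy'
  rw [mul_inv_rev, ← eq_inv_of_mul_eq_one_left hx', ← eq_inv_of_mul_eq_one_left hy'] at hi
  exact hi

/-- Applying `two_fixesPair` to each two of `i`, `j`, `k` shows that there are four terms and that
the remaining one commutes with all the others, so it would be a central involution. -/
theorem not_three_fixesPair (hM : MoebiusAction p G X) (hg : IsIrredundantGenerating g)
    (hn : 4 ≤ n) {i j k : Fin n} (hij : i ≠ j) (hik : i ≠ k) (hjk : j ≠ k)
    (hi : FixesPair (dropSubgroup g i) X) (hj : FixesPair (dropSubgroup g j) X)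
    (hk : FixesPair (dropSubgroup g k) X) : False := by
  obtain ⟨l, hl⟩ := exists_notMem_of_card_lt {i, j, k} (by
      have := Finset.card_le_three (a := i) (b := j) (c := k); omega)
  simp only [Finset.mem_insert, Finset.mem_singleton, not_or] at hl
  obtain ⟨hli, hlj, hlk⟩ := hl
  obtain ⟨rfl, hl2, hlk2⟩ := hM.two_fixesPair hg hn hij hi hj hli hlj hik.symm hjk.symm hlk
  obtain ⟨-, hk2, -⟩ := hM.two_fixesPair hg hn hij hi hj hik.symm hjk.symm hli hlj (Ne.symm hlk)
  obtain ⟨-, hj2, -⟩ := hM.two_fixesPair hg hn hik hi hk hij.symm hjk hli hlk (Ne.symm hlj)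
  obtain ⟨-, -, hlj2⟩ := hM.two_fixesPair hg hn hik hi hk hli hlk hij.symm hjk hlj
  obtain ⟨-, hi2, -⟩ := hM.two_fixesPair hg hn hjk hj hk hij hik hlj hlk (Ne.symm hli)
  obtain ⟨-, -, hli2⟩ := hM.two_fixesPair hg hn hjk hj hk hlj hlk hij hik hli
  refine hM.central_eq_one hg hl2 fun m => ?_
  have hcover : ∀ i j k l m : Fin 4, i ≠ j → i ≠ k → j ≠ k → l ≠ i → l ≠ j → l ≠ k →
      m = i ∨ m = j ∨ m = k ∨ m = l := by decide
  rcases hcover i j k l m hij hik hjk hli hlj hlk with rfl | rfl | rfl | rfl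
  · exact (mul_comm_of_orderOf_two hl2 hi2 hli2).symm
  · exact (mul_comm_of_orderOf_two hl2 hj2 hlj2).symm
  · exact (mul_comm_of_orderOf_two hl2 hk2 hlk2).symm
  · rfl

/-- In a dropped subgroup of `S₄` type three terms generate everything, so with at least five terms
a fourth one in it is redundant. Then all types are pairs, contrary to `not_three_fixesPair`. -/
theorem length_eq_four (hM : MoebiusAction p G X) (hg : IsIrredundantGenerating g) (hn : 4 ≤ n) :
    n = 4 := by
  by_contra hn4
  have hE : ∀ i, ¬ EmbedsInPermFour p (dropSubgroup g i) := by
    intro i hi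
    obtain ⟨j, k, hji, -, hki, -, hjk⟩ := exists_two_ne hn i i
    obtain ⟨l, hl⟩ := exists_notMem_of_card_lt {i, j, k} (by
      have := Finset.card_le_three (a := i) (b := j) (c := k); omega)
    obtain ⟨m, hm⟩ := exists_notMem_of_card_lt {i, j, k, l} (by
      have := Finset.card_le_four (a := i) (b := j) (c := k) (d := l); omega)
    simp only [Finset.mem_insert, Finset.mem_singleton, not_or] at hl hm
    have := (hi.octahedral (mem_dropSubgroup g hji) (mem_dropSubgroup g hki)
      (mem_dropSubgroup g hl.1) (hg.independentTriple hjk (Ne.symm hl.2.1) (Ne.symm hl.2.2))).2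
    refine hg.notMem_closure m ?_ (this (mem_dropSubgroup g hm.1))
    rintro x (rfl | rfl | rfl)
    exacts [⟨j, Ne.symm hm.2.1, rfl⟩, ⟨k, Ne.symm hm.2.2.1, rfl⟩, ⟨l, Ne.symm hm.2.2.2, rfl⟩]
  have hD : ∀ i, FixesPair (dropSubgroup g i) X := fun i =>
    (hM.fixesPair_or_embeds hg hn i).resolve_right (hE i)
  have i : Fin n := ⟨0, by omega⟩
  obtain ⟨j, k, hji, -, hki, -, hjk⟩ := exists_two_ne hn i i
  exact hM.not_three_fixesPair hg hn hji.symm hki.symm hjk (hD i) (hD j) (hD k)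

end MoebiusAction

end MaximalSubgroupTypes

set_option linter.unusedSimpArgs false

/-! ### Sequences of length four consist of involutions -/

section FourTerms

open MulAction

/-- The orders of the products of an independent triple of involutions in a dihedral group, when
these orders are at most four. -/
def DihedralShape (a b c : ℕ) : Prop :=
  (a, b, c) = (2, 2, 3) ∨ (a, b, c) = (2, 3, 2) ∨ (a, b, c) = (3, 2, 2)

theorem mul_inverts {G : Type*} [Group G] {x y : G} (hy : orderOf y = 2)
    (hxy : orderOf (x * y) = 2) : y * x = x⁻¹ * y := by
  have hy' := pow_orderOf_eq_one y
  have hxy' := pow_orderOf_eq_one (x * y)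
  rw [hy, pow_two] at hy'
  rw [hxy, pow_two] at hxy'
  have hi : x * y = y⁻¹ * x⁻¹ := by rw [← mul_inv_rev]; exact eq_inv_of_mul_eq_one_left hxy'
  have : y⁻¹ = y := (eq_inv_of_mul_eq_one_left hy').symm
  rw [this] at hi
  rw [eq_inv_mul_iff_mul_eq, ← mul_assoc, hi]
  group

/-- Both `y` and `z` invert `x` by conjugation, so their product centralizes it. -/
theorem mul_comm_of_inverts {G : Type*} [Group G] {x y z : G} (hy : orderOf y = 2)
    (hz : orderOf z = 2) (hxy : orderOf (x * y) = 2) (hxz : orderOf (x * z) = 2) :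
    x * (y * z) = y * z * x := by
  have h1 := mul_inverts hy hxy
  have h2 := mul_inverts hz hxz
  have h3 : y * x⁻¹ = x * y := by
    rw [mul_inv_eq_iff_eq_mul, mul_assoc, h1, mul_inv_cancel_left]
  rw [mul_assoc, h2, ← mul_assoc y, h3, mul_assoc]

theorem orderOf_mul_comm {G : Type*} [Group G] (x y : G) : orderOf (x * y) = orderOf (y * x) := by
  have : y * x = MulAut.conj y (x * y) := by simp [mul_assoc]
  rw [this, MulEquiv.orderOf_eq]

variable {G X : Type*} [Group G] [MulAction G X] {p : ℕ}

theorem Permutes.swap_mul {x y : G} {P Q : X} (hx : x • P = P ∧ x • Q = Q)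
    (hy : y • P = Q ∧ y • Q = P) : (x * y) • P = Q ∧ (x * y) • Q = P := by
  simp only [mul_smul, hy.1, hy.2, hx.1, hx.2, and_self]

theorem Permutes.swap_mul_swap {x y : G} {P Q : X} (hx : x • P = Q ∧ x • Q = P)
    (hy : y • P = Q ∧ y • Q = P) : (x * y) • P = P ∧ (x * y) • Q = Q := by
  simp only [mul_smul, hy.1, hy.2, hx.1, hx.2, and_self]

namespace MoebiusAction

/-- The square fixes the two fixed points of `x` and also `P`. -/
theorem orderOf_eq_two_of_swap (hM : MoebiusAction p G X) {x : G} (hx : (orderOf x).Coprime p)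
    {P Q : X} (hPQ : P ≠ Q) (h : x • P = Q ∧ x • Q = P) : orderOf x = 2 := by
  have hx1 : x ≠ 1 := by
    rintro rfl
    exact hPQ (by rw [← h.1, one_smul])
  obtain ⟨R, S, hRS, hR, hS⟩ := hM.exists_fixed x hx1 hx
  have hne : ∀ T, x • T = T → T ≠ P := by
    rintro T hT rfl
    exact hPQ (hT.symm.trans h.1)
  refine orderOf_eq_prime (hM.three _ hRS (hne R hR) (hne S hS) ?_ ?_ ?_) hx1
  · rw [pow_two, mul_smul, hR, hR]
  · rw [pow_two, mul_smul, hS, hS]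
  · rw [pow_two, mul_smul, h.1, h.2]

theorem coprime_of_mem (hM : MoebiusAction p G X) {a : ℕ} (h : a = 2 ∨ a = 3 ∨ a = 4) :
    a.Coprime p := by
  rcases h with rfl | rfl | rfl
  · exact hM.coprime_two
  · exact hM.coprime_three
  · exact Nat.Coprime.pow_left 2 hM.coprime_two

/-- Here `x` is the only involution among the rotations, so `y` and `z` are reflections and `x * y`,
`x * z` are reflections too. The rotation `y * z` has odd order, since otherwise `x` would be one of
its powers. -/
theorem dihedral_of_fixed (hM : MoebiusAction p G X) {P Q : X} (hPQ : P ≠ Q) {x y z : G}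
    (hx : x • P = P ∧ x • Q = Q) (hy : Permutes y P Q) (hz : Permutes z P Q)
    (h : IndependentTriple x y z) (ox : orderOf x = 2) (oy : orderOf y = 2) (oz : orderOf z = 2)
    (hxy : orderOf (x * y) = 2 ∨ orderOf (x * y) = 3 ∨ orderOf (x * y) = 4)
    (hxz : orderOf (x * z) = 2 ∨ orderOf (x * z) = 3 ∨ orderOf (x * z) = 4)
    (hyz : orderOf (y * z) = 2 ∨ orderOf (y * z) = 3 ∨ orderOf (y * z) = 4) :
    orderOf (x * y) = 2 ∧ orderOf (x * z) = 2 ∧ orderOf (y * z) = 3 := by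
  have hrot : ∀ w, orderOf w = 2 → x ∉ Subgroup.zpowers w → Permutes w P Q →
      w • P = Q ∧ w • Q = P := by
    intro w ow hxw hw
    rcases hw with hw | hw
    · exact absurd (hM.mem_zpowers hPQ hx.1 hx.2 hw.1 hw.2 (by rw [ox, ow])) hxw
    · exact hw
  have hy' := hrot y oy (fun h' => h.1 (zpowers_le_closure_pair _ _ h')) hy
  have hz' := hrot z oz (fun h' => h.1 (by
    rw [Set.pair_comm]; exact zpowers_le_closure_pair _ _ h')) hz
  refine ⟨hM.orderOf_eq_two_of_swap (hM.coprime_of_mem hxy) hPQ (Permutes.swap_mul hx hy'),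
    hM.orderOf_eq_two_of_swap (hM.coprime_of_mem hxz) hPQ (Permutes.swap_mul hx hz'), ?_⟩
  have hyz' := Permutes.swap_mul_swap hy' hz'
  have hdvd : ¬ 2 ∣ orderOf (y * z) := by
    intro hd
    have hmem := hM.mem_zpowers hPQ hx.1 hx.2 hyz'.1 hyz'.2 (by rwa [ox])
    refine h.1 (Subgroup.zpowers_le.mpr ?_ hmem)
    exact mul_mem (mem_closure_pair_left _ _) (mem_closure_pair_right _ _)
  rcases hyz with h | h | h
  · exact absurd (by rw [h]) hdvd
  · exact h
  · exact absurd (by rw [h]; norm_num) hdvd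

theorem dihedralShape (hM : MoebiusAction p G X) {P Q : X} (hPQ : P ≠ Q) {x y z : G}
    (hx : Permutes x P Q) (hy : Permutes y P Q) (hz : Permutes z P Q)
    (h : IndependentTriple x y z) (ox : orderOf x = 2) (oy : orderOf y = 2) (oz : orderOf z = 2)
    (hxy : orderOf (x * y) = 2 ∨ orderOf (x * y) = 3 ∨ orderOf (x * y) = 4)
    (hxz : orderOf (x * z) = 2 ∨ orderOf (x * z) = 3 ∨ orderOf (x * z) = 4)
    (hyz : orderOf (y * z) = 2 ∨ orderOf (y * z) = 3 ∨ orderOf (y * z) = 4) :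
    DihedralShape (orderOf (x * y)) (orderOf (x * z)) (orderOf (y * z)) := by
  unfold DihedralShape
  rcases hx with hx | hx
  · obtain ⟨a, b, c⟩ := hM.dihedral_of_fixed hPQ hx hy hz h ox oy oz hxy hxz hyz
    rw [a, b, c]; simp
  rcases hy with hy | hy
  · obtain ⟨a, b, c⟩ := hM.dihedral_of_fixed hPQ hy (Or.inr hx) hz
      ⟨h.2.1, h.1, by rw [Set.pair_comm]; exact h.2.2⟩ oy ox oz
      (by rwa [orderOf_mul_comm]) hyz hxz
    rw [orderOf_mul_comm x y, a, b, c]; simp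
  rcases hz with hz | hz
  · obtain ⟨a, b, c⟩ := hM.dihedral_of_fixed hPQ hz (Or.inr hx) (Or.inr hy)
      ⟨h.2.2, by rw [Set.pair_comm]; exact h.1, by rw [Set.pair_comm]; exact h.2.1⟩ oz ox oy
      (by rwa [orderOf_mul_comm]) (by rwa [orderOf_mul_comm]) hxy
    rw [orderOf_mul_comm x z, orderOf_mul_comm y z, a, b, c]; simp
  -- Three reflections: the products are rotations of orders in `{2, 3, 4}`, and by independence no
  -- order divides another. No three such orders exist.
  exfalso
  have rxy := Permutes.swap_mul_swap hx hy
  have rxz := Permutes.swap_mul_swap hx hz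
  have ryz := Permutes.swap_mul_swap hy hz
  obtain ⟨h1, h2, h3⟩ := h
  have mxy : Subgroup.zpowers (x * y) ≤ Subgroup.closure {x, y} := Subgroup.zpowers_le.mpr
    (mul_mem (mem_closure_pair_left _ _) (mem_closure_pair_right _ _))
  have mxz : Subgroup.zpowers (x * z) ≤ Subgroup.closure {x, z} := Subgroup.zpowers_le.mpr
    (mul_mem (mem_closure_pair_left _ _) (mem_closure_pair_right _ _))
  have myz : Subgroup.zpowers (y * z) ≤ Subgroup.closure {y, z} := Subgroup.zpowers_le.mpr
    (mul_mem (mem_closure_pair_left _ _) (mem_closure_pair_right _ _))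
  have n1 : ¬ orderOf (x * y) ∣ orderOf (x * z) := fun hd => h2 <|
    (Subgroup.mul_mem_cancel_left _ (mem_closure_pair_left x z)).mp
      (mxz (hM.mem_zpowers hPQ rxy.1 rxy.2 rxz.1 rxz.2 hd))
  have n2 : ¬ orderOf (x * z) ∣ orderOf (x * y) := fun hd => h3 <|
    (Subgroup.mul_mem_cancel_left _ (mem_closure_pair_left x y)).mp
      (mxy (hM.mem_zpowers hPQ rxz.1 rxz.2 rxy.1 rxy.2 hd))
  have n3 : ¬ orderOf (x * y) ∣ orderOf (y * z) := fun hd => h1 <|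
    (Subgroup.mul_mem_cancel_right _ (mem_closure_pair_left y z)).mp
      (myz (hM.mem_zpowers hPQ rxy.1 rxy.2 ryz.1 ryz.2 hd))
  have n4 : ¬ orderOf (y * z) ∣ orderOf (x * y) := fun hd => h3 <|
    (Subgroup.mul_mem_cancel_left _ (mem_closure_pair_right x y)).mp
      (mxy (hM.mem_zpowers hPQ ryz.1 ryz.2 rxy.1 rxy.2 hd))
  have n5 : ¬ orderOf (x * z) ∣ orderOf (y * z) := fun hd => h1 <|
    (Subgroup.mul_mem_cancel_right _ (mem_closure_pair_right y z)).mp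
      (myz (hM.mem_zpowers hPQ rxz.1 rxz.2 ryz.1 ryz.2 hd))
  have n6 : ¬ orderOf (y * z) ∣ orderOf (x * z) := fun hd => h2 <|
    (Subgroup.mul_mem_cancel_right _ (mem_closure_pair_right x z)).mp
      (mxz (hM.mem_zpowers hPQ ryz.1 ryz.2 rxz.1 rxz.2 hd))
  rcases hxy with e1 | e1 | e1 <;> rcases hxz with e2 | e2 | e2 <;>
    rcases hyz with e3 | e3 | e3 <;> rw [e1, e2] at n1 n2 <;> rw [e1, e3] at n3 n4 <;>
    rw [e2, e3] at n5 n6 <;> revert n1 n2 n3 n4 n5 n6 <;> decide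

/-- The element `s` is a rotation. Were `y` or `z` a rotation, its product with `s` would have order
six. So both are reflections, and if the rotation `y * z` had order three it would generate `s`. -/
theorem dihedral_order_three (hM : MoebiusAction p G X) {P Q : X} (hPQ : P ≠ Q) {s y z : G}
    (hs : Permutes s P Q) (hy : Permutes y P Q) (hz : Permutes z P Q)
    (h : s ∉ Subgroup.closure {y, z}) (os : orderOf s = 3) (oy : orderOf y = 2)
    (oz : orderOf z = 2) (hsy : orderOf (s * y) = 2 ∨ orderOf (s * y) = 3)
    (hsz : orderOf (s * z) = 2 ∨ orderOf (s * z) = 3) :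
    orderOf (s * y) = 2 ∧ orderOf (s * z) = 2 ∧ orderOf (y * z) ≠ 3 := by
  have hs' : s • P = P ∧ s • Q = Q := by
    rcases hs with hs | hs
    · exact hs
    · have := hM.orderOf_eq_two_of_swap (by rw [os]; exact hM.coprime_three) hPQ hs
      omega
  have key : ∀ w, Permutes w P Q → orderOf w = 2 → (orderOf (s * w) = 2 ∨ orderOf (s * w) = 3) →
      (w • P = Q ∧ w • Q = P) ∧ orderOf (s * w) = 2 := by
    intro w hw ow hsw
    rcases hw with hw | hw
    · exfalso
      have hc : Commute s w := hM.commute hPQ hs'.1 hs'.2 hw.1 hw.2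
      have := hc.orderOf_mul_eq_mul_orderOf_of_coprime (by rw [os, ow]; norm_num)
      rw [os, ow] at this
      omega
    · exact ⟨hw, hM.orderOf_eq_two_of_swap (hM.coprime_of_mem (by tauto)) hPQ
        (Permutes.swap_mul hs' hw)⟩
  obtain ⟨hy', h1⟩ := key y hy oy hsy
  obtain ⟨hz', h2⟩ := key z hz oz hsz
  refine ⟨h1, h2, fun h3 => h ?_⟩
  have r := Permutes.swap_mul_swap hy' hz'
  refine Subgroup.zpowers_le.mpr ?_ (hM.mem_zpowers hPQ hs'.1 hs'.2 r.1 r.2 (by rw [os, h3]))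
  exact mul_mem (mem_closure_pair_left _ _) (mem_closure_pair_right _ _)

variable {g : Fin 4 → G}

theorem octahedral (hM : MoebiusAction p G X) (hg : IsIrredundantGenerating g) {i j k l : Fin 4}
    (hij : i ≠ j) (hik : i ≠ k) (hil : i ≠ l) (hjk : j ≠ k) (hjl : j ≠ l) (hkl : k ≠ l)
    (hl : ¬ FixesPair (dropSubgroup g l) X) : OctahedralTriple (g i) (g j) (g k) :=
  (((hM.fixesPair_or_embeds hg le_rfl l).resolve_left hl).octahedral (mem_dropSubgroup g hil)
    (mem_dropSubgroup g hjl) (mem_dropSubgroup g hkl) (hg.independentTriple hij hik hjk)).1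

/-- Of the three dropped subgroups containing `g i`, one is of `S₄` type, and `OctahedralTriple`
bounds the order. -/
theorem orderOf_two_or_three (hM : MoebiusAction p G X) (hg : IsIrredundantGenerating g)
    (i : Fin 4) : orderOf (g i) = 2 ∨ orderOf (g i) = 3 := by
  obtain ⟨j, k, hji, -, hki, -, hjk⟩ := exists_two_ne le_rfl i i
  obtain ⟨l, hl⟩ := exists_notMem_of_card_lt {i, j, k} (by
    have := Finset.card_le_three (a := i) (b := j) (c := k); omega)
  simp only [Finset.mem_insert, Finset.mem_singleton, not_or] at hl
  obtain ⟨hli, hlj, hlk⟩ := hl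
  by_cases hj : FixesPair (dropSubgroup g j) X
  · by_cases hk : FixesPair (dropSubgroup g k) X
    · by_cases hl : FixesPair (dropSubgroup g l) X
      · exact (hM.not_three_fixesPair hg le_rfl hjk (Ne.symm hlj) (Ne.symm hlk) hj hk hl).elim
      · exact (hM.octahedral hg hji.symm hki.symm (Ne.symm hli) hjk (Ne.symm hlj) (Ne.symm hlk)
          hl).1
    · exact (hM.octahedral hg hji.symm (Ne.symm hli) hki.symm (Ne.symm hlj) hjk hlk hk).1
  · exact (hM.octahedral hg hki.symm (Ne.symm hli) hji.symm (Ne.symm hlk) hjk.symm hlj hj).1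

/-- Two independent elements of order three cannot be rotations about the same pair, so dropping `b`
or `c` gives `S₄` type, and `g b`, `g c` are involutions inverting both elements. This shape is not
allowed when dropping `a` or `i`; those stabilize pairs, so `g b * g c` is an involution, and it
commutes with every term. -/
theorem not_two_order_three (hM : MoebiusAction p G X) (hg : IsIrredundantGenerating g)
    {i a b c : Fin 4} (hia : i ≠ a) (hib : i ≠ b) (hic : i ≠ c) (hab : a ≠ b) (hac : a ≠ c)
    (hbc : b ≠ c) (oi : orderOf (g i) = 3) (oa : orderOf (g a) = 3) : False := by
  have key : ∀ b c : Fin 4, i ≠ b → i ≠ c → a ≠ b → a ≠ c → b ≠ c →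
      orderOf (g b) = 2 ∧ orderOf (g i * g b) = 2 ∧ orderOf (g a * g b) = 2 := by
    intro b c hib hic hab hac hbc
    have hc : ¬ FixesPair (dropSubgroup g c) X := by
      rintro ⟨P, Q, hPQ, hfix⟩
      have rot : ∀ m, m ≠ c → orderOf (g m) = 3 → g m • P = P ∧ g m • Q = Q := by
        intro m hm om
        rcases hfix _ (mem_dropSubgroup g hm) with h | h
        · exact h
        · have := hM.orderOf_eq_two_of_swap (by rw [om]; exact hM.coprime_three) hPQ h
          omega
      have ri := rot i hic oi
      have ra := rot a hac oa
      exact hg.notMem_zpowers hia.symm (hM.mem_zpowers hPQ ri.1 ri.2 ra.1 ra.2 (by rw [oi, oa]))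
    have := (hM.octahedral hg hia hib hic hab hac hbc hc).2.1 oi
    rcases this with h | h | h
    · omega
    · exact ⟨h.1, h.2.2.1, h.2.2.2⟩
    · omega
  obtain ⟨ob, oib, oab⟩ := key b c hib hic hab hac hbc
  obtain ⟨oc, oic, oac⟩ := key c b hic hib hac hab hbc.symm
  have hD : ∀ x y, x ≠ y → x ≠ b → x ≠ c → y ≠ b → y ≠ c → orderOf (g x) = 3 →
      orderOf (g x * g b) = 2 → orderOf (g x * g c) = 2 → FixesPair (dropSubgroup g y) X := by
    intro x y hxy hxb hxc hyb hyc ox oxb oxc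
    by_contra h
    have := (hM.octahedral hg hxb hxc hxy hbc hyb.symm hyc.symm h).2.1 ox
    rcases this with h | h | h
    · omega
    · omega
    · rcases h.2.2.1 with h' | h' <;> simp only [oxb, oxc] at h' <;> omega
  have hDa := hD i a hia hib hic hab hac oi oib oic
  have hDi := hD a i hia.symm hab hac hib hic oa oab oac
  obtain ⟨-, -, obc⟩ := hM.two_fixesPair hg le_rfl hia hDi hDa hib.symm hab.symm hic.symm hac.symm
    hbc
  have hcomm := mul_comm_of_orderOf_two ob oc obc
  refine hM.central_eq_one hg obc fun m => ?_
  have hcover : ∀ i a b c m : Fin 4, i ≠ a → i ≠ b → i ≠ c → a ≠ b → a ≠ c → b ≠ c →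
      m = i ∨ m = a ∨ m = b ∨ m = c := by decide
  rcases hcover i a b c m hia hib hic hab hac hbc with rfl | rfl | rfl | rfl
  · exact mul_comm_of_inverts ob oc oib oic
  · exact mul_comm_of_inverts ob oc oab oac
  · rw [hcomm, ← mul_assoc, hcomm]
  · rw [← mul_assoc, ← hcomm]

theorem not_order_three (hM : MoebiusAction p G X) (hg : IsIrredundantGenerating g)
    {i : Fin 4} (oi : orderOf (g i) = 3) : False := by
  have two : ∀ m, m ≠ i → orderOf (g m) = 2 := by
    intro m hm
    rcases hM.orderOf_two_or_three hg m with h | h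
    · exact h
    · obtain ⟨b, c, hbi, hbm, hci, hcm, hbc⟩ := exists_two_ne le_rfl i m
      exact (hM.not_two_order_three hg hm.symm hbi.symm hci.symm hbm.symm hcm.symm hbc oi h).elim
  have hS : ∀ a b c, i ≠ a → i ≠ b → i ≠ c → a ≠ b → a ≠ c → b ≠ c →
      ¬ FixesPair (dropSubgroup g c) X →
      (orderOf (g i * g a) = 2 ∧ orderOf (g i * g b) = 3 ∨
        orderOf (g i * g a) = 3 ∧ orderOf (g i * g b) = 2) ∧
      (orderOf (g a * g b) = 2 ∨ orderOf (g a * g b) = 4) := by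
    intro a b c hia hib hic hab hac hbc hc
    have oa := two a hia.symm
    have ob := two b hib.symm
    rcases (hM.octahedral hg hia hib hic hab hac hbc hc).2.1 oi with h | h | h
    · omega
    · omega
    · exact ⟨h.2.2.1, h.2.2.2⟩
  have h23 : ∀ a b c, i ≠ a → i ≠ b → i ≠ c → a ≠ b → a ≠ c → b ≠ c →
      orderOf (g i * g a) = 2 ∨ orderOf (g i * g a) = 3 := by
    intro a b c hia hib hic hab hac hbc
    by_cases hc : FixesPair (dropSubgroup g c) X
    · by_cases hb : FixesPair (dropSubgroup g b) X
      · have := (hM.two_fixesPair hg le_rfl hbc hb hc hib hic hab hac hia).2.1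
        omega
      · have := (hS a c b hia hic hib hac hab hbc.symm hb).1
        omega
    · have := (hS a b c hia hib hic hab hac hbc hc).1
      omega
  have hDl : ∀ a b c, i ≠ a → i ≠ b → i ≠ c → a ≠ b → a ≠ c → b ≠ c →
      FixesPair (dropSubgroup g c) X → orderOf (g i * g a) = 2 ∧ orderOf (g i * g b) = 2 ∧
        orderOf (g a * g b) ≠ 3 := by
    rintro a b c hia hib hic hab hac hbc ⟨P, Q, hPQ, hfix⟩
    exact hM.dihedral_order_three hPQ (hfix _ (mem_dropSubgroup g hic))
      (hfix _ (mem_dropSubgroup g hac)) (hfix _ (mem_dropSubgroup g hbc))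
      (hg.notMem_pair hia.symm hib.symm) oi (two a hia.symm) (two b hib.symm)
      (h23 a b c hia hib hic hab hac hbc) (h23 b a c hib hia hic hab.symm hbc hac)
  -- If `g i * g a` has order 3, dropping `b` or `c` gives `S₄` type, so `g i` has products of order
  -- 2 with `g b` and `g c`, and dropping `a` gives a pair. No product among `g a`, `g b`, `g c`
  -- then has order 3, whereas every admissible shape of three involutions contains a 3.
  have hmain : ∀ a b c, i ≠ a → i ≠ b → i ≠ c → a ≠ b → a ≠ c → b ≠ c →
      orderOf (g i * g a) ≠ 3 := by
    intro a b c hia hib hic hab hac hbc o3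
    have hc : ¬ FixesPair (dropSubgroup g c) X := fun h => by
      have := (hDl a b c hia hib hic hab hac hbc h).1
      omega
    have hb : ¬ FixesPair (dropSubgroup g b) X := fun h => by
      have := (hDl a c b hia hic hib hac hab hbc.symm h).1
      omega
    have sc := hS a b c hia hib hic hab hac hbc hc
    have sb := hS a c b hia hic hib hac hab hbc.symm hb
    have ha : FixesPair (dropSubgroup g a) X := by
      by_contra h
      have := (hS b c a hib hic hia hbc hab.symm hac.symm h).1
      omega
    have da := (hDl b c a hib hic hia hbc hab.symm hac.symm ha).2.2
    have oa := two a hia.symm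
    have ob := two b hib.symm
    have oc := two c hic.symm
    by_cases hi : FixesPair (dropSubgroup g i) X
    · have obc := (hM.two_fixesPair hg le_rfl hia hi ha hib.symm hab.symm hic.symm hac.symm
        hbc).2.2
      obtain ⟨P, Q, hPQ, hfix⟩ := hi
      have := hM.dihedralShape hPQ (hfix _ (mem_dropSubgroup g hia.symm))
        (hfix _ (mem_dropSubgroup g hib.symm)) (hfix _ (mem_dropSubgroup g hic.symm))
        (hg.independentTriple hab hac hbc) oa ob oc (by omega) (by omega) (by omega)
      simp only [DihedralShape, Prod.mk.injEq] at this
      omega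
    · have := (hM.octahedral hg hab hac hia.symm hbc hib.symm hic.symm hi).2.2 oa ob oc
      simp only [InvolutionShape, Prod.mk.injEq] at this
      omega
  obtain ⟨a, b, hai, -, hbi, -, hab⟩ := exists_two_ne le_rfl i i
  obtain ⟨c, hc⟩ := exists_notMem_of_card_lt {i, a, b} (by
    have := Finset.card_le_three (a := i) (b := a) (c := b); omega)
  simp only [Finset.mem_insert, Finset.mem_singleton, not_or] at hc
  have hia := hai.symm
  have hib := hbi.symm
  have hic := Ne.symm hc.1
  have hac := Ne.symm hc.2.1
  have hbc := Ne.symm hc.2.2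
  have na := hmain a b c hia hib hic hab hac hbc
  have nb := hmain b a c hib hia hic hab.symm hbc hac
  have nc := hmain c a b hic hia hib hac.symm hbc.symm hab
  refine hM.not_three_fixesPair hg le_rfl hab hac hbc ?_ ?_ ?_ <;> by_contra h
  · have := (hS b c a hib hic hia hbc hab.symm hac.symm h).1
    omega
  · have := (hS a c b hia hic hib hac hab hbc.symm h).1
    omega
  · have := (hS a b c hia hib hic hab hac hbc h).1
    omega

theorem orderOf_eq_two (hM : MoebiusAction p G X) (hg : IsIrredundantGenerating g)
    (i : Fin 4) : orderOf (g i) = 2 :=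
  (hM.orderOf_two_or_three hg i).resolve_right fun h => hM.not_order_three hg h

/-- The orders of the products of the terms of an irredundant generating sequence of length
four. -/
theorem product_orders (hM : MoebiusAction p G X) (hg : IsIrredundantGenerating g) {i j k l : Fin 4}
    (hij : i ≠ j) (hik : i ≠ k) (hil : i ≠ l) (hjk : j ≠ k) (hjl : j ≠ l) (hkl : k ≠ l) :
    (¬ FixesPair (dropSubgroup g l) X ∧ InvolutionShape (orderOf (g i * g j)) (orderOf (g i * g k))
      (orderOf (g j * g k)) (orderOf (g i * g j * g k))) ∨
    (FixesPair (dropSubgroup g l) X ∧ DihedralShape (orderOf (g i * g j)) (orderOf (g i * g k))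
      (orderOf (g j * g k))) := by
  have hS : ∀ i j k l : Fin 4, i ≠ j → i ≠ k → i ≠ l → j ≠ k → j ≠ l → k ≠ l →
      ¬ FixesPair (dropSubgroup g l) X → InvolutionShape (orderOf (g i * g j))
        (orderOf (g i * g k)) (orderOf (g j * g k)) (orderOf (g i * g j * g k)) :=
    fun i j k l hij hik hil hjk hjl hkl hl =>
      (hM.octahedral hg hij hik hil hjk hjl hkl hl).2.2 (hM.orderOf_eq_two hg i)
        (hM.orderOf_eq_two hg j) (hM.orderOf_eq_two hg k)
  have hpair : ∀ i j k l : Fin 4, i ≠ j → i ≠ k → i ≠ l → j ≠ k → j ≠ l → k ≠ l →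
      orderOf (g i * g j) = 2 ∨ orderOf (g i * g j) = 3 ∨ orderOf (g i * g j) = 4 := by
    intro i j k l hij hik hil hjk hjl hkl
    by_cases hl : FixesPair (dropSubgroup g l) X
    · by_cases hk : FixesPair (dropSubgroup g k) X
      · exact Or.inl (hM.two_fixesPair hg le_rfl hkl hk hl hik hil hjk hjl hij).2.2
      · have := hS i j l k hij hil hik hjl hjk hkl.symm hk
        simp only [InvolutionShape, Prod.mk.injEq] at this
        omega
    · have := hS i j k l hij hik hil hjk hjl hkl hl
      simp only [InvolutionShape, Prod.mk.injEq] at this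
      omega
  by_cases hl : FixesPair (dropSubgroup g l) X
  · refine Or.inr ⟨hl, ?_⟩
    obtain ⟨P, Q, hPQ, hfix⟩ := hl
    exact hM.dihedralShape hPQ (hfix _ (mem_dropSubgroup g hil))
      (hfix _ (mem_dropSubgroup g hjl)) (hfix _ (mem_dropSubgroup g hkl))
      (hg.independentTriple hij hik hjk) (hM.orderOf_eq_two hg i) (hM.orderOf_eq_two hg j)
      (hM.orderOf_eq_two hg k) (hpair i j k l hij hik hil hjk hjl hkl)
      (hpair i k j l hik hij hil hjk.symm hkl hjl) (hpair j k i l hjk hij.symm hjl hik.symm hkl hil)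
  · exact Or.inl ⟨hl, hS i j k l hij hik hil hjk hjl hkl hl⟩

end MoebiusAction

end FourTerms


/-! ### The trace form on traceless matrices -/

section Traces

open Matrix

/-- The Gram matrix entries of traceless matrices with respect to `-tr(AB)`. -/
def traceForm {F : Type*} [Field F] (A B : Matrix (Fin 2) (Fin 2) F) : F := -(A * B).trace

variable {F : Type*} [Field F] {A B C D : Matrix (Fin 2) (Fin 2) F}

theorem entry_of_trace_eq_zero (h : A.trace = 0) : A 1 1 = -A 0 0 := by
  rw [Matrix.trace_fin_two] at h
  linear_combination h

theorem traceForm_eq (hA : A.trace = 0) (hB : B.trace = 0) :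
    traceForm A B = -(2 * A 0 0 * B 0 0 + A 0 1 * B 1 0 + A 1 0 * B 0 1) := by
  rw [traceForm, Matrix.trace_fin_two, Matrix.mul_apply, Matrix.mul_apply, Fin.sum_univ_two,
    Fin.sum_univ_two, entry_of_trace_eq_zero hA, entry_of_trace_eq_zero hB]
  ring

theorem traceForm_comm (A B : Matrix (Fin 2) (Fin 2) F) : traceForm A B = traceForm B A := by
  rw [traceForm, traceForm, Matrix.trace_mul_comm]

theorem det_eq_one_iff (hA : A.trace = 0) : A.det = 1 ↔ A 0 0 ^ 2 + A 0 1 * A 1 0 = -1 := by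
  rw [Matrix.det_fin_two, entry_of_trace_eq_zero hA]
  constructor <;> intro h <;> linear_combination -h

theorem traceForm_self (hA : A.trace = 0) (hA1 : A.det = 1) : traceForm A A = 2 := by
  rw [traceForm_eq hA hA]
  linear_combination -2 * (det_eq_one_iff hA).mp hA1

/-- Conjugation by a traceless matrix is a reflection up to sign. -/
theorem mul_mul_self_eq (hA : A.trace = 0) (hA1 : A.det = 1) (hB : B.trace = 0) :
    A * B * A = B - traceForm A B • A := by
  rw [traceForm_eq hA hB]
  have hd := (det_eq_one_iff hA).mp hA1
  have hA' := entry_of_trace_eq_zero hA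
  have hB' := entry_of_trace_eq_zero hB
  ext i j
  fin_cases i <;> fin_cases j <;>
    simp [Matrix.mul_apply, Fin.sum_univ_two, hA', hB']
  · linear_combination -B 0 0 * hd
  · linear_combination -B 0 1 * hd
  · linear_combination -B 1 0 * hd
  · linear_combination B 0 0 * hd

/-- The square of the trace of a product of three traceless matrices of determinant one is half of
their Gram determinant. -/
theorem trace_mul_mul_sq (hA : A.trace = 0) (hA1 : A.det = 1) (hB : B.trace = 0) (hB1 : B.det = 1)
    (hC : C.trace = 0) (hC1 : C.det = 1) :
    (A * B * C).trace ^ 2 = 4 + traceForm A B * traceForm A C * traceForm B C - traceForm A B ^ 2 -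
        traceForm A C ^ 2 -
      traceForm B C ^ 2 := by
  rw [traceForm_eq hA hB, traceForm_eq hA hC, traceForm_eq hB hC]
  have hdA := (det_eq_one_iff hA).mp hA1
  have hdB := (det_eq_one_iff hB).mp hB1
  have hdC := (det_eq_one_iff hC).mp hC1
  have hA' := entry_of_trace_eq_zero hA
  have hB' := entry_of_trace_eq_zero hB
  have hC' := entry_of_trace_eq_zero hC
  simp only [Matrix.trace_fin_two, Matrix.mul_apply, Fin.sum_univ_two, hA', hB', hC']
  generalize A 0 0 = a at *
  generalize A 0 1 = a₁ at *
  generalize A 1 0 = a₂ at *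
  generalize B 0 0 = b at *
  generalize B 0 1 = b₁ at *
  generalize B 1 0 = b₂ at *
  generalize C 0 0 = c at *
  generalize C 0 1 = c₁ at *
  generalize C 1 0 = c₂ at *
  grind

/-- Three traceless matrices with nonzero Gram determinant span the space of traceless matrices. -/
theorem eq_zero_of_traceForm_eq_zero (h2 : (2 : F) ≠ 0) (hA : A.trace = 0) (hB : B.trace = 0)
    (hC : C.trace = 0) (hD : D.trace = 0)
    (hdet : traceForm A A * traceForm B B * traceForm C C + 2 * traceForm A B * traceForm A C *
        traceForm B C -
      traceForm A A * traceForm B C ^ 2 - traceForm B B * traceForm A C ^ 2 - traceForm C C *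
          traceForm A B ^ 2 ≠ 0)
    (h₁ : traceForm A D = 0) (h₂ : traceForm B D = 0) (h₃ : traceForm C D = 0) : D = 0 := by
  -- The Gram determinant is twice the square of this coordinate determinant. Its cofactors then
  -- give the entries of `D` by Cramer's rule.
  have hd : A 0 0 * (B 0 1 * C 1 0 - B 1 0 * C 0 1) - A 0 1 * (B 0 0 * C 1 0 - B 1 0 * C 0 0) +
      A 1 0 * (B 0 0 * C 0 1 - B 0 1 * C 0 0) ≠ 0 := by
    intro h
    apply hdet
    rw [traceForm_eq hA hA, traceForm_eq hB hB, traceForm_eq hC hC, traceForm_eq hA hB,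
        traceForm_eq hA hC, traceForm_eq hB hC]
    linear_combination 2 * (A 0 0 * (B 0 1 * C 1 0 - B 1 0 * C 0 1) -
      A 0 1 * (B 0 0 * C 1 0 - B 1 0 * C 0 0) + A 1 0 * (B 0 0 * C 0 1 - B 0 1 * C 0 0)) * h
  rw [traceForm_eq hA hD] at h₁
  rw [traceForm_eq hB hD] at h₂
  rw [traceForm_eq hC hD] at h₃
  have d0 : D 0 0 = 0 := by
    refine (mul_eq_zero.mp (?_ : 2 * (A 0 0 * (B 0 1 * C 1 0 - B 1 0 * C 0 1) -
      A 0 1 * (B 0 0 * C 1 0 - B 1 0 * C 0 0) + A 1 0 * (B 0 0 * C 0 1 - B 0 1 * C 0 0)) * D 0 0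
      = 0)).resolve_left (mul_ne_zero h2 hd)
    linear_combination (-1) * (B 0 1 * C 1 0 - B 1 0 * C 0 1) * h₁ +
      (A 0 1 * C 1 0 - A 1 0 * C 0 1) * h₂ - (A 0 1 * B 1 0 - A 1 0 * B 0 1) * h₃
  have d1 : D 0 1 = 0 := by
    refine (mul_eq_zero.mp (?_ : (A 0 0 * (B 0 1 * C 1 0 - B 1 0 * C 0 1) -
      A 0 1 * (B 0 0 * C 1 0 - B 1 0 * C 0 0) + A 1 0 * (B 0 0 * C 0 1 - B 0 1 * C 0 0)) * D 0 1
      = 0)).resolve_left hd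
    linear_combination (-1) * (B 0 0 * C 0 1 - B 0 1 * C 0 0) * h₁ +
      (A 0 0 * C 0 1 - A 0 1 * C 0 0) * h₂ - (A 0 0 * B 0 1 - A 0 1 * B 0 0) * h₃
  have d2 : D 1 0 = 0 := by
    refine (mul_eq_zero.mp (?_ : (A 0 0 * (B 0 1 * C 1 0 - B 1 0 * C 0 1) -
      A 0 1 * (B 0 0 * C 1 0 - B 1 0 * C 0 0) + A 1 0 * (B 0 0 * C 0 1 - B 0 1 * C 0 0)) * D 1 0
      = 0)).resolve_left hd
    linear_combination (B 0 0 * C 1 0 - B 1 0 * C 0 0) * h₁ -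
      (A 0 0 * C 1 0 - A 1 0 * C 0 0) * h₂ + (A 0 0 * B 1 0 - A 1 0 * B 0 0) * h₃
  have d3 := entry_of_trace_eq_zero hD
  ext i j
  fin_cases i <;> fin_cases j <;> simp [d0, d1, d2, d3]

end Traces


/-! ### Gram determinants of four involutions -/

section FourTracelessMatrices

open Matrix

variable {F : Type*} [Field F]

/-- The determinant of the symmetric matrix of size four with diagonal entries two. -/
def gramPoly (x₀₁ x₀₂ x₀₃ x₁₂ x₁₃ x₂₃ : F) : F :=
  16 - 4 * (x₀₁ ^ 2 + x₀₂ ^ 2 + x₀₃ ^ 2 + x₁₂ ^ 2 + x₁₃ ^ 2 + x₂₃ ^ 2) +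
    (x₀₁ ^ 2 * x₂₃ ^ 2 + x₀₂ ^ 2 * x₁₃ ^ 2 + x₀₃ ^ 2 * x₁₂ ^ 2) +
    4 * (x₀₁ * x₀₂ * x₁₂ + x₀₁ * x₀₃ * x₁₃ + x₀₂ * x₀₃ * x₂₃ + x₁₂ * x₁₃ * x₂₃) -
    2 * (x₀₁ * x₁₂ * x₂₃ * x₀₃ + x₀₁ * x₁₃ * x₂₃ * x₀₂ + x₀₂ * x₁₂ * x₁₃ * x₀₃)

theorem det_symmetric_four (a b c d x₀₁ x₀₂ x₀₃ x₁₂ x₁₃ x₂₃ : F) (ha : a = 2) (hb : b = 2)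
    (hc : c = 2) (hd : d = 2) :
    !![a, x₀₁, x₀₂, x₀₃; x₀₁, b, x₁₂, x₁₃; x₀₂, x₁₂, c, x₂₃; x₀₃, x₁₃, x₂₃, d].det =
      gramPoly x₀₁ x₀₂ x₀₃ x₁₂ x₁₃ x₂₃ := by
  subst ha hb hc hd
  simp [Matrix.det_succ_row_zero, Fin.sum_univ_succ, Fin.succAbove, gramPoly]
  ring

/-- Four traceless matrices are linearly dependent. -/
theorem gramPoly_traceForm (A : Fin 4 → Matrix (Fin 2) (Fin 2) F) (hA : ∀ i, (A i).trace = 0)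
    (hdet : ∀ i, (A i).det = 1) :
    gramPoly (traceForm (A 0) (A 1)) (traceForm (A 0) (A 2)) (traceForm (A 0) (A 3))
      (traceForm (A 1) (A 2)) (traceForm (A 1) (A 3)) (traceForm (A 2) (A 3)) = 0 := by
  rw [← det_symmetric_four _ _ _ _ _ _ _ _ _ _ (traceForm_self (hA 0) (hdet 0))
    (traceForm_self (hA 1) (hdet 1)) (traceForm_self (hA 2) (hdet 2))
    (traceForm_self (hA 3) (hdet 3))]
  simp only [traceForm_eq (hA _) (hA _)]
  generalize A 0 0 0 = a
  generalize A 0 0 1 = a₁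
  generalize A 0 1 0 = a₂
  generalize A 1 0 0 = b
  generalize A 1 0 1 = b₁
  generalize A 1 1 0 = b₂
  generalize A 2 0 0 = c
  generalize A 2 0 1 = c₁
  generalize A 2 1 0 = c₂
  generalize A 3 0 0 = d
  generalize A 3 0 1 = d₁
  generalize A 3 1 0 = d₂
  -- The Gram matrix factors through the three-dimensional space of traceless matrices; a zero
  -- column and a zero row make the factors square.
  have hprod : ∀ M : Matrix (Fin 4) (Fin 4) F,
      M = !![-a, -a₁, -a₂, 0; -b, -b₁, -b₂, 0; -c, -c₁, -c₂, 0; -d, -d₁, -d₂, 0] *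
        !![2 * a, 2 * b, 2 * c, 2 * d; a₂, b₂, c₂, d₂; a₁, b₁, c₁, d₁; 0, 0, 0, 0] →
      M.det = 0 := by
    rintro M rfl
    rw [Matrix.det_mul, Matrix.det_eq_zero_of_column_eq_zero 3, zero_mul]
    intro i
    fin_cases i <;> rfl
  apply hprod
  ext i j
  fin_cases i <;> fin_cases j <;> simp [Matrix.mul_apply, Fin.sum_univ_four] <;> ring

/-- The value attached to the order of a product of two involutions. -/
def sqOfOrder (n : ℕ) : F := if n = 3 then 1 else if n = 4 then 2 else 0

/-- The constraint on the product of the three Gram entries of a triangle with labels `a`, `b`,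
`c`. -/
def TriangleRel (a b c : ℕ) (t : F) : Prop :=
  (a = 3 ∧ b = 3 ∧ c = 3 → t = 1) ∧
    ((a = 3 ∧ b = 4 ∧ c = 4) ∨ (a = 4 ∧ b = 3 ∧ c = 4) ∨ (a = 4 ∧ b = 4 ∧ c = 3) → t = 2)

/-- The labels of triangles. -/
def TriangleLabels (a b c : ℕ) : Prop := (∃ d ∈ [3, 4], InvolutionShape a b c d) ∨ DihedralShape a
    b c

instance (a b c : ℕ) : Decidable (DihedralShape a b c) := by
  unfold DihedralShape; infer_instance

instance (a b c : ℕ) : Decidable (TriangleLabels a b c) := by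
  unfold TriangleLabels; infer_instance

/-- Representatives of the labelings of the complete graph on four vertices with nonsingular Gram
matrix. -/
def nondegenerateLabelings : List (ℕ × ℕ × ℕ × ℕ × ℕ × ℕ) :=
  [(2, 2, 3, 3, 2, 3), (2, 2, 3, 3, 2, 4), (2, 2, 3, 3, 3, 3), (2, 2, 3, 3, 4, 4),
    (2, 2, 4, 3, 3, 3), (2, 3, 3, 3, 3, 3), (2, 3, 3, 3, 4, 2), (2, 3, 4, 4, 3, 2),
    (2, 3, 4, 4, 3, 4), (3, 3, 3, 3, 3, 3), (3, 3, 4, 3, 4, 4), (3, 4, 4, 4, 4, 3),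
    (2, 2, 3, 3, 2, 2), (2, 2, 2, 3, 3, 3)]

/-- The label of an edge. -/
def edgeLabel (a b c d e f : ℕ) (i j : Fin 4) : ℕ :=
  match i, j with
  | 0, 1 => a | 1, 0 => a
  | 0, 2 => b | 2, 0 => b
  | 0, 3 => c | 3, 0 => c
  | 1, 2 => d | 2, 1 => d
  | 1, 3 => e | 3, 1 => e
  | 2, 3 => f | 3, 2 => f
  | _, _ => 0

/-- Up to permuting the vertices, every labeling with four admissible triangles is in a list of
sixteen; the two in front can have vanishing Gram determinant. The triangle conditions are
interleaved with the quantifiers so that bad partial labelings are discarded early. -/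
theorem exists_relabeling : ∀ a ∈ [2, 3, 4], ∀ b ∈ [2, 3, 4], ∀ d ∈ [2, 3, 4],
    TriangleLabels a b d → ∀ c ∈ [2, 3, 4], ∀ e ∈ [2, 3, 4], TriangleLabels a c e →
    ∀ f ∈ [2, 3, 4], TriangleLabels b c f → TriangleLabels d e f →
    ∃ i j k l : Fin 4, i ≠ j ∧ i ≠ k ∧ i ≠ l ∧ j ≠ k ∧ j ≠ l ∧ k ≠ l ∧
      (edgeLabel a b c d e f i j, edgeLabel a b c d e f i k, edgeLabel a b c d e f i l,
        edgeLabel a b c d e f j k, edgeLabel a b c d e f j l, edgeLabel a b c d e f k l) ∈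
      (2, 3, 3, 3, 3, 2) :: (2, 3, 3, 4, 4, 3) :: nondegenerateLabelings := by
  decide +kernel

variable {x₀₁ x₀₂ x₀₃ x₁₂ x₁₃ x₂₃ : F}

/-- The squares of the entries and the triangle products determine the value up to the sign of a
four-cycle product `ε`. For instance the complete graph labeled 3 gives 5, and the four-cycle with
labels 3, 3, 3, 4 gives `-1 - 2ε` with `ε² = 2`, which vanishes only if 7 = 0. -/
theorem gramPoly_ne_zero (h2 : (2 : F) ≠ 0) (h3 : (3 : F) ≠ 0) (h5 : (5 : F) ≠ 0)
    (h7 : (7 : F) ≠ 0) {a b c d e f : ℕ} (hmem : (a, b, c, d, e, f) ∈ nondegenerateLabelings)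
    (ha : x₀₁ ^ 2 = sqOfOrder a) (hb : x₀₂ ^ 2 = sqOfOrder b) (hc : x₀₃ ^ 2 = sqOfOrder c)
    (hd : x₁₂ ^ 2 = sqOfOrder d) (he : x₁₃ ^ 2 = sqOfOrder e) (hf : x₂₃ ^ 2 = sqOfOrder f)
    (t₁ : TriangleRel a b d (x₀₁ * x₀₂ * x₁₂)) (t₂ : TriangleRel a c e (x₀₁ * x₀₃ * x₁₃))
    (t₃ : TriangleRel b c f (x₀₂ * x₀₃ * x₂₃)) (t₄ : TriangleRel d e f (x₁₂ * x₁₃ * x₂₃)) :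
    gramPoly x₀₁ x₀₂ x₀₃ x₁₂ x₁₃ x₂₃ ≠ 0 := by
  intro h
  unfold gramPoly at h
  have h4 : (4 : F) ≠ 0 := by
    rw [show (4 : F) = 2 * 2 by norm_num]; exact mul_ne_zero h2 h2
  have h9 : (9 : F) ≠ 0 := by
    rw [show (9 : F) = 3 * 3 by norm_num]; exact mul_ne_zero h3 h3
  have h8 : (8 : F) ≠ 0 := by
    rw [show (8 : F) = 2 * 4 by norm_num]; exact mul_ne_zero h2 h4
  simp only [nondegenerateLabelings, List.mem_cons, Prod.mk.injEq, List.not_mem_nil,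
    or_false] at hmem
  rcases hmem with h' | h' | h' | h' | h' | h' | h' | h' | h' | h' | h' | h' | h' | h' <;>
    obtain ⟨rfl, rfl, rfl, rfl, rfl, rfl⟩ := h' <;>
    simp [sqOfOrder, TriangleRel] at ha hb hc hd he hf t₁ t₂ t₃ t₄ <;> grind

end FourTracelessMatrices


/-! ### The two degenerate labelings: one involution is a word in the others -/

section DegenerateLabelings

open Matrix

variable {F : Type*} [Field F] {A B C D : Matrix (Fin 2) (Fin 2) F}

theorem traceForm_sub_right (A B C : Matrix (Fin 2) (Fin 2) F) :
    traceForm A (B - C) = traceForm A B - traceForm A C := by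
  simp only [traceForm, mul_sub, Matrix.trace_sub]; ring

theorem traceForm_smul_right (A B : Matrix (Fin 2) (Fin 2) F) (r : F) :
    traceForm A (r • B) = r * traceForm A B := by
  simp only [traceForm, Matrix.mul_smul, Matrix.trace_smul, smul_eq_mul]; ring

/-- Four traceless matrices forming a four-cycle of products of order three, with the two diagonals
orthogonal: the last is a word in the others. -/
theorem word_of_four_cycle (h2 : (2 : F) ≠ 0) (hA : A.trace = 0) (hA1 : A.det = 1)
    (hB : B.trace = 0) (hB1 : B.det = 1) (hC : C.trace = 0) (hC1 : C.det = 1) (hD : D.trace = 0)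
    (hAB : traceForm A B = 0) (hCD : traceForm C D = 0) (hAC : traceForm A C ^ 2 = 1)
    (hBC : traceForm B C ^ 2 = 1) (hBD : traceForm B D ^ 2 = 1)
    (hprod : traceForm A C * traceForm B C * traceForm B D * traceForm A D = 1) :
    ∃ r : F, D = r • (B * (A * C * A) * B) := by
  -- Conjugations act as reflections up to sign, so the word is the vector `C` reflected in `A` and
  -- then in `B`. Pairing with `A` forces this scalar; the equality is checked by pairing with the
  -- basis `A`, `B`, `C`.
  refine ⟨-(traceForm A C * traceForm A D), ?_⟩
  have hA2 := traceForm_self hA hA1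
  have hB2 := traceForm_self hB hB1
  have hC2 := traceForm_self hC hC1
  have hBA : traceForm B A = 0 := by rw [traceForm_comm, hAB]
  have hCA := traceForm_comm C A
  have hCB := traceForm_comm C B
  have htr : (C - traceForm A C • A).trace = 0 := by
    simp [Matrix.trace_sub, Matrix.trace_smul, hA, hC]
  rw [mul_mul_self_eq hA hA1 hC, mul_mul_self_eq hB hB1 htr]
  simp only [traceForm_sub_right, traceForm_smul_right, hBA]
  rw [← sub_eq_zero]
  have h4 : (4 : F) ≠ 0 := by
    rw [show (4 : F) = 2 * 2 by norm_num]; exact mul_ne_zero h2 h2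
  refine eq_zero_of_traceForm_eq_zero h2 hA hB hC ?_ ?_ ?_ ?_ ?_
  · simp [Matrix.trace_sub, Matrix.trace_smul, hA, hC, hB, hD]
  · rw [hA2, hB2, hC2, hAB, hAC, hBC]
    intro h; apply h4; linear_combination h
  · simp only [traceForm_sub_right, traceForm_smul_right, hA2, hAB]
    linear_combination (-traceForm A D) * hAC
  · simp only [traceForm_sub_right, traceForm_smul_right, hB2, hBA]
    linear_combination (-traceForm B D) * hprod +
      traceForm A C * traceForm A D * traceForm B C * hBD
  · simp only [traceForm_sub_right, traceForm_smul_right, hC2, hCA, hCB, hCD]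
    linear_combination (-traceForm A C * traceForm A D) * (hBC + hAC)

/-- Four traceless matrices with labels `2`, `3`, `3`, `4`, `4`, `3`: the first is a word in the
others. -/
theorem word_of_label_four (h2 : (2 : F) ≠ 0) (hA : A.trace = 0)
    (hB : B.trace = 0) (hB1 : B.det = 1) (hC : C.trace = 0) (hC1 : C.det = 1) (hD : D.trace = 0)
    (hD1 : D.det = 1)
    (hAB : traceForm A B = 0) (hCD : traceForm C D ^ 2 = 1) (hAC : traceForm A C ^ 2 = 1)
    (hAD : traceForm A D ^ 2 = 1) (hBC : traceForm B C ^ 2 = 2) (hBD : traceForm B D ^ 2 = 2)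
    (hACD : traceForm A C * traceForm A D * traceForm C D = 1)
    (hBCD : traceForm B C * traceForm B D * traceForm C D = 2) :
    ∃ r : F, A = r • (D * (B * C * B) * D) := by
  refine ⟨traceForm A C, ?_⟩
  have hB2 := traceForm_self hB hB1
  have hC2 := traceForm_self hC hC1
  have hD2 := traceForm_self hD hD1
  have hBA : traceForm B A = 0 := by rw [traceForm_comm, hAB]
  have hCA := traceForm_comm C A
  have hCB := traceForm_comm C B
  have hDA := traceForm_comm D A
  have hDB := traceForm_comm D B
  have hDC := traceForm_comm D C
  have htr : (C - traceForm B C • B).trace = 0 := by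
    simp [Matrix.trace_sub, Matrix.trace_smul, hB, hC]
  rw [mul_mul_self_eq hB hB1 hC, mul_mul_self_eq hD hD1 htr]
  simp only [traceForm_sub_right, traceForm_smul_right]
  rw [← sub_eq_zero]
  refine eq_zero_of_traceForm_eq_zero h2 hB hC hD ?_ ?_ ?_ ?_ ?_
  · simp [Matrix.trace_sub, Matrix.trace_smul, hA, hC, hB, hD]
  · rw [hB2, hC2, hD2]
    intro h; apply h2; grind
  · simp only [traceForm_sub_right, traceForm_smul_right, hB2, hBA, hDB, hDC]
    grind
  · simp only [traceForm_sub_right, traceForm_smul_right, hC2, hCA, hCB, hDB, hDC]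
    grind
  · simp only [traceForm_sub_right, traceForm_smul_right, hD2, hDA, hDB, hDC]
    grind

end DegenerateLabelings


/-! ### Orders in `PSL(2, F)` and traces of lifts -/

section Lifts

open Matrix

variable {F : Type*} [Field F]

/-- The projection to the projective special linear group. -/
def toPSL : Matrix.SpecialLinearGroup (Fin 2) F →* Matrix.ProjectiveSpecialLinearGroup (Fin 2) F :=
  QuotientGroup.mk' _

theorem toPSL_surjective : Function.Surjective (toPSL (F := F)) := QuotientGroup.mk'_surjective _

theorem scalar_of_det_one {A : Matrix (Fin 2) (Fin 2) F} (hA : A.det = 1) {r : F}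
    (h : A = r • 1) : A = 1 ∨ A = -1 := by
  subst h
  have hr : r * r = 1 := by
    rwa [Matrix.det_smul, Matrix.det_one, mul_one, Fintype.card_fin, pow_two] at hA
  rcases mul_self_eq_one_iff.mp hr with rfl | rfl <;> simp

theorem toPSL_eq_one_iff {A : Matrix.SpecialLinearGroup (Fin 2) F} :
    toPSL A = 1 ↔ (A : Matrix (Fin 2) (Fin 2) F) = 1 ∨ (A : Matrix (Fin 2) (Fin 2) F) = -1 := by
  have : toPSL A = 1 ↔ A ∈ Subgroup.center (Matrix.SpecialLinearGroup (Fin 2) F) :=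
    QuotientGroup.eq_one_iff A
  rw [this, Matrix.SpecialLinearGroup.mem_center_iff]
  constructor
  · rintro ⟨r, -, h⟩
    exact scalar_of_det_one A.2 (r := r) (by rw [← h, Matrix.scalar_apply,
        Matrix.smul_one_eq_diagonal])
  · rintro (h | h)
    · exact ⟨1, by simp, by rw [h]; simp⟩
    · exact ⟨-1, by simp, by rw [h, map_neg, map_one]⟩

theorem toPSL_eq_iff {A B : Matrix.SpecialLinearGroup (Fin 2) F} :
    toPSL A = toPSL B ↔ (A : Matrix (Fin 2) (Fin 2) F) = B ∨ (A : Matrix (Fin 2) (Fin 2) F) = -B :=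
        by
  rw [← mul_inv_eq_one, ← map_inv, ← map_mul, toPSL_eq_one_iff]
  have h1 : (A : Matrix (Fin 2) (Fin 2) F) = ((A * B⁻¹ : Matrix.SpecialLinearGroup (Fin 2) F) :
      Matrix (Fin 2) (Fin 2) F) * B := by
    rw [← Matrix.SpecialLinearGroup.coe_mul, inv_mul_cancel_right]
  have h2 : (B : Matrix (Fin 2) (Fin 2) F) * ((B⁻¹ : Matrix.SpecialLinearGroup (Fin 2) F) : Matrix
      (Fin 2) (Fin 2) F) = 1 := by
    rw [← Matrix.SpecialLinearGroup.coe_mul, mul_inv_cancel, Matrix.SpecialLinearGroup.coe_one]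
  constructor
  · rintro (h | h) <;> rw [h] at h1 <;> simp only [one_mul, neg_mul] at h1
    · exact .inl h1
    · exact .inr h1
  · rintro (h | h) <;> rw [Matrix.SpecialLinearGroup.coe_mul, h]
    · exact .inl h2
    · exact .inr (by rw [neg_mul, h2])

theorem toPSL_eq_of_eq_smul {A B : Matrix.SpecialLinearGroup (Fin 2) F} {r : F}
    (h : (A : Matrix (Fin 2) (Fin 2) F) = r • (B : Matrix (Fin 2) (Fin 2) F)) : toPSL A = toPSL B
        := by
  have hA := A.2
  rw [h, Matrix.det_smul, B.2, mul_one, Fintype.card_fin, sq_eq_one_iff] at hA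
  rw [toPSL_eq_iff, h]
  rcases hA with rfl | rfl <;> simp

theorem mul_self_fin_two {A : Matrix (Fin 2) (Fin 2) F} (hA : A.det = 1) :
    A * A = A.trace • A - 1 := by
  rw [Matrix.det_fin_two] at hA
  ext i j
  fin_cases i <;> fin_cases j <;>
    simp [Matrix.mul_apply, Fin.sum_univ_two, Matrix.trace_fin_two] <;> grind

/-- A nontrivial image means that `A` is not scalar. Cayley–Hamilton writes a power of `A` as `r • A
+ s • 1`, so if that power is `±1` the polynomial `r` in the trace vanishes; this is how element
orders become trace equations. -/
theorem eq_zero_of_smul_eq {A : Matrix.SpecialLinearGroup (Fin 2) F} (h1 : toPSL A ≠ 1) {r s : F}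
    (h : r • (A : Matrix (Fin 2) (Fin 2) F) = s • 1) : r = 0 := by
  by_contra hr
  apply h1
  rw [toPSL_eq_one_iff]
  refine scalar_of_det_one A.2 (r := r⁻¹ * s) ?_
  rw [mul_smul, ← h, smul_smul, inv_mul_cancel₀ hr, one_smul]

theorem trace_of_orderOf_two {A : Matrix.SpecialLinearGroup (Fin 2) F} (h : orderOf (toPSL A) = 2) :
    (A : Matrix (Fin 2) (Fin 2) F).trace = 0 := by
  have h1 : toPSL A ≠ 1 := by rintro h'; rw [h', orderOf_one] at h; omega
  have h2 := pow_orderOf_eq_one (toPSL A)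
  rw [h, ← map_pow, toPSL_eq_one_iff, pow_two, Matrix.SpecialLinearGroup.coe_mul,
    mul_self_fin_two A.2] at h2
  rcases h2 with h2 | h2
  · refine eq_zero_of_smul_eq h1 (s := 2) ?_
    rw [sub_eq_iff_eq_add.mp h2, two_smul]
  · refine eq_zero_of_smul_eq h1 (s := 0) ?_
    rw [sub_eq_iff_eq_add.mp h2, zero_smul, neg_add_cancel]

theorem trace_sq_of_orderOf_three {A : Matrix.SpecialLinearGroup (Fin 2) F} (h : orderOf (toPSL A)
    = 3) :
    (A : Matrix (Fin 2) (Fin 2) F).trace ^ 2 = 1 := by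
  have h1 : toPSL A ≠ 1 := by rintro h'; rw [h', orderOf_one] at h; omega
  have h2 := pow_orderOf_eq_one (toPSL A)
  have h3 : (A : Matrix (Fin 2) (Fin 2) F) * A * A = ((A : Matrix (Fin 2) (Fin 2) F).trace ^ 2 - 1)
      •
      (A : Matrix (Fin 2) (Fin 2) F) - (A : Matrix (Fin 2) (Fin 2) F).trace • 1 := by
    rw [mul_self_fin_two A.2, sub_mul, one_mul, smul_mul_assoc, mul_self_fin_two A.2]
    module
  rw [h, ← map_pow, toPSL_eq_one_iff, pow_succ, pow_two, Matrix.SpecialLinearGroup.coe_mul,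
    Matrix.SpecialLinearGroup.coe_mul, h3] at h2
  rw [← sub_eq_zero]
  rcases h2 with h2 | h2
  · refine eq_zero_of_smul_eq h1 (s := 1 + (A : Matrix (Fin 2) (Fin 2) F).trace) ?_
    rw [sub_eq_iff_eq_add.mp h2, add_smul, one_smul]
  · refine eq_zero_of_smul_eq h1 (s := -1 + (A : Matrix (Fin 2) (Fin 2) F).trace) ?_
    rw [sub_eq_iff_eq_add.mp h2, add_smul, neg_smul, one_smul]

theorem trace_sq_of_orderOf_four {A : Matrix.SpecialLinearGroup (Fin 2) F} (h : orderOf (toPSL A) =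
    4) :
    (A : Matrix (Fin 2) (Fin 2) F).trace ^ 2 = 2 := by
  have h2 : orderOf (toPSL (A * A)) = 2 := by
    rw [map_mul, ← pow_two, orderOf_pow' _ two_ne_zero, h]
    norm_num
  have h3 := trace_of_orderOf_two h2
  rw [Matrix.SpecialLinearGroup.coe_mul, mul_self_fin_two A.2, Matrix.trace_sub, Matrix.trace_smul,
    Matrix.trace_one, Fintype.card_fin, smul_eq_mul] at h3
  push_cast at h3
  linear_combination h3

theorem trace_sq_eq_sqOfOrder {A : Matrix.SpecialLinearGroup (Fin 2) F}
    (h : orderOf (toPSL A) ∈ [2, 3, 4]) :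
    (A : Matrix (Fin 2) (Fin 2) F).trace ^ 2 = sqOfOrder (orderOf (toPSL A)) := by
  simp only [List.mem_cons, List.not_mem_nil, or_false] at h
  rcases h with h | h | h
  · rw [trace_of_orderOf_two h, h]; simp [sqOfOrder]
  · rw [trace_sq_of_orderOf_three h, h]; simp [sqOfOrder]
  · rw [trace_sq_of_orderOf_four h, h]; simp [sqOfOrder]

theorem edgeLabel_eq {α : Fin 4 → Fin 4 → ℕ} (hα : ∀ i j, α i j = α j i) {i j : Fin 4}
    (hij : i ≠ j) :
    edgeLabel (α 0 1) (α 0 2) (α 0 3) (α 1 2) (α 1 3) (α 2 3) i j = α i j := by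
  fin_cases i <;> fin_cases j <;>
    first
    | exact absurd rfl hij
    | rfl
    | exact hα _ _

variable {p : ℕ} {X : Type*} [MulAction (Matrix.ProjectiveSpecialLinearGroup (Fin 2) F) X]
  {g : Fin 4 → Matrix.ProjectiveSpecialLinearGroup (Fin 2) F}

/-- The labels of triangles are constrained. -/
theorem MoebiusAction.triangle (hM : MoebiusAction p (Matrix.ProjectiveSpecialLinearGroup (Fin 2)
    F) X)
    (hg : IsIrredundantGenerating g) {i j k l : Fin 4}
    (hij : i ≠ j) (hik : i ≠ k) (hil : i ≠ l) (hjk : j ≠ k) (hjl : j ≠ l) (hkl : k ≠ l) :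
    TriangleLabels (orderOf (g i * g j)) (orderOf (g i * g k)) (orderOf (g j * g k)) ∧
    ∀ A B C : Matrix.SpecialLinearGroup (Fin 2) F, toPSL A = g i → toPSL B = g j → toPSL C = g k →
      TriangleRel (orderOf (g i * g j)) (orderOf (g i * g k)) (orderOf (g j * g k))
        (traceForm A.1 B.1 * traceForm A.1 C.1 * traceForm B.1 C.1) := by
  have h := hM.product_orders hg hij hik hil hjk hjl hkl
  constructor
  · rcases h with ⟨-, h⟩ | ⟨-, h⟩
    · left
      unfold InvolutionShape at h ⊢
      rcases h with ⟨h, -⟩ | h | ⟨h, -⟩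
      · exact ⟨4, by simp, .inl ⟨h, rfl⟩⟩
      · exact ⟨3, by simp, .inr (.inl h)⟩
      · exact ⟨3, by simp, .inr (.inr ⟨h, rfl⟩)⟩
    · exact .inr h
  · intro A B C hA hB hC
    have tA : A.1.trace = 0 := trace_of_orderOf_two (by rw [hA]; exact hM.orderOf_eq_two hg i)
    have tB : B.1.trace = 0 := trace_of_orderOf_two (by rw [hB]; exact hM.orderOf_eq_two hg j)
    have tC : C.1.trace = 0 := trace_of_orderOf_two (by rw [hC]; exact hM.orderOf_eq_two hg k)
    have hsq := trace_mul_mul_sq tA A.2 tB B.2 tC C.2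
    have hx : ∀ U V : Matrix.SpecialLinearGroup (Fin 2) F, orderOf (toPSL U * toPSL V) ∈ [2, 3, 4] →
        traceForm U.1 V.1 ^ 2 = sqOfOrder (orderOf (toPSL U * toPSL V)) := by
      intro U V h
      rw [← map_mul] at h ⊢
      rw [← trace_sq_eq_sqOfOrder h, traceForm, neg_sq]
      rfl
    have hx1 := hx A B
    have hx2 := hx A C
    have hx3 := hx B C
    have h4 : orderOf (g i * g j * g k) = 4 → (A.1 * B.1 * C.1).trace ^ 2 = 2 := by
      rw [← hA, ← hB, ← hC, ← map_mul, ← map_mul]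
      exact fun h => trace_sq_of_orderOf_four h
    have h3 : orderOf (g i * g j * g k) = 3 → (A.1 * B.1 * C.1).trace ^ 2 = 1 := by
      rw [← hA, ← hB, ← hC, ← map_mul, ← map_mul]
      exact fun h => trace_sq_of_orderOf_three h
    rw [hsq] at h3 h4
    rw [hA, hB] at hx1
    rw [hA, hC] at hx2
    rw [hB, hC] at hx3
    generalize orderOf (g i * g j) = a at *
    generalize orderOf (g i * g k) = b at *
    generalize orderOf (g j * g k) = c at *
    have hd : ¬ ((2 : ℕ) = 3) := by omega
    constructor
    -- The triple product has order 4, so its squared trace is 2, and `trace_mul_mul_sq` reads `4 +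
    -- t - 3 = 2`. For the labels 3, 4, 4 the order is 3 and the equation is `4 + t - 5 = 1`.
    · rintro ⟨rfl, rfl, rfl⟩
      have := h4 (by simpa [InvolutionShape, DihedralShape] using h.imp And.right And.right)
      rw [hx1 (by simp), hx2 (by simp), hx3 (by simp)] at this
      simp only [sqOfOrder, if_true] at this
      linear_combination this
    · rintro (⟨rfl, rfl, rfl⟩ | ⟨rfl, rfl, rfl⟩ | ⟨rfl, rfl, rfl⟩) <;>
      · have := h3 (by simpa [InvolutionShape, DihedralShape] using h.imp And.right And.right)
        rw [hx1 (by simp), hx2 (by simp), hx3 (by simp)] at this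
        simp [sqOfOrder] at this
        linear_combination this

end Lifts


/-! ### No irredundant generating sequence of length four outside characteristic 7 -/

section LengthFourExclusion

open Matrix

variable {F : Type*} [Field F] {p : ℕ} {X : Type*}
  [MulAction (Matrix.ProjectiveSpecialLinearGroup (Fin 2) F) X]
  {g : Fin 4 → Matrix.ProjectiveSpecialLinearGroup (Fin 2) F}

/-- An irredundant generating sequence of length four yields a square root of two. -/
theorem MoebiusAction.exists_sq_eq_two
    (hM : MoebiusAction p (Matrix.ProjectiveSpecialLinearGroup (Fin 2) F) X)
    (hg : IsIrredundantGenerating g) : ∃ x : F, x ^ 2 = 2 := by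
  have h4 : ∀ x : Matrix.ProjectiveSpecialLinearGroup (Fin 2) F, orderOf x = 4 →
      ∃ x : F, x ^ 2 = 2 := by
    intro x hx
    obtain ⟨A, rfl⟩ := toPSL_surjective x
    exact ⟨_, trace_sq_of_orderOf_four hx⟩
  -- Every shape of `S₄` type involves an element of order four, whose trace squares to 2; and not
  -- all dropped subgroups stabilize pairs.
  have h : ∀ i j k l : Fin 4, i ≠ j → i ≠ k → i ≠ l → j ≠ k → j ≠ l → k ≠ l →
      ¬ FixesPair (dropSubgroup g l) X → ∃ x : F, x ^ 2 = 2 := by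
    intro i j k l hij hik hil hjk hjl hkl hl
    obtain ⟨-, h⟩ | ⟨h, -⟩ := hM.product_orders hg hij hik hil hjk hjl hkl
    · by_contra hne
      have hne' : ∀ x : Matrix.ProjectiveSpecialLinearGroup (Fin 2) F, orderOf x ≠ 4 :=
        fun x hx => hne (h4 x hx)
      have e1 := hne' (g i * g j)
      have e2 := hne' (g i * g k)
      have e3 := hne' (g j * g k)
      have e4 := hne' (g i * g j * g k)
      simp only [InvolutionShape, Prod.mk.injEq] at h
      omega
    · exact absurd h hl
  by_contra hne
  refine hM.not_three_fixesPair hg le_rfl (i := 1) (j := 2) (k := 3) (by decide) (by decide)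
    (by decide) ?_ ?_ ?_
  · by_contra hl
    exact hne (h 0 2 3 1 (by decide) (by decide) (by decide) (by decide) (by decide) (by decide) hl)
  · by_contra hl
    exact hne (h 0 1 3 2 (by decide) (by decide) (by decide) (by decide) (by decide) (by decide) hl)
  · by_contra hl
    exact hne (h 0 1 2 3 (by decide) (by decide) (by decide) (by decide) (by decide) (by decide) hl)

theorem MoebiusAction.not_isIrredundantGenerating_four
    (hM : MoebiusAction p (Matrix.ProjectiveSpecialLinearGroup (Fin 2) F) X)
    (h2 : (2 : F) ≠ 0) (h3 : (3 : F) ≠ 0) (h5 : (5 : F) = 0 → ∀ x : F, x ^ 2 ≠ 2)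
    (h7 : (7 : F) ≠ 0) : ¬ IsIrredundantGenerating g := by
  intro hg
  have h5' : (5 : F) ≠ 0 := fun h => by
    obtain ⟨x, hx⟩ := hM.exists_sq_eq_two hg
    exact h5 h x hx
  choose A hA using fun i => toPSL_surjective (g i)
  have htr : ∀ i, (A i).1.trace = 0 := fun i =>
    trace_of_orderOf_two (by rw [hA]; exact hM.orderOf_eq_two hg i)
  have hdet : ∀ i, (A i).1.det = 1 := fun i => (A i).2
  have hlab : ∀ i j k l : Fin 4, i ≠ j → i ≠ k → i ≠ l → j ≠ k → j ≠ l → k ≠ l →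
      TriangleLabels (orderOf (g i * g j)) (orderOf (g i * g k)) (orderOf (g j * g k)) ∧
      TriangleRel (orderOf (g i * g j)) (orderOf (g i * g k)) (orderOf (g j * g k))
        (traceForm (A i).1 (A j).1 * traceForm (A i).1 (A k).1 *
          traceForm (A j).1 (A k).1) := by
    intro i j k l hij hik hil hjk hjl hkl
    have := hM.triangle hg hij hik hil hjk hjl hkl
    exact ⟨this.1, this.2 _ _ _ (hA i) (hA j) (hA k)⟩
  have hmem : ∀ a b c : ℕ, TriangleLabels a b c → a ∈ [2, 3, 4] ∧ b ∈ [2, 3, 4] ∧ c ∈ [2, 3, 4] :=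
      by
    intro a b c h
    simp only [TriangleLabels, InvolutionShape, DihedralShape, List.mem_cons, List.not_mem_nil,
      or_false, exists_eq_or_imp, exists_eq_left, Prod.mk.injEq] at h ⊢
    omega
  have hsq : ∀ i j : Fin 4, i ≠ j →
      orderOf (g i * g j) ∈ [2, 3, 4] ∧
        traceForm (A i).1 (A j).1 ^ 2 = sqOfOrder (orderOf (g i * g j)) := by
    intro i j hij
    obtain ⟨k, l, hik, hil, hjk, hjl, hkl⟩ : ∃ k l : Fin 4, i ≠ k ∧ i ≠ l ∧ j ≠ k ∧ j ≠ l ∧ k ≠ l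
        := by
      revert i j; decide
    have h := (hmem _ _ _ (hlab i j k l hij hik hil hjk hjl hkl).1).1
    refine ⟨h, ?_⟩
    rw [← hA, ← hA, ← map_mul] at h ⊢
    rw [← trace_sq_eq_sqOfOrder h, traceForm, neg_sq]
    rfl
  have hsymm : ∀ i j : Fin 4, orderOf (g i * g j) = orderOf (g j * g i) :=
    fun i j => orderOf_mul_comm _ _
  have m01 := (hsq 0 1 (by decide)).1
  have m02 := (hsq 0 2 (by decide)).1
  have m03 := (hsq 0 3 (by decide)).1
  have m12 := (hsq 1 2 (by decide)).1
  have m13 := (hsq 1 3 (by decide)).1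
  have m23 := (hsq 2 3 (by decide)).1
  obtain ⟨i, j, k, l, hij, hik, hil, hjk, hjl, hkl, hcls⟩ := exists_relabeling _ m01 _ m02 _ m12
    (hlab 0 1 2 3 (by decide) (by decide) (by decide) (by decide) (by decide) (by decide)).1
    _ m03 _ m13 (hlab 0 1 3 2 (by decide) (by decide) (by decide) (by decide) (by decide)
      (by decide)).1 _ m23
    (hlab 0 2 3 1 (by decide) (by decide) (by decide) (by decide) (by decide) (by decide)).1
    (hlab 1 2 3 0 (by decide) (by decide) (by decide) (by decide) (by decide) (by decide)).1
  rw [edgeLabel_eq (α := fun i j => orderOf (g i * g j)) hsymm hij,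
    edgeLabel_eq (α := fun i j => orderOf (g i * g j)) hsymm hik,
    edgeLabel_eq (α := fun i j => orderOf (g i * g j)) hsymm hil,
    edgeLabel_eq (α := fun i j => orderOf (g i * g j)) hsymm hjk,
    edgeLabel_eq (α := fun i j => orderOf (g i * g j)) hsymm hjl,
    edgeLabel_eq (α := fun i j => orderOf (g i * g j)) hsymm hkl] at hcls
  have sij := (hsq i j hij).2
  have sik := (hsq i k hik).2
  have sil := (hsq i l hil).2
  have sjk := (hsq j k hjk).2
  have sjl := (hsq j l hjl).2
  have skl := (hsq k l hkl).2
  have t1 := (hlab i j k l hij hik hil hjk hjl hkl).2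
  have t2 := (hlab i j l k hij hil hik hjl hjk hkl.symm).2
  have t3 := (hlab i k l j hik hil hij hkl hjk.symm hjl.symm).2
  have t4 := (hlab j k l i hjk hjl hij.symm hkl hik.symm hil.symm).2
  have hgram := gramPoly_traceForm ![(A i).1, (A j).1, (A k).1, (A l).1]
    (by intro m; fin_cases m <;> simp [htr]) (by intro m; fin_cases m <;> simp)
  simp only [Matrix.cons_val] at hgram
  rw [List.mem_cons, List.mem_cons] at hcls
  rcases hcls with h | h | h
  · simp only [Prod.mk.injEq] at h
    obtain ⟨e1, e2, e3, e4, e5, e6⟩ := h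
    rw [e1] at sij; rw [e2] at sik; rw [e3] at sil; rw [e4] at sjk; rw [e5] at sjl; rw [e6] at skl
    simp only [sqOfOrder] at sij sik sil sjk sjl skl
    norm_num at sij skl
    norm_num only [if_true] at sik sil sjk sjl
    -- For these labels the Gram determinant is `2 - 2ε`, where `ε` is the four-cycle product; its
    -- vanishing gives `ε = 1`.
    obtain ⟨r, hr⟩ := word_of_four_cycle h2 (htr i) (hdet i) (htr j) (hdet j) (htr k) (hdet k)
      (htr l) sij skl sik sjk sjl (by
        rw [gramPoly, sij, skl] at hgram
        have h4 : (2 : F) * 2 ≠ 0 := mul_ne_zero h2 h2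
        grind)
    have := toPSL_eq_of_eq_smul (A := A l) (B := A j * (A i * A k * A i) * A j) hr
    simp only [map_mul, hA] at this
    refine hg.notMem_dropSubgroup l ?_
    rw [this]
    have mi := mem_dropSubgroup g hil
    have mj := mem_dropSubgroup g hjl
    have mk := mem_dropSubgroup g hkl
    exact mul_mem (mul_mem mj (mul_mem (mul_mem mi mk) mi)) mj
  · simp only [Prod.mk.injEq] at h
    obtain ⟨e1, e2, e3, e4, e5, e6⟩ := h
    rw [e2, e3, e6] at t3; rw [e4, e5, e6] at t4
    rw [e1] at sij; rw [e2] at sik; rw [e3] at sil; rw [e4] at sjk; rw [e5] at sjl; rw [e6] at skl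
    simp only [sqOfOrder] at sij sik sil sjk sjl skl
    norm_num at sij
    norm_num only [if_true] at sik sil sjk sjl skl
    obtain ⟨r, hr⟩ := word_of_label_four h2 (htr i) (htr j) (hdet j) (htr k) (hdet k)
      (htr l) (hdet l) sij skl sik sil sjk sjl (t3.1 (by decide)) (t4.2 (by decide))
    have := toPSL_eq_of_eq_smul (A := A i) (B := A l * (A j * A k * A j) * A l) hr
    simp only [map_mul, hA] at this
    refine hg.notMem_dropSubgroup i ?_
    rw [this]
    have ml := mem_dropSubgroup g hil.symm
    have mj := mem_dropSubgroup g hij.symm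
    have mk := mem_dropSubgroup g hik.symm
    exact mul_mem (mul_mem ml (mul_mem (mul_mem mj mk) mj)) ml
  · exact gramPoly_ne_zero h2 h3 h5' h7 h sij sik sil sjk sjl skl t1 t2 t3 t4 hgram

end LengthFourExclusion


/-! ### The action on the projective line over the algebraic closure -/

section GeometricLine

open Matrix

/-- The projective line over the algebraic closure of `F`. -/
def GeometricLine (F : Type*) [Field F] : Type _ :=
  Projectivization (AlgebraicClosure F) (Fin 2 → AlgebraicClosure F)

variable {F : Type*} [Field F]

/-- Extension of scalars to the algebraic closure. -/
noncomputable def extend : Matrix.SpecialLinearGroup (Fin 2) F →*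
    Matrix.SpecialLinearGroup (Fin 2) (AlgebraicClosure F) :=
  Matrix.SpecialLinearGroup.map (algebraMap F (AlgebraicClosure F))

theorem coe_extend (A : Matrix.SpecialLinearGroup (Fin 2) F) :
    (extend A).1 = A.1.map (algebraMap F (AlgebraicClosure F)) := rfl

theorem extend_injective : Function.Injective (extend (F := F)) := by
  intro A B h
  ext i j
  have := congrFun (congrFun (congrArg Subtype.val h) i) j
  rw [coe_extend, coe_extend, Matrix.map_apply, Matrix.map_apply] at this
  exact (algebraMap F (AlgebraicClosure F)).injective this

theorem trace_extend (A : Matrix.SpecialLinearGroup (Fin 2) F) :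
    (extend A).1.trace = algebraMap F (AlgebraicClosure F) A.1.trace := by
  rw [coe_extend, Matrix.trace_fin_two, Matrix.trace_fin_two, map_add]
  rfl

theorem toPSL_eq_one_of_extend {A : Matrix.SpecialLinearGroup (Fin 2) F} {r : AlgebraicClosure F}
    (h : (extend A).1 = r • 1) : toPSL A = 1 := by
  rw [toPSL_eq_one_iff]
  rcases scalar_of_det_one (extend A).2 h with h | h
  · left
    have : A = 1 := extend_injective (by rw [map_one]; exact Subtype.ext h)
    rw [this]; rfl
  · right
    have : A = -1 := extend_injective (by
      apply Subtype.ext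
      rw [h, coe_extend]
      ext i j
      fin_cases i <;> fin_cases j <;> simp)
    rw [this]; rfl

theorem center_le_ker_extend : Subgroup.center (Matrix.SpecialLinearGroup (Fin 2) F) ≤
    ((MulAction.toPermHom (Matrix.SpecialLinearGroup (Fin 2) (AlgebraicClosure F))
      (Projectivization (AlgebraicClosure F) (Fin 2 → AlgebraicClosure F))).comp extend).ker := by
  intro A hA
  have h : toPSL A = 1 := (QuotientGroup.eq_one_iff A).mpr hA
  rw [MonoidHom.mem_ker, MonoidHom.comp_apply, ← MonoidHom.mem_ker,
    Projectivization.SL_mulAction_ker, Matrix.SpecialLinearGroup.mem_center_iff]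
  rw [toPSL_eq_one_iff] at h
  rcases h with h | h
  · refine ⟨1, by simp, ?_⟩
    rw [coe_extend, h]
    ext i j
    fin_cases i <;> fin_cases j <;> simp
  · refine ⟨-1, by simp, ?_⟩
    rw [coe_extend, h]
    ext i j
    fin_cases i <;> fin_cases j <;> simp

/-- The action of the projective special linear group on the geometric projective line. -/
noncomputable def toPermGeometricLine (F : Type*) [Field F] :
    Matrix.ProjectiveSpecialLinearGroup (Fin 2) F →* Equiv.Perm (GeometricLine F) :=
  QuotientGroup.lift _ _ center_le_ker_extend

noncomputable instance : MulAction (Matrix.ProjectiveSpecialLinearGroup (Fin 2) F)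
    (GeometricLine F) :=
  MulAction.compHom _ (toPermGeometricLine F)

/-- The point of the geometric projective line spanned by a vector. -/
noncomputable def GeometricLine.mk (v : Fin 2 → AlgebraicClosure F) (hv : v ≠ 0) : GeometricLine F
    :=
  Projectivization.mk (AlgebraicClosure F) v hv

theorem GeometricLine.exists_mk (x : GeometricLine F) : ∃ v hv, x = GeometricLine.mk v hv :=
  ⟨Projectivization.rep x, Projectivization.rep_nonzero x, (Projectivization.mk_rep x).symm⟩

theorem GeometricLine.mk_eq_iff {v w : Fin 2 → AlgebraicClosure F} {hv : v ≠ 0} {hw : w ≠ 0} :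
    GeometricLine.mk v hv = GeometricLine.mk w hw ↔ ∃ c : AlgebraicClosure F, c • w = v :=
  Projectivization.mk_eq_mk_iff' ..

theorem GeometricLine.smul_mk_eq_iff {A : Matrix.SpecialLinearGroup (Fin 2) F}
    {v w : Fin 2 → AlgebraicClosure F} {hv : v ≠ 0} {hw : w ≠ 0} :
    toPSL A • GeometricLine.mk v hv = GeometricLine.mk w hw ↔
      ∃ c : AlgebraicClosure F, (extend A).1 *ᵥ v = c • w := by
  have : toPSL A • GeometricLine.mk v hv =
    GeometricLine.mk (extend A • v) ((smul_ne_zero_iff_ne _).mpr hv) := rfl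
  rw [this, GeometricLine.mk_eq_iff]
  exact exists_congr fun c => eq_comm

end GeometricLine

/-! ### Eigenlines of two-by-two matrices -/

section Eigenvectors

open Matrix

variable {K : Type*} [Field K] {M : Matrix (Fin 2) (Fin 2) K} {u v w : Fin 2 → K} {a b c : K}

theorem eigenvalue_root (hM : M.det = 1) (hu : u ≠ 0) (h : M *ᵥ u = a • u) :
    a ^ 2 - M.trace * a + 1 = 0 := by
  have h2 : (M * M) *ᵥ u = (a * a) • u := by
    rw [← Matrix.mulVec_mulVec, h, Matrix.mulVec_smul, h, smul_smul]
  rw [mul_self_fin_two hM, Matrix.sub_mulVec, Matrix.smul_mulVec, h, Matrix.one_mulVec, smul_smul,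
    sub_eq_iff_eq_add, ← sub_eq_zero] at h2
  have h3 : (a ^ 2 - M.trace * a + 1) • u = 0 := by
    rw [← neg_eq_zero, ← h2]; module
  exact (smul_eq_zero.mp h3).resolve_right hu

/-- The determinant of two vectors of the plane. -/
def cross (u v : Fin 2 → K) : K := u 0 * v 1 - u 1 * v 0

theorem exists_smul_of_cross_eq_zero (hv : v ≠ 0) (h : cross u v = 0) : ∃ c : K, c • v = u := by
  unfold cross at h
  by_cases h0 : v 0 = 0
  · have h1 : v 1 ≠ 0 := fun h1 => hv (by ext i; fin_cases i <;> assumption)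
    refine ⟨u 1 / v 1, ?_⟩
    have hu : u 0 = 0 := by
      rw [h0, mul_zero, sub_zero] at h
      exact (mul_eq_zero.mp h).resolve_right h1
    ext i; fin_cases i
    · simp [h0, hu]
    · simp [h1]
  · refine ⟨u 0 / v 0, ?_⟩
    ext i; fin_cases i
    · simp [h0]
    · simp only [Pi.smul_apply, smul_eq_mul, Fin.mk_one]
      field_simp
      linear_combination h

theorem eq_of_mulVec_eq {N : Matrix (Fin 2) (Fin 2) K} (h : cross u v ≠ 0) (hu : M *ᵥ u = N *ᵥ u)
    (hv : M *ᵥ v = N *ᵥ v) : M = N := by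
  unfold cross at h
  have e : ∀ i, M i 0 = N i 0 ∧ M i 1 = N i 1 := by
    intro i
    have hu' := congrFun hu i
    have hv' := congrFun hv i
    simp only [Matrix.mulVec, dotProduct, Fin.sum_univ_two] at hu' hv'
    constructor
    · refine mul_right_cancel₀ h ?_
      linear_combination v 1 * hu' - u 1 * hv'
    · refine mul_right_cancel₀ h ?_
      linear_combination u 0 * hv' - v 0 * hu'
  ext i j
  fin_cases j
  exacts [(e i).1, (e i).2]

theorem eq_smul_one_of_eigenvalue_eq (h : cross u v ≠ 0) (hu : M *ᵥ u = a • u)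
    (hv : M *ᵥ v = a • v) : M = a • 1 := by
  refine eq_of_mulVec_eq h ?_ ?_ <;> rw [Matrix.smul_mulVec, Matrix.one_mulVec] <;> assumption

/-- A matrix with three eigenlines is scalar. -/
theorem scalar_of_three_eigenlines (hM : M.det = 1) (huv : cross u v ≠ 0) (huw : cross u w ≠ 0)
    (hvw : cross v w ≠ 0) (hu : M *ᵥ u = a • u) (hv : M *ᵥ v = b • v) (hw : M *ᵥ w = c • w) :
    ∃ r : K, M = r • 1 := by
  have hu0 : u ≠ 0 := by rintro rfl; simp [cross] at huv
  have hv0 : v ≠ 0 := by rintro rfl; simp [cross] at huv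
  have hw0 : w ≠ 0 := by rintro rfl; simp [cross] at huw
  have ra := eigenvalue_root hM hu0 hu
  have rb := eigenvalue_root hM hv0 hv
  have rc := eigenvalue_root hM hw0 hw
  by_cases hab : a = b
  · subst hab; exact ⟨a, eq_smul_one_of_eigenvalue_eq huv hu hv⟩
  by_cases hac : a = c
  · subst hac; exact ⟨a, eq_smul_one_of_eigenvalue_eq huw hu hw⟩
  -- Two distinct eigenvalues sum to the trace, so the third eigenline repeats one of them.
  have h1 : a + b = M.trace := by
    refine mul_left_cancel₀ (sub_ne_zero.mpr hab) ?_
    linear_combination ra - rb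
  have h2 : a + c = M.trace := by
    refine mul_left_cancel₀ (sub_ne_zero.mpr hac) ?_
    linear_combination ra - rc
  have hbc : b = c := by linear_combination h1 - h2
  subst hbc
  exact ⟨b, eq_smul_one_of_eigenvalue_eq hvw hv hw⟩

theorem exists_eigenvector (hM : M.det = 1) (h : a ^ 2 - M.trace * a + 1 = 0) :
    ∃ u, u ≠ 0 ∧ M *ᵥ u = a • u := by
  have hdet : (M - a • (1 : Matrix (Fin 2) (Fin 2) K)).det = 0 := by
    rw [Matrix.det_fin_two] at hM ⊢
    rw [Matrix.trace_fin_two] at h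
    simp
    linear_combination h + hM
  obtain ⟨u, hu, h⟩ := Matrix.exists_mulVec_eq_zero_iff.mpr hdet
  refine ⟨u, hu, ?_⟩
  rwa [Matrix.sub_mulVec, Matrix.smul_mulVec, Matrix.one_mulVec, sub_eq_zero] at h

theorem sub_one_mul_self (hM : M.det = 1) (ht : M.trace = 2 * a) (ha : a * a = 1) :
    (M - a • 1) * (M - a • 1) = 0 := by
  rw [sub_mul, mul_sub, mul_sub, mul_self_fin_two hM, ht]
  simp only [smul_mul_assoc, mul_smul_comm, one_mul, mul_one, smul_smul, ha]
  module

/-- In characteristic `p`, matrices with a double eigenvalue `±1` have `p`-th power `±1`. -/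
theorem pow_char_eq_smul {p : ℕ} [Fact p.Prime] [CharP K p] (hM : M.det = 1)
    (ht : M.trace = 2 * a) (ha : a * a = 1) : M ^ p = a ^ p • 1 := by
  have h : M = (M - a • 1) + a • 1 := by abel
  have hp2 : 2 ≤ p := (Fact.out : p.Prime).two_le
  have hc : Commute (M - a • 1) (a • (1 : Matrix (Fin 2) (Fin 2) K)) :=
    (Commute.one_right _).smul_right a
  rw [h, add_pow_char_of_commute p hc, smul_pow, one_pow]
  obtain ⟨k, rfl⟩ := Nat.exists_eq_add_of_le hp2
  rw [pow_add, pow_two, sub_one_mul_self hM ht ha, zero_mul, zero_add]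

end Eigenvectors


/-! ### Fixed points and cyclic stabilizers -/

section PlaneActions

open Matrix MulAction

variable {F : Type*} [Field F] {p : ℕ}

theorem GeometricLine.cross_ne_zero {u v : Fin 2 → AlgebraicClosure F} {hu : u ≠ 0} {hv : v ≠ 0}
    (h : GeometricLine.mk u hu ≠ GeometricLine.mk v hv) : cross u v ≠ 0 :=
  fun h' => h (GeometricLine.mk_eq_iff.mpr (exists_smul_of_cross_eq_zero hv h'))

theorem threeFixedPointsTrivial_geometricLine :
    ThreeFixedPointsTrivial (Matrix.ProjectiveSpecialLinearGroup (Fin 2) F) (GeometricLine F) := by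
  intro g x y z hxy hxz hyz gx gy gz
  obtain ⟨A, rfl⟩ := toPSL_surjective g
  obtain ⟨u, hu, rfl⟩ := x.exists_mk
  obtain ⟨v, hv, rfl⟩ := y.exists_mk
  obtain ⟨w, hw, rfl⟩ := z.exists_mk
  obtain ⟨a, ha⟩ := GeometricLine.smul_mk_eq_iff.mp gx
  obtain ⟨b, hb⟩ := GeometricLine.smul_mk_eq_iff.mp gy
  obtain ⟨c, hc⟩ := GeometricLine.smul_mk_eq_iff.mp gz
  obtain ⟨r, hr⟩ := scalar_of_three_eigenlines (extend A).2 (GeometricLine.cross_ne_zero hxy)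
    (GeometricLine.cross_ne_zero hxz) (GeometricLine.cross_ne_zero hyz) ha hb hc
  exact toPSL_eq_one_of_extend hr

theorem toPSL_pow_char [Fact p.Prime] [CharP F p] {A : Matrix.SpecialLinearGroup (Fin 2) F} {a : F}
    (ht : A.1.trace = 2 * a) (ha : a * a = 1) : toPSL A ^ p = 1 := by
  rw [← map_pow, toPSL_eq_one_iff]
  refine scalar_of_det_one (A ^ p).2 (r := a ^ p) ?_
  rw [Matrix.SpecialLinearGroup.coe_pow]
  exact pow_char_eq_smul A.2 ht ha

theorem toPSL_eq_one_of_coprime [Fact p.Prime] [CharP F p]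
    {A : Matrix.SpecialLinearGroup (Fin 2) F} {a : F}
    (ht : A.1.trace = 2 * a) (ha : a * a = 1) (h : (orderOf (toPSL A)).Coprime p) : toPSL A = 1 :=
        by
  rw [← orderOf_eq_one_iff]
  exact Nat.Coprime.eq_one_of_dvd h (orderOf_dvd_of_pow_eq_one (toPSL_pow_char ht ha))

/-- The eigenvalues are a root `a` of the characteristic polynomial and `trace - a`. If their
eigenlines coincide, `a = ±1` is a double eigenvalue, so `g ^ p = 1`, and an order prime to `p`
forces `g = 1`. -/
theorem exists_two_fixed_points [Fact p.Prime] [CharP F p]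
    (g : Matrix.ProjectiveSpecialLinearGroup (Fin 2) F) (hg : g ≠ 1) (h : (orderOf g).Coprime p) :
    ∃ a b : GeometricLine F, a ≠ b ∧ g • a = a ∧ g • b = b := by
  obtain ⟨A, rfl⟩ := toPSL_surjective g
  have hdeg : (Polynomial.X ^ 2 - Polynomial.C (extend A).1.trace * Polynomial.X + 1 :
      Polynomial (AlgebraicClosure F)).degree = 2 := by
    compute_degree!
  obtain ⟨a, ha⟩ := IsAlgClosed.exists_root (Polynomial.X ^ 2 - Polynomial.C (extend A).1.trace *
    Polynomial.X + 1 : Polynomial (AlgebraicClosure F)) (by rw [hdeg]; decide)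
  have ha' : a ^ 2 - (extend A).1.trace * a + 1 = 0 := by
    simpa [Polynomial.IsRoot] using ha
  have hb : ((extend A).1.trace - a) ^ 2 - (extend A).1.trace * ((extend A).1.trace - a) + 1 = 0 :=
      by
    linear_combination ha'
  obtain ⟨u, hu, hu'⟩ := exists_eigenvector (extend A).2 ha'
  obtain ⟨v, hv, hv'⟩ := exists_eigenvector (extend A).2 hb
  refine ⟨GeometricLine.mk u hu, GeometricLine.mk v hv, ?_, GeometricLine.smul_mk_eq_iff.mpr ⟨_,
      hu'⟩,
    GeometricLine.smul_mk_eq_iff.mpr ⟨_, hv'⟩⟩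
  intro huv
  obtain ⟨c, rfl⟩ := GeometricLine.mk_eq_iff.mp huv
  have hc : c ≠ 0 := by rintro rfl; simp at hu
  have hab : (extend A).1.trace - a = a := by
    rw [Matrix.mulVec_smul, hv', smul_comm a c] at hu'
    exact smul_left_injective _ hv ((smul_right_injective _ hc) hu')
  have ht : (extend A).1.trace = 2 * a := by linear_combination hab
  have haa : a * a = 1 := by rw [ht] at ha'; linear_combination -ha'
  rcases mul_self_eq_one_iff.mp haa with rfl | rfl
  · refine hg (toPSL_eq_one_of_coprime (a := 1) ?_ (one_mul 1) h)
    apply (algebraMap F (AlgebraicClosure F)).injective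
    rw [← trace_extend, ht]; simp only [map_ofNat, mul_one]
  · refine hg (toPSL_eq_one_of_coprime (a := -1) ?_ (by ring) h)
    apply (algebraMap F (AlgebraicClosure F)).injective
    rw [← trace_extend, ht]; simp only [map_mul, map_neg, map_one, map_ofNat]

/-- The eigenvalue on `v` is multiplicative on the preimage of `S`, and `h` makes it injective; a
finite group embedding multiplicatively in a field is cyclic. -/
theorem isCyclic_of_le_stabilizer [Finite F] {v : Fin 2 → AlgebraicClosure F} (hv : v ≠ 0)
    (S : Subgroup (Matrix.ProjectiveSpecialLinearGroup (Fin 2) F))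
    (hS : S ≤ stabilizer _ (GeometricLine.mk v hv))
    (h : ∀ A, toPSL A ∈ S → (extend A).1 *ᵥ v = v → A = 1) : IsCyclic S := by
  let H := S.comap toPSL
  have he : ∀ A : H, ∃ c : AlgebraicClosure F, (extend A.1).1 *ᵥ v = c • v := fun A =>
    GeometricLine.smul_mk_eq_iff.mp (hS A.2)
  choose e he using he
  have hmul : ∀ A B, e (A * B) = e A * e B := by
    intro A B
    apply smul_left_injective _ hv
    simp only
    rw [← he, mul_smul, Subgroup.coe_mul, map_mul, Matrix.SpecialLinearGroup.coe_mul,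
      ← Matrix.mulVec_mulVec, he B, Matrix.mulVec_smul, he A, smul_smul, smul_smul, mul_comm]
  have hone : e 1 = 1 := by
    apply smul_left_injective _ hv
    simp only
    rw [← he, Subgroup.coe_one, map_one, Matrix.SpecialLinearGroup.coe_one, Matrix.one_mulVec,
      one_smul]
  let f : H →* AlgebraicClosure F := ⟨⟨e, hone⟩, hmul⟩
  have hf : Function.Injective f := by
    intro A B hAB
    have h1 : e A * e (A⁻¹ * B) = e A * 1 := by
      rw [← hmul, mul_inv_cancel_left, mul_one]
      exact hAB.symm
    have h0 : e A ≠ 0 := by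
      intro h0
      have := hmul A A⁻¹
      rw [mul_inv_cancel, hone, h0, zero_mul] at this
      exact one_ne_zero this
    have h2 := he (A⁻¹ * B)
    rw [mul_left_cancel₀ h0 h1, one_smul] at h2
    have h3 : A⁻¹ * B = 1 := Subtype.ext (h _ (A⁻¹ * B).2 h2)
    exact (inv_mul_eq_one.mp h3)
  have : IsCyclic H := isCyclic_of_injective_ringHom f hf
  exact isCyclic_of_surjective (toPSL.subgroupComap S)
    (MonoidHom.subgroupComap_surjective_of_surjective _ _ toPSL_surjective)

theorem trace_eq_two_of_fixed {K : Type*} [Field K] {M : Matrix (Fin 2) (Fin 2) K} (hM : M.det = 1)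
    {v : Fin 2 → K} (hv : v ≠ 0) (h : M *ᵥ v = v) : M.trace = 2 := by
  have := eigenvalue_root (a := 1) hM hv (by rw [h, one_smul])
  linear_combination -this

theorem isCyclic_stabilizer_inf [Finite F] {a b : GeometricLine F} (hab : a ≠ b) :
    IsCyclic (stabilizer (Matrix.ProjectiveSpecialLinearGroup (Fin 2) F) a ⊓ stabilizer _ b :
      Subgroup (Matrix.ProjectiveSpecialLinearGroup (Fin 2) F)) := by
  obtain ⟨u, hu, rfl⟩ := a.exists_mk
  obtain ⟨v, hv, rfl⟩ := b.exists_mk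
  refine isCyclic_of_le_stabilizer hu _ inf_le_left fun A hA hAu => ?_
  obtain ⟨c, hc⟩ := GeometricLine.smul_mk_eq_iff.mp (mem_stabilizer_iff.mp hA.2)
  have h1 := eigenvalue_root (extend A).2 hv hc
  rw [trace_eq_two_of_fixed (extend A).2 hu hAu] at h1
  have h2 : (c - 1) ^ 2 = 0 := by linear_combination h1
  have h3 : c = 1 := sub_eq_zero.mp (pow_eq_zero_iff two_ne_zero |>.mp h2)
  apply extend_injective
  rw [map_one]
  apply Subtype.ext
  have h4 := eq_smul_one_of_eigenvalue_eq (M := (extend A).1) (a := 1)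
    (GeometricLine.cross_ne_zero hab) (by rw [hAu, one_smul]) (by rw [hc, h3])
  rw [h4, one_smul]
  rfl

theorem isCyclic_of_le_stabilizer_of_coprime [Finite F] [Fact p.Prime] [CharP F p]
    (h2 : (2 : F) ≠ 0) (S : Subgroup (Matrix.ProjectiveSpecialLinearGroup (Fin 2) F))
    (a : GeometricLine F) (hS : (Nat.card S).Coprime p) (h : S ≤ stabilizer _ a) : IsCyclic S := by
  obtain ⟨v, hv, rfl⟩ := a.exists_mk
  refine isCyclic_of_le_stabilizer hv _ h fun A hA hAv => ?_
  have ht := trace_eq_two_of_fixed (extend A).2 hv hAv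
  have ht' : A.1.trace = 2 * 1 := by
    apply (algebraMap F (AlgebraicClosure F)).injective
    rw [← trace_extend, ht]; simp only [map_ofNat, mul_one]
  have hcop : (orderOf (toPSL A)).Coprime p :=
    Nat.Coprime.coprime_dvd_left (Subgroup.orderOf_dvd_natCard S hA) hS
  rcases toPSL_eq_one_iff.mp (toPSL_eq_one_of_coprime ht' (one_mul 1) hcop) with h | h
  · exact Subtype.ext h
  -- The matrix `-1` has trace `-2`, and `2 = -2` would make 4 vanish.
  · rw [h] at ht'
    exfalso
    apply h2
    have h4 : (2 : F) * 2 = 0 := by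
      simp at ht'
      linear_combination -ht'
    exact mul_self_eq_zero.mp h4

end PlaneActions


/-! ### Subgroups containing transvections -/

section Transvections

open Matrix MulAction

variable {p : ℕ} [Fact p.Prime]

theorem unipotent_pow {R : Type*} [CommRing R] (x : R) (k : ℕ) :
    !![1, x; 0, 1] ^ k = !![1, k * x; 0, 1] := by
  induction k with
  | zero => ext i j; fin_cases i <;> fin_cases j <;> simp
  | succ k ih =>
    rw [pow_succ, ih]
    ext i j
    fin_cases i <;> fin_cases j <;> simp
    ring

theorem unipotent_pow' {R : Type*} [CommRing R] (x : R) (k : ℕ) :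
    !![1, 0; x, 1] ^ k = !![1, 0; k * x, 1] := by
  induction k with
  | zero => ext i j; fin_cases i <;> fin_cases j <;> simp
  | succ k ih =>
    rw [pow_succ, ih]
    ext i j
    fin_cases i <;> fin_cases j <;> simp
    ring

/-- Two opposite transvections generate the special linear group over a prime field. -/
theorem eq_top_of_transvections {H : Subgroup (Matrix.SpecialLinearGroup (Fin 2) (ZMod p))}
    {x y : ZMod p} (hx : x ≠ 0) (hy : y ≠ 0) {U V : Matrix.SpecialLinearGroup (Fin 2) (ZMod p)}
    (hU : U ∈ H) (hV : V ∈ H) (hU' : U.1 = !![1, x; 0, 1]) (hV' : V.1 = !![1, 0; y, 1]) :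
    H = ⊤ := by
  -- Over a prime field every transvection is a power of a given nontrivial one with the same axis.
  have key : ∀ c x : ZMod p, x ≠ 0 → (((c / x).val : ℕ) : ZMod p) * x = c := by
    intro c x hx
    rw [ZMod.natCast_zmod_val, div_mul_cancel₀ _ hx]
  rw [eq_top_iff]
  rintro A -
  refine Matrix.SL2.transvection_induction (fun A => A ∈ H) ?_ (fun _ _ => mul_mem) A
  intro i j hij c
  fin_cases i <;> fin_cases j
  · exact absurd rfl hij
  · have : Matrix.SpecialLinearGroup.transvection hij c = U ^ (c / x).val := by
      apply Subtype.ext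
      rw [Matrix.SpecialLinearGroup.coe_pow, hU', unipotent_pow, key c x hx,
        Matrix.SpecialLinearGroup.transvection_coe]
      ext i j
      fin_cases i <;> fin_cases j <;> simp
    rw [this]
    exact pow_mem hU _
  · have : Matrix.SpecialLinearGroup.transvection hij c = V ^ (c / y).val := by
      apply Subtype.ext
      rw [Matrix.SpecialLinearGroup.coe_pow, hV', unipotent_pow', key c y hy,
        Matrix.SpecialLinearGroup.transvection_coe]
      ext i j
      fin_cases i <;> fin_cases j <;> simp
    rw [this]
    exact pow_mem hV _
  · exact absurd rfl hij

theorem exists_upper {F : Type*} [Field F] {A : Matrix.SpecialLinearGroup (Fin 2) F} (hA : A ≠ 1)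
    (h : A • ![1, 0] = (![1, 0] : Fin 2 → F)) : ∃ x, x ≠ 0 ∧ A.1 = !![1, x; 0, 1] := by
  have h' : A.1 *ᵥ ![1, 0] = ![1, 0] := h
  have h00 : A.1 0 0 = 1 := by simpa [Matrix.mulVec, dotProduct] using congrFun h' 0
  have h10 : A.1 1 0 = 0 := by simpa [Matrix.mulVec, dotProduct] using congrFun h' 1
  have hd := A.2
  rw [Matrix.det_fin_two, h00, h10, one_mul, mul_zero, sub_zero] at hd
  refine ⟨A.1 0 1, fun h01 => hA ?_, ?_⟩
  · apply Subtype.ext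
    ext i j
    fin_cases i <;> fin_cases j <;> simp [*]
  · ext i j
    fin_cases i <;> fin_cases j <;> simp [*]

theorem exists_lower {F : Type*} [Field F] {A : Matrix.SpecialLinearGroup (Fin 2) F} (hA : A ≠ 1)
    (h : A • ![0, 1] = (![0, 1] : Fin 2 → F)) : ∃ x, x ≠ 0 ∧ A.1 = !![1, 0; x, 1] := by
  have h' : A.1 *ᵥ ![0, 1] = ![0, 1] := h
  have h01 : A.1 0 1 = 0 := by simpa [Matrix.mulVec, dotProduct] using congrFun h' 0
  have h11 : A.1 1 1 = 1 := by simpa [Matrix.mulVec, dotProduct] using congrFun h' 1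
  have hd := A.2
  rw [Matrix.det_fin_two, h01, h11, mul_one, zero_mul, sub_zero] at hd
  refine ⟨A.1 1 0, fun h10 => hA ?_, ?_⟩
  · apply Subtype.ext
    ext i j
    fin_cases i <;> fin_cases j <;> simp [*]
  · ext i j
    fin_cases i <;> fin_cases j <;> simp [*]

/-- A proper subgroup of the special linear group over a prime field containing a transvection
fixes its axis. -/
theorem cross_eq_zero_of_transvection {H : Subgroup (Matrix.SpecialLinearGroup (Fin 2) (ZMod p))}
    (hH : H ≠ ⊤) {B : Matrix.SpecialLinearGroup (Fin 2) (ZMod p)} (hB : B ∈ H) (hB1 : B ≠ 1)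
    {v : Fin 2 → ZMod p} (hv : B • v = v) {A : Matrix.SpecialLinearGroup (Fin 2) (ZMod p)}
    (hA : A ∈ H) : cross v (A • v) = 0 := by
  by_contra hd
  set w := A • v with hw
  set d := cross v w with hd_def
  -- In the basis `v`, `w / d`, scaled to determinant one, `B` is upper unitriangular and `A * B *
  -- A⁻¹`, which fixes `w`, is lower unitriangular.
  let P : Matrix.SpecialLinearGroup (Fin 2) (ZMod p) := ⟨!![v 0, w 0 / d; v 1, w 1 / d], by
    rw [Matrix.det_fin_two_of]
    unfold cross at hd_def
    field_simp
    linear_combination -hd_def⟩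
  have hP0 : P • ![1, 0] = v := by
    change P.1 *ᵥ ![1, 0] = v
    ext i; fin_cases i <;> simp [P, Matrix.mulVec, dotProduct]
  have hP1 : P • ![0, 1] = d⁻¹ • w := by
    change P.1 *ᵥ ![0, 1] = d⁻¹ • w
    ext i; fin_cases i <;> simp [P, Matrix.mulVec, dotProduct, div_eq_inv_mul]
  obtain ⟨x, hx, hU⟩ := exists_upper (A := P⁻¹ * B * P) (by
      intro h
      apply hB1
      rw [mul_assoc, inv_mul_eq_one] at h
      exact (mul_eq_right.mp h.symm)) (by
      rw [mul_smul, mul_smul, hP0, hv, inv_smul_eq_iff, hP0])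
  obtain ⟨y, hy, hV⟩ := exists_lower (A := P⁻¹ * (A * B * A⁻¹) * P) (by
      intro h
      apply hB1
      rw [mul_assoc, inv_mul_eq_one] at h
      have h2 := mul_eq_right.mp h.symm
      rwa [mul_inv_eq_one, mul_eq_left] at h2) (by
      rw [mul_smul, mul_smul, hP1, inv_smul_eq_iff, hP1, smul_comm, mul_smul, mul_smul, hw,
        inv_smul_smul, hv])
  have htop := eq_top_of_transvections (H := H.comap (MulAut.conj P).toMonoidHom) hx hy
    (U := P⁻¹ * B * P) (V := P⁻¹ * (A * B * A⁻¹) * P)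
    (by
      rw [Subgroup.mem_comap]
      simpa [mul_assoc] using hB)
    (by
      rw [Subgroup.mem_comap]
      simpa [mul_assoc] using mul_mem hA (mul_mem hB (inv_mem hA))) hU hV
  apply hH
  rw [eq_top_iff]
  intro C _
  have : (MulAut.conj P)⁻¹ C ∈ H.comap (MulAut.conj P).toMonoidHom := htop ▸ Subgroup.mem_top _
  rw [Subgroup.mem_comap] at this
  simpa [mul_assoc] using this

theorem eq_top_of_comap_toPSL {F : Type*} [Field F]
    {S : Subgroup (Matrix.ProjectiveSpecialLinearGroup (Fin 2) F)} (h : S.comap toPSL = ⊤) :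
    S = ⊤ := by
  rw [eq_top_iff]
  intro g _
  obtain ⟨C, rfl⟩ := toPSL_surjective g
  exact (h ▸ Subgroup.mem_top C : C ∈ S.comap toPSL)

/-- By Cauchy there is an element of order `p`. The square of its lift has `p`-th power exactly 1,
since squaring removes the sign, and is nontrivial because `p` is odd. It is thus a transvection,
whose axis the preimage of `S` must preserve. -/
theorem fixesPoint_of_char_dvd_card (hp2 : p ≠ 2)
    (S : Subgroup (Matrix.ProjectiveSpecialLinearGroup (Fin 2) (ZMod p))) (hS : p ∣ Nat.card S)
    (hS1 : S ≠ ⊤) : FixesPoint S (GeometricLine (ZMod p)) := by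
  obtain ⟨s, hs⟩ := exists_prime_orderOf_dvd_card' p hS
  obtain ⟨A, hA⟩ := toPSL_surjective s.1
  have hord : orderOf (toPSL A) = p := by rw [hA, Subgroup.orderOf_coe, hs]
  have hB : toPSL (A * A) ∈ S := by rw [map_mul, hA]; exact mul_mem s.2 s.2
  have hB1 : A * A ≠ 1 := by
    intro h
    have h2 : toPSL A ^ 2 = 1 := by rw [pow_two, ← map_mul, h, map_one]
    have := orderOf_dvd_of_pow_eq_one h2
    rw [hord] at this
    exact hp2 ((Nat.prime_dvd_prime_iff_eq Fact.out Nat.prime_two).mp this)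
  have hBp : (A * A).1 ^ p = 1 := by
    have h := pow_orderOf_eq_one (toPSL A)
    rw [hord, ← map_pow, toPSL_eq_one_iff, Matrix.SpecialLinearGroup.coe_pow] at h
    rw [Matrix.SpecialLinearGroup.coe_mul, (Commute.refl A.1).mul_pow]
    rcases h with h | h <;> rw [h] <;> simp
  have hdet : ((A * A).1 - 1).det = 0 := by
    have : ((A * A).1 - 1) ^ p = 0 := by
      rw [sub_pow_char_of_commute p (Commute.one_right _), hBp, one_pow, sub_self]
    have h := congrArg Matrix.det this
    rw [Matrix.det_pow, Matrix.det_zero] at h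
    exact pow_eq_zero_iff (Fact.out : p.Prime).ne_zero |>.mp h
  obtain ⟨v, hv, hv'⟩ := Matrix.exists_mulVec_eq_zero_iff.mpr hdet
  rw [Matrix.sub_mulVec, Matrix.one_mulVec, sub_eq_zero] at hv'
  have hH : S.comap toPSL ≠ ⊤ := fun h => hS1 (eq_top_of_comap_toPSL h)
  have hinj := (algebraMap (ZMod p) (AlgebraicClosure (ZMod p))).injective
  have hv0 : (fun i => algebraMap (ZMod p) (AlgebraicClosure (ZMod p)) (v i)) ≠ 0 := by
    intro h
    apply hv
    ext i
    apply hinj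
    rw [congrFun h i]
    simp
  refine ⟨GeometricLine.mk _ hv0, fun g hg => ?_⟩
  obtain ⟨C, rfl⟩ := toPSL_surjective g
  have hc : cross (C • v) v = 0 := by
    have h := cross_eq_zero_of_transvection hH (B := A * A) hB hB1 hv' (A := C) hg
    unfold cross at h ⊢
    linear_combination -h
  obtain ⟨c, hc⟩ := exists_smul_of_cross_eq_zero hv hc
  refine GeometricLine.smul_mk_eq_iff.mpr ⟨algebraMap _ _ c, ?_⟩
  have hc' : C.1 *ᵥ v = c • v := hc.symm
  ext i
  rw [coe_extend]
  have := congrArg (algebraMap (ZMod p) (AlgebraicClosure (ZMod p))) (congrFun hc' i)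
  simpa [Matrix.mulVec, dotProduct] using this

end Transvections


/-! ### Elements of order five, and the upper bounds -/

section ProjectiveAction

open Matrix MulAction

variable {p : ℕ}

/-- Cayley–Hamilton gives `t⁴ - 3t² + 1 = 0` for the trace `t`, so `(2t² - 3)² = 5`. -/
theorem five_isSquare_of_orderOf_five {F : Type*} [Field F]
    {A : Matrix.SpecialLinearGroup (Fin 2) F} (h : orderOf (toPSL A) = 5) : IsSquare (5 : F) := by
  have h1 : toPSL A ≠ 1 := by rintro h'; rw [h', orderOf_one] at h; omega
  have h2 := pow_orderOf_eq_one (toPSL A)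
  set t := (A : Matrix (Fin 2) (Fin 2) F).trace with ht
  have h3 : (A.1 * A.1) * (A.1 * A.1) * A.1 = (t ^ 4 - 3 * t ^ 2 + 1) • A.1 - (t ^ 3 - 2 * t) • 1
      := by
    rw [mul_self_fin_two A.2, ← ht]
    simp only [sub_mul, mul_sub, one_mul, smul_mul_assoc, mul_one, mul_smul_comm,
      mul_self_fin_two A.2, ← ht]
    module
  rw [h, ← map_pow, toPSL_eq_one_iff, show A ^ 5 = (A * A) * (A * A) * A by simp only [pow_succ,
      pow_zero, one_mul, mul_assoc],
    Matrix.SpecialLinearGroup.coe_mul, Matrix.SpecialLinearGroup.coe_mul,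
    Matrix.SpecialLinearGroup.coe_mul, h3] at h2
  have h4 : t ^ 4 - 3 * t ^ 2 + 1 = 0 := by
    rcases h2 with h2 | h2
    · refine eq_zero_of_smul_eq h1 (s := 1 + (t ^ 3 - 2 * t)) ?_
      rw [sub_eq_iff_eq_add.mp h2, add_smul, one_smul]
    · refine eq_zero_of_smul_eq h1 (s := -1 + (t ^ 3 - 2 * t)) ?_
      rw [sub_eq_iff_eq_add.mp h2, add_smul, neg_smul, one_smul]
  exact ⟨2 * t ^ 2 - 3, by linear_combination -4 * h4⟩

theorem mul_self_mod_five : ∀ x : ZMod 5, x * x ≠ 2 ∧ x * x ≠ 3 := by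
  decide

/-- Quadratic reciprocity for `5 ≡ 1 mod 4` makes `p` a square mod 5, that is `±1`; oddness lifts
this to mod 10. -/
theorem modEq_of_five_isSquare (hp : p.Prime) (hp3 : 3 < p) (hp5 : p ≠ 5)
    (h : IsSquare (5 : ZMod p)) : (p : ℤ) ≡ 1 [ZMOD 10] ∨ (p : ℤ) ≡ -1 [ZMOD 10] := by
  have := Fact.mk hp
  have : Fact (Nat.Prime 5) := ⟨by norm_num⟩
  have h1 : IsSquare ((5 : ℕ) : ZMod p) := by exact_mod_cast h
  rw [← ZMod.exists_sq_eq_prime_iff_of_mod_four_eq_one (p := 5) (q := p) (by norm_num) (by omega),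
    ← ZMod.natCast_mod] at h1
  have hmod : p % 5 ≠ 0 := fun h0 =>
    hp5 ((Nat.prime_dvd_prime_iff_eq (by norm_num) hp).mp (Nat.dvd_of_mod_eq_zero h0)).symm
  have h2 : p % 5 = 1 ∨ p % 5 = 4 := by
    have hlt : p % 5 < 5 := Nat.mod_lt _ (by norm_num)
    revert h1 hmod hlt
    generalize p % 5 = r
    intro h1 hmod hlt
    interval_cases r
    · exact absurd rfl hmod
    · exact .inl rfl
    · obtain ⟨x, hx⟩ := h1
      exact absurd hx.symm (mul_self_mod_five x).1
    · obtain ⟨x, hx⟩ := h1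
      exact absurd hx.symm (mul_self_mod_five x).2
    · exact .inr rfl
  have h3 : p % 2 = 1 := hp.eq_two_or_odd.resolve_left (by omega)
  simp only [Int.ModEq]
  omega

/-- A nontrivial upper unitriangular matrix fixes only one point. -/
theorem eq_of_upper_fixed {F : Type*} [Field F] {A : Matrix.SpecialLinearGroup (Fin 2) F} {x : F}
    (hx : x ≠ 0) (hA : A.1 = !![1, x; 0, 1]) {v : Fin 2 → AlgebraicClosure F} {hv : v ≠ 0}
    (h : toPSL A • GeometricLine.mk v hv = GeometricLine.mk v hv) : v 1 = 0 := by
  obtain ⟨c, hc⟩ := GeometricLine.smul_mk_eq_iff.mp h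
  rw [coe_extend, hA] at hc
  have h0 := congrFun hc 0
  have h1 := congrFun hc 1
  simp [Matrix.mulVec, dotProduct] at h0 h1
  by_contra hv1
  have hc1 : c = 1 := mul_right_cancel₀ hv1 (by rw [← h1, one_mul])
  subst hc1
  have : algebraMap F (AlgebraicClosure F) x * v 1 = 0 := by linear_combination h0
  rcases mul_eq_zero.mp this with h | h
  · exact hx ((algebraMap F (AlgebraicClosure F)).injective (by rw [h, map_zero]))
  · exact hv1 h

theorem eq_of_lower_fixed {F : Type*} [Field F] {A : Matrix.SpecialLinearGroup (Fin 2) F} {x : F}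
    (hx : x ≠ 0) (hA : A.1 = !![1, 0; x, 1]) {v : Fin 2 → AlgebraicClosure F} {hv : v ≠ 0}
    (h : toPSL A • GeometricLine.mk v hv = GeometricLine.mk v hv) : v 0 = 0 := by
  obtain ⟨c, hc⟩ := GeometricLine.smul_mk_eq_iff.mp h
  rw [coe_extend, hA] at hc
  have h0 := congrFun hc 0
  have h1 := congrFun hc 1
  simp [Matrix.mulVec, dotProduct] at h0 h1
  by_contra hv1
  have hc1 : c = 1 := mul_right_cancel₀ hv1 (by rw [← h0, one_mul])
  subst hc1
  have : algebraMap F (AlgebraicClosure F) x * v 0 = 0 := by linear_combination h1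
  rcases mul_eq_zero.mp this with h | h
  · exact hx ((algebraMap F (AlgebraicClosure F)).injective (by rw [h, map_zero]))
  · exact hv1 h

/-- The upper unitriangular matrix with entry `x`. -/
def upper {F : Type*} [Field F] (x : F) : Matrix.SpecialLinearGroup (Fin 2) F :=
  ⟨!![1, x; 0, 1], by simp⟩

/-- The lower unitriangular matrix with entry `x`. -/
def lower {F : Type*} [Field F] (x : F) : Matrix.SpecialLinearGroup (Fin 2) F :=
  ⟨!![1, 0; x, 1], by simp⟩

theorem upper_mul_self {F : Type*} [Field F] (x : F) : upper x * upper x = upper (2 * x) := by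
  apply Subtype.ext
  rw [Matrix.SpecialLinearGroup.coe_mul]
  change !![1, x; 0, 1] * !![1, x; 0, 1] = !![1, 2 * x; 0, 1]
  ext i j
  fin_cases i <;> fin_cases j <;> simp
  ring

theorem not_fixesPoint_geometricLine {F : Type*} [Field F] :
    ¬ FixesPoint (⊤ : Subgroup (Matrix.ProjectiveSpecialLinearGroup (Fin 2) F))
      (GeometricLine F) := by
  rintro ⟨a, ha⟩
  obtain ⟨v, hv, rfl⟩ := a.exists_mk
  have h1 := eq_of_upper_fixed one_ne_zero rfl (ha (toPSL (upper 1)) trivial)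
  have h0 := eq_of_lower_fixed one_ne_zero rfl (ha (toPSL (lower 1)) trivial)
  exact hv (by ext i; fin_cases i <;> assumption)

/-- The square of a transvection would fix both points of the pair, but in odd characteristic it is
a nontrivial transvection with a single fixed point. -/
theorem not_fixesPair_geometricLine {F : Type*} [Field F] (h2 : (2 : F) ≠ 0) :
    ¬ FixesPair (⊤ : Subgroup (Matrix.ProjectiveSpecialLinearGroup (Fin 2) F))
      (GeometricLine F) := by
  rintro ⟨a, b, hab, h⟩
  obtain ⟨u, hu, rfl⟩ := a.exists_mk
  obtain ⟨v, hv, rfl⟩ := b.exists_mk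
  have hU : toPSL (upper (2 * 1 : F)) • GeometricLine.mk u hu = GeometricLine.mk u hu ∧
      toPSL (upper (2 * 1 : F)) • GeometricLine.mk v hv = GeometricLine.mk v hv := by
    rw [← upper_mul_self, map_mul, mul_smul, mul_smul]
    rcases h (toPSL (upper 1)) trivial with ⟨h1, h2⟩ | ⟨h1, h2⟩
    · exact ⟨by rw [h1, h1], by rw [h2, h2]⟩
    · exact ⟨by rw [h1, h2], by rw [h2, h1]⟩
  have hu1 := eq_of_upper_fixed (mul_ne_zero h2 one_ne_zero) rfl hU.1
  have hv1 := eq_of_upper_fixed (mul_ne_zero h2 one_ne_zero) rfl hU.2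
  apply GeometricLine.cross_ne_zero hab
  simp [cross, hu1, hv1]

theorem ofNat_ne_zero_of_coprime {n : ℕ} (hp : p.Prime) (hn : n.Coprime p) : (n : ZMod p) ≠ 0 := by
  have := Fact.mk hp
  rw [Ne, ZMod.natCast_eq_zero_iff]
  exact fun h => hp.one_lt.ne' (Nat.Coprime.eq_one_of_dvd hn.symm h)

/-- The action on the geometric projective line. -/
theorem moebiusAction [Fact p.Prime] (hp3 : 3 < p)
    (h1 : ¬ (p : ℤ) ≡ 1 [ZMOD 10]) (h9 : ¬ (p : ℤ) ≡ -1 [ZMOD 10]) :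
    MoebiusAction p (Matrix.ProjectiveSpecialLinearGroup (Fin 2) (ZMod p))
      (GeometricLine (ZMod p)) := by
  have hp : p.Prime := Fact.out
  have c2 : Nat.Coprime 2 p := (Nat.coprime_primes Nat.prime_two hp).mpr (by omega)
  have h2 : (2 : ZMod p) ≠ 0 := by exact_mod_cast ofNat_ne_zero_of_coprime hp c2
  refine ⟨c2, (Nat.coprime_primes Nat.prime_three hp).mpr (by omega), hp,
    Finite.of_surjective _ toPSL_surjective, ⟨GeometricLine.mk ![1, 0] (by simp)⟩,
    threeFixedPointsTrivial_geometricLine, exists_two_fixed_points, isCyclic_stabilizer_inf,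
    fun S a hS h => isCyclic_of_le_stabilizer_of_coprime h2 S a hS h,
    fun S hS hS1 => fixesPoint_of_char_dvd_card (by omega) S hS hS1, ?_,
    not_fixesPoint_geometricLine, not_fixesPair_geometricLine h2⟩
  intro g hg h5
  obtain ⟨A, rfl⟩ := toPSL_surjective g
  have hp5 : p ≠ 5 := by
    rintro rfl
    rw [h5] at hg
    exact absurd hg (by decide)
  rcases modEq_of_five_isSquare hp hp3 hp5 (five_isSquare_of_orderOf_five h5) with h | h
  · exact h1 h
  · exact h9 h

theorem length_le_four [Fact p.Prime] (hp3 : 3 < p)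
    (h1 : ¬ (p : ℤ) ≡ 1 [ZMOD 10]) (h9 : ¬ (p : ℤ) ≡ -1 [ZMOD 10]) {n : ℕ}
    {g : Fin n → Matrix.ProjectiveSpecialLinearGroup (Fin 2) (ZMod p)}
    (hg : IsIrredundantGenerating g) : n ≤ 4 := by
  by_contra! h
  have := (moebiusAction hp3 h1 h9).length_eq_four hg h.le
  omega

theorem length_le_three [Fact p.Prime] (hp3 : 3 < p)
    (h1 : ¬ (p : ℤ) ≡ 1 [ZMOD 10]) (h9 : ¬ (p : ℤ) ≡ -1 [ZMOD 10]) (h7 : p ≠ 7) {n : ℕ}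
    {g : Fin n → Matrix.ProjectiveSpecialLinearGroup (Fin 2) (ZMod p)}
    (hg : IsIrredundantGenerating g) : n ≤ 3 := by
  by_contra! h
  have hp : p.Prime := Fact.out
  have hM := moebiusAction hp3 h1 h9
  obtain rfl := hM.length_eq_four hg h
  have h2 := ofNat_ne_zero_of_coprime hp hM.coprime_two
  have h3 := ofNat_ne_zero_of_coprime hp hM.coprime_three
  have h7 := ofNat_ne_zero_of_coprime hp
    ((Nat.coprime_primes (by norm_num : Nat.Prime 7) hp).mpr (Ne.symm h7))
  refine hM.not_isIrredundantGenerating_four (by exact_mod_cast h2) (by exact_mod_cast h3) ?_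
    (by exact_mod_cast h7) hg
  -- In characteristic 5 the required square root of 2 does not exist.
  intro h5
  have h5' : ((5 : ℕ) : ZMod p) = 0 := by exact_mod_cast h5
  rw [ZMod.natCast_eq_zero_iff, Nat.prime_dvd_prime_iff_eq hp (by norm_num)] at h5'
  subst h5'
  exact fun x => by rw [pow_two]; exact (mul_self_mod_five x).1

end ProjectiveAction


/-! ### Three involutions generating `PSL(2, p)` -/

section IrredundantSequences

open Matrix

variable {G : Type*} [Group G]

/-- A group generated by involutions acting on a set by conjugation normalizes it. -/
theorem closure_ne_top_of_conj_mem {s T : Set G} (hs : ∀ g ∈ s, g * g = 1)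
    (hT : ∀ g ∈ s, ∀ t ∈ T, g * t * g⁻¹ ∈ T) (hN : Subgroup.normalizer T ≠ ⊤) :
    Subgroup.closure s ≠ ⊤ := by
  intro h
  apply hN
  rw [eq_top_iff, ← h, Subgroup.closure_le]
  intro g hg
  rw [SetLike.mem_coe, Subgroup.mem_set_normalizer_iff]
  intro t
  refine ⟨hT g hg t, fun ht => ?_⟩
  have h1 := hT g hg _ ht
  have h2 : g * (g * t * g⁻¹) * g⁻¹ = (g * g) * t * (g * g)⁻¹ := by group
  rwa [h2, hs g hg, one_mul, inv_one, mul_one] at h1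

/-- A nonabelian simple group is not generated by two involutions. -/
theorem closure_pair_ne_top [IsSimpleGroup G] {a b : G} (hab : a * b ≠ b * a) {x y : G}
    (hx : x * x = 1) (hy : y * y = 1) : Subgroup.closure {x, y} ≠ ⊤ := by
  intro hxy
  have hx' : x⁻¹ = x := inv_eq_of_mul_eq_one_left hx
  have hy' : y⁻¹ = y := inv_eq_of_mul_eq_one_left hy
  -- Each involution exchanges `x * y` and its inverse `y * x`, so the cyclic group they generate is
  -- normal. Simplicity makes it trivial or everything, and either way the group is abelian.
  have hN : Subgroup.normalizer {x * y, y * x} = ⊤ := by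
    by_contra hN
    refine closure_ne_top_of_conj_mem (s := {x, y}) ?_ ?_ hN hxy
    · rintro g (rfl | rfl) <;> assumption
    · have h1 : x * (x * y) * x = y * x := by rw [← mul_assoc, hx, one_mul]
      have h2 : x * (y * x) * x = x * y := by simp only [mul_assoc, hx, mul_one]
      have h3 : y * (x * y) * y = y * x := by simp only [mul_assoc, hy, mul_one]
      have h4 : y * (y * x) * y = x * y := by rw [← mul_assoc, hy, one_mul]
      rintro g (rfl | rfl) t (rfl | rfl) <;>
        simp [hx', hy', h1, h2, h3, h4]
  have hnormal : (Subgroup.closure {x * y, y * x}).Normal := by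
    rw [← Subgroup.normalizer_eq_top_iff, eq_top_iff, ← hN]
    exact Subgroup.normalizer_le_normalizer_closure _
  have hcomm : ∀ u v : G, u ∈ Subgroup.closure {x * y, y * x} →
      v ∈ Subgroup.closure {x * y, y * x} → u * v = v * u := by
    have hle : Subgroup.closure {x * y, y * x} ≤ Subgroup.zpowers (x * y) := by
      rw [Subgroup.closure_le]
      rintro _ (rfl | rfl)
      · exact Subgroup.mem_zpowers _
      · rw [show y * x = (x * y)⁻¹ by rw [_root_.mul_inv_rev, hx', hy']]
        exact inv_mem (Subgroup.mem_zpowers _)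
    intro u v hu hv
    obtain ⟨i, rfl⟩ := hle hu
    obtain ⟨j, rfl⟩ := hle hv
    exact (Commute.zpow_zpow_self _ i j).eq
  rcases hnormal.eq_bot_or_eq_top with h | h
  · have h1 : x * y = 1 := by
      rw [← Subgroup.mem_bot, ← h]
      exact Subgroup.subset_closure (by simp)
    have h2 : x = y := by rw [eq_inv_of_mul_eq_one_left h1, hy']
    subst h2
    rw [Set.pair_eq_singleton, ← Subgroup.zpowers_eq_closure] at hxy
    obtain ⟨i, rfl⟩ := (hxy ▸ Subgroup.mem_top a : a ∈ Subgroup.zpowers x)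
    obtain ⟨j, rfl⟩ := (hxy ▸ Subgroup.mem_top b : b ∈ Subgroup.zpowers x)
    exact hab (Commute.zpow_zpow_self _ i j).eq
  · exact hab (hcomm a b (h ▸ Subgroup.mem_top a) (h ▸ Subgroup.mem_top b))

theorem toPSL_mul_self {F : Type*} [Field F] {A : Matrix.SpecialLinearGroup (Fin 2) F}
    (h : A.1.trace = 0) : toPSL A * toPSL A = 1 := by
  rw [← map_mul, toPSL_eq_one_iff, Matrix.SpecialLinearGroup.coe_mul, mul_self_fin_two A.2, h]
  right
  rw [zero_smul, zero_sub]

variable {p : ℕ} [Fact p.Prime]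

/-- A subgroup containing a transvection and an element moving its axis is everything. -/
theorem eq_top_of_transvection_mem
    {S : Subgroup (Matrix.ProjectiveSpecialLinearGroup (Fin 2) (ZMod p))}
    {A B : Matrix.SpecialLinearGroup (Fin 2) (ZMod p)} (hA : toPSL A ∈ S) (hB : toPSL B ∈ S)
    (hB1 : B ≠ 1) {v : Fin 2 → ZMod p} (hv : B • v = v) (h : cross v (A • v) ≠ 0) : S = ⊤ := by
  by_contra hS
  exact h (cross_eq_zero_of_transvection (fun h => hS (eq_top_of_comap_toPSL h))
    (B := B) hB hB1 hv hA)

theorem toPSL_upper_lower_not_commute (hp3 : 3 < p) :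
    toPSL (upper (1 : ZMod p)) * toPSL (lower 1) ≠ toPSL (lower 1) * toPSL (upper 1) := by
  have hp : p.Prime := Fact.out
  have h3 : ((3 : ℕ) : ZMod p) ≠ 0 :=
    ofNat_ne_zero_of_coprime hp ((Nat.coprime_primes Nat.prime_three hp).mpr (by omega))
  rw [← map_mul, ← map_mul, Ne, toPSL_eq_iff, Matrix.SpecialLinearGroup.coe_mul,
    Matrix.SpecialLinearGroup.coe_mul]
  rintro (h | h)
  · have := congrFun (congrFun h 0) 0
    simp [upper, lower] at this
  · have := congrFun (congrFun h 0) 0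
    simp [upper, lower] at this
    apply h3
    push_cast
    linear_combination this

/-- Three involutions generating `PSL(2, p)`. -/
def threeInvolutions (p : ℕ) : Fin 3 → Matrix.SpecialLinearGroup (Fin 2) (ZMod p) :=
  ![⟨!![1, 1; -2, -1], by rw [Matrix.det_fin_two_of]; ring⟩,
    ⟨!![0, 1; -1, 0], by rw [Matrix.det_fin_two_of]; ring⟩,
    ⟨!![-2, 5; -1, 2], by rw [Matrix.det_fin_two_of]; ring⟩]

theorem isIrredundantGenerating_three (hp3 : 3 < p) :
    IsIrredundantGenerating fun i => toPSL (threeInvolutions p i) := by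
  have hp : p.Prime := Fact.out
  have h3 : ((3 : ℕ) : ZMod p) ≠ 0 :=
    ofNat_ne_zero_of_coprime hp ((Nat.coprime_primes Nat.prime_three hp).mpr (by omega))
  have htr : ∀ i, (threeInvolutions p i).1.trace = 0 := by
    intro i; fin_cases i <;> simp [threeInvolutions, Matrix.trace_fin_two]
  -- The entries are chosen so that the product is a transvection, nontrivial since `p ≠ 3`, whose
  -- axis the second involution moves.
  have hword : (threeInvolutions p 0 * threeInvolutions p 1 * threeInvolutions p 2).1 =
      !![1, -3; 0, 1] := by
    rw [Matrix.SpecialLinearGroup.coe_mul, Matrix.SpecialLinearGroup.coe_mul]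
    ext i j
    fin_cases i <;> fin_cases j <;> simp [threeInvolutions] <;> ring
  constructor
  · have hmem : ∀ i, toPSL (threeInvolutions p i) ∈
        Subgroup.closure (Set.range fun i => toPSL (threeInvolutions p i)) :=
      fun i => Subgroup.subset_closure ⟨i, rfl⟩
    refine eq_top_of_transvection_mem (A := threeInvolutions p 1)
      (B := threeInvolutions p 0 * threeInvolutions p 1 * threeInvolutions p 2) (v := ![1, 0])
      (hmem 1) ?_ ?_ ?_ ?_
    · rw [map_mul, map_mul]
      exact mul_mem (mul_mem (hmem 0) (hmem 1)) (hmem 2)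
    · intro h
      have := congrFun (congrFun (congrArg Subtype.val h) 0) 1
      rw [hword] at this
      simp at this
      exact h3 (by exact_mod_cast this)
    · change (threeInvolutions p 0 * threeInvolutions p 1 * threeInvolutions p 2).1 *ᵥ ![1, 0] = _
      rw [hword]
      ext i; fin_cases i <;> simp [Matrix.mulVec, dotProduct]
    · change cross ![1, 0] ((threeInvolutions p 1).1 *ᵥ ![1, 0]) ≠ 0
      simp [cross, threeInvolutions, Matrix.mulVec, dotProduct]
  · intro j
    have := Matrix.ProjectiveSpecialLinearGroup.rank_two_simple (F := ZMod p) (by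
      rw [Nat.card_zmod]; omega)
    obtain ⟨k, l, hkl⟩ : ∃ k l : Fin 3, ∀ i, i ≠ j → i = k ∨ i = l := by
      revert j; decide
    intro htop
    refine closure_pair_ne_top (toPSL_upper_lower_not_commute hp3) (toPSL_mul_self (htr k))
      (toPSL_mul_self (htr l)) ?_
    rw [eq_top_iff, ← htop]
    refine Subgroup.closure_mono ?_
    rintro _ ⟨i, hi, rfl⟩
    rcases hkl i hi with rfl | rfl <;> simp

end IrredundantSequences


/-! ### Four involutions generating `PSL(2, 7)` -/

section LengthFour

open Matrix

/-- The image of a matrix over the field with seven elements given by its entries. -/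
def mk₇ (a b c d : ZMod 7) (h : a * d - b * c = 1) : Matrix.SpecialLinearGroup (Fin 2) (ZMod 7) :=
  ⟨!![a, b; c, d], by rwa [Matrix.det_fin_two_of]⟩

/-- Four involutions generating `PSL(2, 7)`. -/
def fourInvolutions : Fin 4 → Matrix.SpecialLinearGroup (Fin 2) (ZMod 7) :=
  ![mk₇ 0 1 6 0 (by decide), mk₇ 1 5 1 6 (by decide), mk₇ 2 3 3 5 (by decide),
    mk₇ 2 6 5 5 (by decide)]

/-- The involutions of a Klein four-group normalized by all but one of the terms of
`fourInvolutions`. -/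
def kleinInvolutions : Fin 4 → Fin 3 → Matrix.SpecialLinearGroup (Fin 2) (ZMod 7) :=
  ![![mk₇ 2 2 1 5 (by decide), mk₇ 1 6 2 6 (by decide), mk₇ 1 4 3 6 (by decide)],
    ![mk₇ 3 5 5 4 (by decide), mk₇ 3 3 6 4 (by decide), mk₇ 3 6 3 4 (by decide)],
    ![mk₇ 1 1 5 6 (by decide), mk₇ 1 5 1 6 (by decide), mk₇ 2 4 4 5 (by decide)],
    ![mk₇ 3 2 2 4 (by decide), mk₇ 0 1 6 0 (by decide), mk₇ 2 4 4 5 (by decide)]]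

/-- Equality up to sign of matrices over the field with seven elements. -/
def EqUpToSign (A B : Matrix.SpecialLinearGroup (Fin 2) (ZMod 7)) : Prop :=
  A.1 = B.1 ∨ A.1 = -B.1

instance (A B : Matrix.SpecialLinearGroup (Fin 2) (ZMod 7)) : Decidable (EqUpToSign A B) := by
  unfold EqUpToSign; infer_instance

instance : Fact (Nat.Prime 7) := ⟨by norm_num⟩

theorem toPSL_eq_iff_eqUpToSign {A B : Matrix.SpecialLinearGroup (Fin 2) (ZMod 7)} :
    toPSL A = toPSL B ↔ EqUpToSign A B :=
  toPSL_eq_iff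

theorem fourInvolutions_conj : ∀ j i : Fin 4, i ≠ j → ∀ k, ∃ l,
    EqUpToSign (fourInvolutions i * kleinInvolutions j k)
      (kleinInvolutions j l * fourInvolutions i) := by
  decide +kernel

/-- The omitted term does not normalize the corresponding Klein four-group, so the normalizer
containing the other three terms is proper. -/
theorem fourInvolutions_not_conj : ∀ j : Fin 4, ∃ k, ∀ l,
    ¬ EqUpToSign (fourInvolutions j * kleinInvolutions j k)
      (kleinInvolutions j l * fourInvolutions j) := by
  decide +kernel

theorem isIrredundantGenerating_four :
    IsIrredundantGenerating fun i => toPSL (fourInvolutions i) := by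
  constructor
  · have hmem : ∀ i, toPSL (fourInvolutions i) ∈
        Subgroup.closure (Set.range fun i => toPSL (fourInvolutions i)) :=
      fun i => Subgroup.subset_closure ⟨i, rfl⟩
    -- An explicit word that is a transvection; `fourInvolutions 0` moves its axis, so the four
    -- terms generate.
    have hword : (fourInvolutions 1 * fourInvolutions 0 * fourInvolutions 3 * fourInvolutions 2) ^
        2 =
        lower (4 : ZMod 7) := by
      decide +kernel
    refine eq_top_of_transvection_mem (A := fourInvolutions 0) (B := lower (4 : ZMod 7))
      (v := ![0, 1]) (hmem 0) ?_ ?_ ?_ ?_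
    · rw [← hword, map_pow, map_mul, map_mul, map_mul]
      exact pow_mem (mul_mem (mul_mem (mul_mem (hmem 1) (hmem 0)) (hmem 3)) (hmem 2)) 2
    · decide +kernel
    · change (lower (4 : ZMod 7)).1 *ᵥ ![0, 1] = _
      ext i
      revert i
      decide +kernel
    · change cross ![0, 1] ((fourInvolutions 0).1 *ᵥ ![0, 1]) ≠ 0
      decide +kernel
  · intro j
    refine closure_ne_top_of_conj_mem (T := Set.range fun k => toPSL (kleinInvolutions j k)) ?_ ?_
        ?_
    · rintro _ ⟨i, -, rfl⟩
      apply toPSL_mul_self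
      revert i
      decide +kernel
    · rintro _ ⟨i, hi, rfl⟩ _ ⟨k, rfl⟩
      obtain ⟨l, hl⟩ := fourInvolutions_conj j i hi k
      rw [← toPSL_eq_iff_eqUpToSign, map_mul, map_mul] at hl
      exact ⟨l, by rw [eq_mul_inv_iff_mul_eq]; exact hl.symm⟩
    · intro h
      obtain ⟨k, hk⟩ := fourInvolutions_not_conj j
      have hj : toPSL (fourInvolutions j) ∈
          Subgroup.normalizer (Set.range fun k => toPSL (kleinInvolutions j k)) := h ▸
              Subgroup.mem_top _
      obtain ⟨l, hl⟩ := (Subgroup.mem_set_normalizer_iff.mp hj _).mp ⟨k, rfl⟩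
      apply hk l
      rw [← toPSL_eq_iff_eqUpToSign, map_mul, map_mul]
      exact (eq_mul_inv_iff_mul_eq.mp hl).symm

end LengthFour

theorem maxIrredundantLength_eq {G : Type*} [Group G] {n : ℕ} {g : Fin n → G}
    (hg : IsIrredundantGenerating g)
    (h : ∀ (k : ℕ) (f : Fin k → G), IsIrredundantGenerating f → k ≤ n) :
    maxIrredundantLength G = n :=
  le_antisymm (iSup₂_le fun k ⟨f, hf⟩ => Nat.cast_le.mpr (h k f hf))
    (le_iSup₂_of_le n ⟨g, hg⟩ le_rfl)

theorem theorem3 (p : ℕ) (hp : p.Prime) (hp3 : 3 < p)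
    (h1 : ¬ (p : ℤ) ≡ 1 [ZMOD 10]) (h9 : ¬ (p : ℤ) ≡ -1 [ZMOD 10]) :
    (p ≠ 7 →
      maxIrredundantLength (Matrix.ProjectiveSpecialLinearGroup (Fin 2) (ZMod p)) = 3) ∧
    (p = 7 →
      maxIrredundantLength (Matrix.ProjectiveSpecialLinearGroup (Fin 2) (ZMod p)) = 4) := by
  have := Fact.mk hp
  constructor
  · intro h7
    exact maxIrredundantLength_eq (isIrredundantGenerating_three hp3)
      fun _ _ hf => length_le_three hp3 h1 h9 h7 hf
  · rintro rfl
    exact maxIrredundantLength_eq isIrredundantGenerating_four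
      fun _ _ hf => length_le_four hp3 h1 h9 hf
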